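/- **Theorem (Well-posedness with neutrality).** Fix a real number $s\ge 2$, $k\in\{1,-1\}$ and $\nu\ge 0$. Let $c=c(t,x)$ be a continuous background state on $[0,\infty)\times\mathbb R$ with $0<c_-\le c(t,x)\le c_+$ for constants $c_\pm$, and assume $$\partial_t c\in L^\infty(\mathbb R_+;H^s\cap\dot H^{-1}\cap L^1(\mathbb R)),\qquad \partial_x c\in L^\infty(\mathbb R_+;H^s(\mathbb R)).$$ Put $c_0=c(0,\cdot)$, and let $\rho_0,u_0:\mathbb R\to\mathbb R$ (taken as their continuous representatives) satisfy $$(\rho_0-c_0,\;u_0)\in \big(H^s\cap\dot H^{-1}\cap L^1(\mathbb R)\big)\times\big(H^{s+1}\cap BV(\mathbb R)\big),$$ where $u_0\in BV(\mathbb R)$ means that $u_0$ has finite total variation on $\mathbb R$. Then there are $T>0$ and functions $\rho,u$ of class $\mathcal C^1$ on $[0,T)\times\mathbb R$ (that is, $f,\partial_tf,\partial_xf$ are continuous on $[0,T)\times\mathbb R$, and bounded on $[0,T']\times\mathbb R$ for every $T'<T$, for $f=\rho,u$) such that $(\rho,u)(0,\cdot)=(\rho_0,u_0)$, the Euler–Poisson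 system $$\partial_t\rho+\partial_x(\rho u)=0,\qquad \partial_tu+u\,\partial_xu=-\nu u-k\,\partial_x\phi,\qquad -\partial_{xx}\phi=\rho-c$$ holds at every point of $[0,T)\times\mathbb R$ for some potential $\phi$ with $\partial_x\phi(t,\cdot)\in L^2(\mathbb R)$ for all $t\in[0,T)$, the neutrality condition $$\rho(t,\cdot)-c(t,\cdot)\in L^1(\mathbb R),\qquad \int_{\mathbb R}(\rho(t,x)-c(t,x))\,dx=0\qquad\text{for all }t\in[0,T)$$ holds, and $$\sup_{0\le t<T}\Big(\|(\rho-c)(t)\|_{L^1}+\|(\partial_xu)(t)\|_{L^1}\Big)<\infty .$$ -/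

import Mathlib

open MeasureTheory Set
open scoped ENNReal NNReal FourierTransform

noncomputable section

/-- The (extended-valued) norm of `H^s(ℝ)`, `s ≥ 0`: the `L²` norm of `(1 + |ξ|²)^(s/2) f̂(ξ)`, where
`f̂` is the Plancherel Fourier transform of `f ∈ L²`. It is `∞` if `f ∉ L²`. -/
def sobolevENorm (s : ℝ) (f : ℝ → ℝ) : ℝ≥0∞ :=
  open Classical in
  if hf : MemLp (fun x => (f x : ℂ)) 2 (volume : Measure ℝ) then
    eLpNorm (fun ξ : ℝ => (((1 + |ξ| ^ 2) ^ (s / 2) : ℝ) : ℂ) *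
      (𝓕 (hf.toLp (fun x => (f x : ℂ))) : Lp ℂ 2 (volume : Measure ℝ)) ξ) 2 volume
  else ⊤

/-- The (extended-valued) norm of the homogeneous space `Ḣ^{-1}(ℝ)`, on functions `f ∈ L²(ℝ)`: the
`L²` norm of `|ξ|⁻¹ f̂(ξ)`. It is only used for the intersections `H^s ∩ Ḣ^{-1}` with `s ≥ 0`, so it
is set to `∞` if `f ∉ L²`. -/
def homSobolevNegOneENorm (f : ℝ → ℝ) : ℝ≥0∞ :=
  open Classical in
  if hf : MemLp (fun x => (f x : ℂ)) 2 (volume : Measure ℝ) then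
    eLpNorm (fun ξ : ℝ => ((|ξ|⁻¹ : ℝ) : ℂ) *
      (𝓕 (hf.toLp (fun x => (f x : ℂ))) : Lp ℂ 2 (volume : Measure ℝ)) ξ) 2 volume
  else ⊤

/-- Background states `c(t,x)`, `t ≥ 0`, `x ∈ ℝ`: continuous, with values in `[c₋, c₊]`,
`c₋ > 0`, such that `∂ₜc ∈ L^∞(ℝ₊; H^s ∩ Ḣ^{-1} ∩ L¹)` and `∂ₓc ∈ L^∞(ℝ₊; H^s)`. The time derivative
is understood in the integrated (weak) sense: `ct` represents it when
`c(t,x) = c(0,x) + ∫₀ᵗ ct(τ,x) dτ`. -/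
structure IsBackground (s cmin cmax : ℝ) (c : ℝ → ℝ → ℝ) : Prop where
  cmin_pos : 0 < cmin
  lower : ∀ t, 0 ≤ t → ∀ x, cmin ≤ c t x
  upper : ∀ t, 0 ≤ t → ∀ x, c t x ≤ cmax
  continuousOn : ContinuousOn (Function.uncurry c) (Ici 0 ×ˢ univ)
  time_deriv : ∃ ct : ℝ → ℝ → ℝ, Measurable (Function.uncurry ct) ∧
    (∀ t, 0 ≤ t → ∀ᵐ x, IntervalIntegrable (fun τ => ct τ x) volume 0 t ∧
      c t x = c 0 x + ∫ τ in (0 : ℝ)..t, ct τ x) ∧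
    ∃ M : ℝ≥0, ∀ᵐ t ∂(volume.restrict (Ici (0 : ℝ))),
      sobolevENorm s (ct t) ≤ M ∧ homSobolevNegOneENorm (ct t) ≤ M ∧
        eLpNorm (ct t) 1 volume ≤ M
  space_deriv : ∃ M : ℝ≥0, ∀ᵐ t ∂(volume.restrict (Ici (0 : ℝ))),
    Differentiable ℝ (c t) ∧ sobolevENorm s (deriv (c t)) ≤ M

/-- The time derivative on `[0,T)` (one-sided at `t = 0`). -/
def timeDeriv (T : ℝ) (f : ℝ → ℝ → ℝ) (t x : ℝ) : ℝ :=
  derivWithin (fun τ => f τ x) (Ico 0 T) t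

/-- The space derivative. -/
def spaceDeriv (f : ℝ → ℝ → ℝ) (t x : ℝ) : ℝ :=
  deriv (f t) x

/-- Functions of class `C¹` on `[0,T) × ℝ`: `f`, `∂ₜf`, `∂ₓf` exist and are continuous, and
`|f| + |∂ₜf| + |∂ₓf|` is bounded on `[0,T'] × ℝ` for every `T' < T`. -/
structure IsClassC1 (T : ℝ) (f : ℝ → ℝ → ℝ) : Prop where
  diff_time : ∀ t ∈ Ico 0 T, ∀ x, DifferentiableWithinAt ℝ (fun τ => f τ x) (Ico 0 T) t
  diff_space : ∀ t ∈ Ico 0 T, Differentiable ℝ (f t)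
  cont : ContinuousOn (Function.uncurry f) (Ico 0 T ×ˢ univ)
  cont_time : ContinuousOn (Function.uncurry (timeDeriv T f)) (Ico 0 T ×ˢ univ)
  cont_space : ContinuousOn (Function.uncurry (spaceDeriv f)) (Ico 0 T ×ˢ univ)
  bounded : ∀ T' ∈ Ico 0 T, ∃ B : ℝ, ∀ t ∈ Icc 0 T', ∀ x,
    |f t x| + |timeDeriv T f t x| + |spaceDeriv f t x| ≤ B

/-- Classical solutions `(ρ,u)` on `[0,T) × ℝ`: class `C¹`, the Euler--Poisson system holds pointwise
with a potential `φ`, the initial data are attained, and the neutrality condition holds. The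
condition `∂ₓφ(t,·) ∈ L²` says that the force is the one associated with `ρ - c ∈ Ḣ^{-1}`, so that
`∂ₓφ` is determined by the Poisson equation. -/
structure IsClassicalSolution (k ν : ℝ) (c : ℝ → ℝ → ℝ) (ρ₀ u₀ : ℝ → ℝ) (T : ℝ)
    (ρ u : ℝ → ℝ → ℝ) : Prop where
  density_C1 : IsClassC1 T ρ
  velocity_C1 : IsClassC1 T u
  continuity_eq : ∀ t ∈ Ico 0 T, ∀ x,
    timeDeriv T ρ t x + spaceDeriv (fun τ y => ρ τ y * u τ y) t x = 0
  momentum_poisson : ∃ φ : ℝ → ℝ → ℝ, ∀ t ∈ Ico 0 T,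
    Differentiable ℝ (φ t) ∧ Differentiable ℝ (spaceDeriv φ t) ∧
    MemLp (spaceDeriv φ t) 2 volume ∧
    (∀ x, -spaceDeriv (spaceDeriv φ) t x = ρ t x - c t x) ∧
    ∀ x, timeDeriv T u t x + u t x * spaceDeriv u t x
      = -ν * u t x - k * spaceDeriv φ t x
  initial_density : ∀ x, ρ 0 x = ρ₀ x
  initial_velocity : ∀ x, u 0 x = u₀ x
  neutrality : ∀ t ∈ Ico 0 T,
    Integrable (fun x => ρ t x - c t x) volume ∧ ∫ x, (ρ t x - c t x) = 0

end

open MeasureTheory Set Filter Topology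
open scoped ENNReal NNReal FourierTransform Interval

/-! In one space dimension the Poisson force is explicit along particle paths. Let `m` be a
primitive of `ρ₀` and `Γ(t,·)` a primitive of `c(t,·)`, normalised so that `Γ - m` is the initial
field `∂ₓφ` at `t = 0`. Conservation of mass makes `m` constant along paths, so the force at
`X(t,a)` is `Γ(t,X) - m(a)`, and Euler–Poisson splits into decoupled ODEs, one per label `a`: `X' =
U`, `U' = -νU - k(Γ(t,X) - m(a))`. Since `∂ₓΓ = c` is bounded, all of them live on a common short
interval. The label derivatives `Y = ∂ₐX`, `V = ∂ₐU` solve the linearised ODE. As long as `Y ≥ 1/2`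
the flow has an inverse `A(t,·)`, and `ρ = (ρ₀/Y)∘A`, `u = U∘A`, `∂ₓφ = Γ - m∘A` solve the system.
For `ρ` to be `C¹` one more label derivative `Z = ∂ₐY` is needed; it costs bounds on `ρ₀'`, `u₀''`
and `∂ₓc`, which Sobolev embedding supplies (`FlowData.exists_particleFlow`, `exists_inverse_flow`).

Integrability comes in two stages. First, a function in `L¹ ∩ Ḣ⁻¹ ∩ H^s` has its antiderivative from
`-∞` in `L²` (`eLpNorm_integral_Iic_le_of_homSobolevNegOneENorm_le`). This applies to the initial
field `e₀` and to `B(t,x) = ∫_{-∞}^x (c(t) - c(0))`. Along the flow the field is `(C₀(X) - C₀(a)) +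
B(t,X) + e₀(a)` with `C₀' = c(0)`, so a short-time estimate puts `X - a`, `U` and the field in `L²`.
Secondly, the source `c(t,X) - ρ₀(a)` of the linearised ODE is in `L¹`: the parts `c(t) - c(0)` and
`c(0) - ρ₀` are integrable by assumption, and `c(0,X) - c(0,a)` is the time integral of `∂ₓc(0,X)
U`, a product of two `L²` functions. With `u₀' ∈ L¹` from bounded variation, `Y - 1` and `V` are
bounded in `L¹` uniformly in time, which gives the final bound after a change of variables.

Neutrality is then automatic: `c - ρ` is integrable and is the derivative of a field in `L²`, which
must vanish at both ends. The background is frozen at `c(0)` for `t < 0`, so that the ODEs run on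
`[-T,T]` and the one-sided derivatives at `t = 0` come from two-sided ones. -/

/-! ### Fourier inversion, Sobolev embedding and antiderivatives of `Ḣ⁻¹` functions -/

theorem continuous_fourierInv {h : ℝ → ℂ} (hi : Integrable h) : Continuous (𝓕⁻ h) := by
  have h1 : Continuous (𝓕 (h : ℝ → ℂ)) :=
    VectorFourier.fourierIntegral_continuous Real.continuous_fourierChar
      (L := innerₗ ℝ) (by exact continuous_inner) hi
  have : (𝓕⁻ (h : ℝ → ℂ)) = fun x => 𝓕 (h : ℝ → ℂ) (-x) := by
    ext x; exact Real.fourierInv_eq_fourier_neg _ _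
  rw [this]; exact h1.comp continuous_neg

/-- Tested against a smooth compactly supported function, both sides equal the pairing of `h` with
the inverse transform of the test function: one by the definition on tempered distributions, the
other by Fubini. -/
theorem ae_eq_fourierInv_of_integrable (h : Lp ℂ 2 (volume : Measure ℝ)) (hi : Integrable h) :
    (𝓕⁻ h : Lp ℂ 2 (volume : Measure ℝ)) =ᵐ[volume] 𝓕⁻ (h : ℝ → ℂ) := by
  have hcont := continuous_fourierInv hi
  refine ae_eq_of_integral_contDiff_smul_eq
    ((Lp.memLp _).locallyIntegrable (by norm_num)) hcont.locallyIntegrable ?_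
  intro g hg hgs
  have hg₁ : HasCompactSupport (Complex.ofRealCLM ∘ g) := hgs.comp_left rfl
  have hg₂ : ContDiff ℝ ((⊤ : ℕ∞) : WithTop ℕ∞) (Complex.ofRealCLM ∘ g) :=
    Complex.ofRealCLM.contDiff.comp hg
  set φ : SchwartzMap ℝ ℂ := hg₁.toSchwartzMap hg₂ with hφ
  have hφx : ∀ x, φ x = (g x : ℂ) := fun x => rfl
  have key := congrArg (fun T => T φ) (Lp.fourierInv_toTemperedDistribution_eq h)
  simp only [TemperedDistribution.fourierInv_apply, Lp.toTemperedDistribution_apply,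
    SchwartzMap.fourierInv_coe] at key
  have e1 : ∫ x, g x • (𝓕⁻ h : Lp ℂ 2 (volume : Measure ℝ)) x
      = ∫ x, φ x • (𝓕⁻ h : Lp ℂ 2 (volume : Measure ℝ)) x := by
    simp [hφx]
  have e2 : ∫ x, g x • (𝓕⁻ (h : ℝ → ℂ)) x = ∫ x, φ x • (𝓕⁻ (h : ℝ → ℂ)) x := by
    simp [hφx]
  rw [e1, e2, ← key]
  -- The inverse transform is the Fourier integral for the negated inner product; this pairing is
  -- symmetric, so the `flip` disappears.
  have := VectorFourier.integral_fourierIntegral_smul_eq_flip (L := -(innerₗ ℝ))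
    (μ := volume) (ν := volume) (f := φ) (g := (h : ℝ → ℂ)) Real.continuous_fourierChar
    (by simpa using! (continuous_snd.mul continuous_fst).neg) φ.integrable hi
  have hfl : (-(innerₗ ℝ)).flip = (-(innerₗ ℝ) : ℝ →ₗ[ℝ] ℝ →ₗ[ℝ] ℝ) := by
    ext; simp
  rw [hfl] at this
  convert! this using 2

theorem hasDerivAt_fourierInv {h : ℝ → ℂ} (h0 : Integrable h)
    (h1 : Integrable (fun ξ : ℝ => (2 * Real.pi * Complex.I * ξ) * h ξ)) (x : ℝ) :
    HasDerivAt (𝓕⁻ h) (𝓕⁻ (fun ξ : ℝ => (2 * Real.pi * Complex.I * ξ) * h ξ) x) x := by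
  have e : ∀ f : ℝ → ℂ, 𝓕⁻ f = fun x => 𝓕 f (-x) := fun f => by
    ext x; exact Real.fourierInv_eq_fourier_neg _ _
  have h1' : Integrable (fun ξ : ℝ => ξ • h ξ) := by
    have := h1.const_mul (2 * Real.pi * Complex.I)⁻¹
    refine this.congr (Filter.Eventually.of_forall fun ξ => ?_)
    have : (Real.pi : ℂ) ≠ 0 := by exact_mod_cast Real.pi_ne_zero
    simp only [Complex.real_smul]
    field_simp
  have := (Real.hasDerivAt_fourier h0 h1' (-x)).scomp x (hasDerivAt_neg x)
  rw [e h, e]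
  convert! this using 1
  beta_reduce
  rw [neg_one_smul, Real.fourier_eq, Real.fourier_eq, ← integral_neg]
  congr 1; ext ξ
  simp only [smul_eq_mul, Circle.smul_def]; ring

theorem norm_fourierInv_le (h : ℝ → ℂ) (x : ℝ) : ‖𝓕⁻ h x‖ ≤ ∫ ξ, ‖h ξ‖ := by
  rw [Real.fourierInv_eq]
  refine (norm_integral_le_integral_norm _).trans_eq ?_
  simp

theorem memLp_rpow_neg_half_one_add_sq :
    MemLp (fun ξ : ℝ => (1 + |ξ| ^ 2) ^ (-(1 / 2) : ℝ)) 2 volume := by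
  have hc : Continuous fun ξ : ℝ => (1 + |ξ| ^ 2) ^ (-(1 / 2) : ℝ) :=
    (by fun_prop : Continuous fun ξ : ℝ => 1 + |ξ| ^ 2).rpow_const
      fun ξ => Or.inl (by positivity)
  rw [memLp_two_iff_integrable_sq hc.aestronglyMeasurable]
  refine integrable_inv_one_add_sq.congr (Filter.Eventually.of_forall fun ξ => ?_)
  have h0 : (0 : ℝ) ≤ 1 + ξ ^ 2 := by positivity
  simp only [sq_abs]
  rw [← Real.rpow_natCast ((1 + ξ ^ 2) ^ _) 2, ← Real.rpow_mul h0, ← Real.rpow_neg_one]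
  norm_num

/-- The `L²` norm of `(1 + |ξ|²)^(-1/2)`. -/
noncomputable def besselWeightNorm : ℝ≥0 :=
  (eLpNorm (fun ξ : ℝ => (1 + |ξ| ^ 2) ^ (-(1 / 2) : ℝ)) 2 volume).toNNReal

/-- Cauchy–Schwarz after splitting off the `L²` factor `(1 + |ξ|²)^(-1/2)`; this costs one full
power of the weight. -/
theorem weighted_integrable_of_eLpNorm_le {h : ℝ → ℂ} (hm : AEStronglyMeasurable h volume)
    {r s : ℝ} (hrs : r + 1 ≤ s) {M : ℝ≥0}
    (hM : eLpNorm (fun ξ : ℝ => (((1 + |ξ| ^ 2) ^ (s / 2) : ℝ) : ℂ) * h ξ) 2 volume ≤ M) :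
    Integrable (fun ξ : ℝ => (1 + |ξ| ^ 2) ^ (r / 2) * ‖h ξ‖) ∧
      ∫ ξ : ℝ, (1 + |ξ| ^ 2) ^ (r / 2) * ‖h ξ‖ ≤ (besselWeightNorm : ℝ) * (M : ℝ) := by
  have hw : ∀ p : ℝ, Continuous fun ξ : ℝ => (1 + |ξ| ^ 2) ^ p := fun p =>
    (by fun_prop : Continuous fun ξ : ℝ => 1 + |ξ| ^ 2).rpow_const
      fun ξ => Or.inl (by positivity)
  set G : ℝ → ℂ := fun ξ => (((1 + |ξ| ^ 2) ^ (s / 2) : ℝ) : ℂ) * h ξ with hG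
  have hGm : AEStronglyMeasurable G volume :=
    (Complex.continuous_ofReal.comp (hw (s / 2))).aestronglyMeasurable.mul hm
  have hmul := eLpNorm_smul_le_mul_eLpNorm (p := 2) (q := 2) (r := 1) hGm
    (hw (-(1 / 2))).aestronglyMeasurable
  have hpt : ∀ ξ : ℝ, ‖(1 + |ξ| ^ 2) ^ (r / 2) * ‖h ξ‖‖ ≤
      ‖((fun ξ : ℝ => (1 + |ξ| ^ 2) ^ (-(1 / 2) : ℝ)) • G) ξ‖ := by
    intro ξ
    have h1 : (1 : ℝ) ≤ 1 + |ξ| ^ 2 := by nlinarith [sq_nonneg |ξ|]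
    have h0 : (0 : ℝ) < 1 + |ξ| ^ 2 := by positivity
    have e : ((fun ξ : ℝ => (1 + |ξ| ^ 2) ^ (-(1 / 2) : ℝ)) • G) ξ =
        (((1 + |ξ| ^ 2) ^ (-(1 / 2) : ℝ) : ℝ) : ℂ) * ((((1 + |ξ| ^ 2) ^ (s / 2) : ℝ) : ℂ) * h ξ) := by
      simp [hG]
    rw [e, norm_mul, norm_mul, norm_mul, norm_norm, Complex.norm_real, Complex.norm_real,
      ← mul_assoc]
    refine mul_le_mul_of_nonneg_right ?_ (norm_nonneg _)
    rw [Real.norm_of_nonneg (by positivity), Real.norm_of_nonneg (by positivity),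
      Real.norm_of_nonneg (by positivity), ← Real.rpow_add h0]
    exact Real.rpow_le_rpow_of_exponent_le h1 (by linarith)
  have hfin : eLpNorm (fun ξ : ℝ => (1 + |ξ| ^ 2) ^ (r / 2) * ‖h ξ‖) 1 volume ≤
      (besselWeightNorm * M : ℝ≥0) := by
    refine (eLpNorm_mono hpt).trans (hmul.trans ?_)
    rw [ENNReal.coe_mul, besselWeightNorm,
      ENNReal.coe_toNNReal memLp_rpow_neg_half_one_add_sq.eLpNorm_ne_top]
    gcongr
  have hme : AEStronglyMeasurable (fun ξ : ℝ => (1 + |ξ| ^ 2) ^ (r / 2) * ‖h ξ‖) volume :=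
    (hw (r / 2)).aestronglyMeasurable.mul hm.norm
  refine ⟨memLp_one_iff_integrable.1 ⟨hme, hfin.trans_lt ENNReal.coe_lt_top⟩, ?_⟩
  calc ∫ ξ : ℝ, (1 + |ξ| ^ 2) ^ (r / 2) * ‖h ξ‖
      = ∫ ξ : ℝ, ‖(1 + |ξ| ^ 2) ^ (r / 2) * ‖h ξ‖‖ := by
        congr 1; ext ξ; rw [Real.norm_of_nonneg (by positivity)]
    _ = (eLpNorm (fun ξ : ℝ => (1 + |ξ| ^ 2) ^ (r / 2) * ‖h ξ‖) 1 volume).toReal := by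
        rw [integral_norm_eq_lintegral_enorm hme, eLpNorm_one_eq_lintegral_enorm]
    _ ≤ _ := by
        have := ENNReal.toReal_mono ENNReal.coe_ne_top hfin
        simpa using this

theorem memLp_of_sobolevENorm_lt_top {s : ℝ} {f : ℝ → ℝ} (h : sobolevENorm s f < ⊤) :
    MemLp (fun x => (f x : ℂ)) 2 volume := by
  by_contra hf
  simp [sobolevENorm, hf] at h

/-- Sobolev embedding: `(2πiξ)^j f̂` is integrable for `j ≤ n`, so the inversion integral may be
differentiated. The constant does not depend on `f`, which later gives bounds uniform in time. -/
theorem exists_continuous_derivs_of_sobolevENorm_le (n : ℕ) {s : ℝ} (hs : n + 1 ≤ s) :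
    ∃ C : ℝ≥0, ∀ (f : ℝ → ℝ) (M : ℝ≥0), sobolevENorm s f ≤ M →
      ∃ g : ℕ → ℝ → ℝ, f =ᵐ[volume] g 0 ∧
        (∀ j ≤ n, Continuous (g j) ∧ ∀ x, |g j x| ≤ C * M) ∧
        ∀ j < n, ∀ x, HasDerivAt (g j) (g (j + 1) x) x := by
  refine ⟨(2 * NNReal.pi) ^ n * besselWeightNorm, fun f M hM => ?_⟩
  have hf := memLp_of_sobolevENorm_lt_top (hM.trans_lt ENNReal.coe_lt_top)
  rw [sobolevENorm, dif_pos hf] at hM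
  set h : Lp ℂ 2 (volume : Measure ℝ) := 𝓕 (hf.toLp (fun x => (f x : ℂ))) with hh
  obtain ⟨hI, hIle⟩ := weighted_integrable_of_eLpNorm_le (Lp.aestronglyMeasurable h) hs hM
  have hpt : ∀ j ≤ n, ∀ ξ : ℝ, ‖(2 * Real.pi * Complex.I * ξ) ^ j * h ξ‖ ≤
      (2 * Real.pi) ^ n * ((1 + |ξ| ^ 2) ^ ((n : ℝ) / 2) * ‖h ξ‖) := by
    intro j hj ξ
    have h1 : (1 : ℝ) ≤ 1 + |ξ| ^ 2 := by nlinarith [sq_nonneg |ξ|]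
    have h0 : (0 : ℝ) ≤ 1 + |ξ| ^ 2 := by positivity
    have hpi : (1 : ℝ) ≤ 2 * Real.pi := by linarith [Real.pi_gt_three]
    rw [norm_mul, norm_pow, ← mul_assoc]
    refine mul_le_mul_of_nonneg_right ?_ (norm_nonneg _)
    have e : ‖(2 * Real.pi * Complex.I * ξ : ℂ)‖ = 2 * Real.pi * |ξ| := by
      simp [abs_of_pos Real.pi_pos]
    rw [e, mul_pow]
    refine mul_le_mul (pow_le_pow_right₀ hpi hj) ?_ (by positivity) (by positivity)
    calc |ξ| ^ j ≤ Real.sqrt (1 + |ξ| ^ 2) ^ j :=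
          pow_le_pow_left₀ (abs_nonneg _) (Real.le_sqrt_of_sq_le (by linarith)) _
      _ ≤ Real.sqrt (1 + |ξ| ^ 2) ^ n :=
          pow_le_pow_right₀ (Real.one_le_sqrt.2 h1) hj
      _ = _ := by
          rw [Real.sqrt_eq_rpow, ← Real.rpow_natCast, ← Real.rpow_mul h0]; ring_nf
  have hint : ∀ j ≤ n, Integrable (fun ξ : ℝ => (2 * Real.pi * Complex.I * ξ) ^ j * h ξ) := by
    intro j hj
    refine (hI.const_mul ((2 * Real.pi) ^ n)).mono' ?_ (Filter.Eventually.of_forall (hpt j hj))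
    exact (by fun_prop : Continuous fun ξ : ℝ =>
      (2 * Real.pi * Complex.I * ξ : ℂ) ^ j).aestronglyMeasurable.mul (Lp.aestronglyMeasurable h)
  refine ⟨fun j x => (𝓕⁻ (fun ξ : ℝ => (2 * Real.pi * Complex.I * ξ) ^ j * h ξ) x).re,
    ?_, ?_, ?_⟩
  · have h0 : Integrable h := by simpa using hint 0 (Nat.zero_le _)
    have a1 := ae_eq_fourierInv_of_integrable h h0
    have a2 : (𝓕⁻ h : Lp ℂ 2 (volume : Measure ℝ)) = hf.toLp (fun x => (f x : ℂ)) := by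
      rw [hh]; exact FourierTransform.fourierInv_fourier_eq _
    rw [a2] at a1
    filter_upwards [a1, hf.coeFn_toLp] with x hx hx'
    simp only [pow_zero, one_mul]
    rw [← hx, hx']; simp
  · intro j hj
    refine ⟨Complex.continuous_re.comp (continuous_fourierInv (hint j hj)), fun x => ?_⟩
    refine (Complex.abs_re_le_norm _).trans ((norm_fourierInv_le _ _).trans ?_)
    calc _ ≤ ∫ ξ : ℝ, (2 * Real.pi) ^ n * ((1 + |ξ| ^ 2) ^ ((n : ℝ) / 2) * ‖h ξ‖) :=
          integral_mono (hint j hj).norm (hI.const_mul _) (hpt j hj)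
      _ = (2 * Real.pi) ^ n * ∫ ξ : ℝ, ((1 + |ξ| ^ 2) ^ ((n : ℝ) / 2) * ‖h ξ‖) :=
          integral_const_mul _ _
      _ ≤ (2 * Real.pi) ^ n * (besselWeightNorm * M) := by gcongr
      _ = _ := by push_cast; simp only [NNReal.coe_real_pi]; ring
  · intro j hj x
    have := hasDerivAt_fourierInv (hint j hj.le)
      ((hint (j + 1) hj).congr (Filter.Eventually.of_forall fun ξ => by ring)) x
    have e : (fun ξ : ℝ => (2 * Real.pi * Complex.I * ξ) * ((2 * Real.pi * Complex.I * ξ) ^ j * h ξ))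
        = fun ξ : ℝ => (2 * Real.pi * Complex.I * ξ) ^ (j + 1) * h ξ := by
      ext ξ; ring
    rw [e] at this
    exact (Complex.reCLM.hasFDerivAt.comp_hasDerivAt x this)

theorem eq_zero_of_tendsto_atBot_of_memLp_two {g : ℝ → ℝ} (hg : MemLp g 2 volume) {l : ℝ}
    (hl : Filter.Tendsto g Filter.atBot (nhds l)) : l = 0 := by
  have h1 : Integrable (fun x => g x ^ 2) := hg.integrable_sq
  have h2 := IntegrableAtFilter.eq_zero_of_tendsto (l := Filter.atBot)
    (h1.integrableAtFilter _) (fun s hs => by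
      obtain ⟨a, ha⟩ := Filter.mem_atBot_sets.1 hs
      exact measure_mono_top (s₁ := Iic a) (fun x hx => ha x hx) Real.volume_Iic) (hl.pow 2)
  exact pow_eq_zero_iff (two_ne_zero) |>.1 h2

/-- Dividing `f̂` by `2πiξ` gives the transform of an `L²` antiderivative. It differs from the
antiderivative starting at `-∞` by a constant, which decay at `-∞` forces to vanish. -/
theorem eLpNorm_integral_Iic_le_of_homSobolevNegOneENorm_le {s : ℝ} (hs : 1 ≤ s) {f : ℝ → ℝ}
    (hf1 : Integrable f) (hfs : sobolevENorm s f < ⊤) {M : ℝ≥0}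
    (hM : homSobolevNegOneENorm f ≤ M) :
    MemLp (fun x => ∫ y in Iic x, f y) 2 volume ∧
      eLpNorm (fun x => ∫ y in Iic x, f y) 2 volume ≤ M := by
  have hf := memLp_of_sobolevENorm_lt_top hfs
  rw [sobolevENorm, dif_pos hf] at hfs
  rw [homSobolevNegOneENorm, dif_pos hf] at hM
  set h : Lp ℂ 2 (volume : Measure ℝ) := 𝓕 (hf.toLp (fun x => (f x : ℂ))) with hh
  have hm := Lp.aestronglyMeasurable h
  obtain ⟨hI, -⟩ := weighted_integrable_of_eLpNorm_le (r := 0) (M := (eLpNorm (fun ξ : ℝ =>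
    (((1 + |ξ| ^ 2) ^ (s / 2) : ℝ) : ℂ) * h ξ) 2 volume).toNNReal) hm (by linarith)
    (by rw [ENNReal.coe_toNNReal hfs.ne])
  have h0 : Integrable h := by
    rw [← integrable_norm_iff hm]; simpa using hI
  -- the symbol of the antiderivative
  set q : ℝ → ℂ := fun ξ => (2 * Real.pi * Complex.I * ξ)⁻¹ * h ξ with hq
  have hqm : AEStronglyMeasurable q volume :=
    (by fun_prop : Measurable fun ξ : ℝ =>
      (2 * Real.pi * Complex.I * ξ : ℂ)⁻¹).aestronglyMeasurable.mul hm
  have hpi : (1 : ℝ) ≤ 2 * Real.pi := by linarith [Real.pi_gt_three]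
  have hinv : (2 * Real.pi)⁻¹ ≤ 1 := inv_le_one_of_one_le₀ hpi
  have hqn : ∀ ξ, ‖q ξ‖ = (2 * Real.pi)⁻¹ * (|ξ|⁻¹ * ‖h ξ‖) := by
    intro ξ
    simp [hq, abs_of_pos Real.pi_pos]; ring
  have hqM : eLpNorm q 2 volume ≤ M := by
    refine le_trans (eLpNorm_mono fun ξ => ?_) hM
    rw [hqn, norm_mul, Complex.norm_real, Real.norm_of_nonneg (by positivity)]
    exact mul_le_of_le_one_left (by positivity) hinv
  have hq2 : MemLp q 2 volume := ⟨hqm, hqM.trans_lt ENNReal.coe_lt_top⟩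
  -- `√(1+ξ²) ‖q‖ ≤ ‖q‖ + ‖h‖`, and the right side is in `L²`: the `Ḣ⁻¹` norm handles low
  -- frequencies and `h` the high ones. Cauchy–Schwarz against the inverse weight concludes.
  have hq1 : Integrable q := by
    have hw : MemLp (fun ξ : ℝ => ‖q ξ‖ + ‖h ξ‖) 2 volume := hq2.norm.add (Lp.memLp h).norm
    have := hw.smul (r := 1) memLp_rpow_neg_half_one_add_sq
    rw [memLp_one_iff_integrable] at this
    refine this.mono' hqm ?_
    have hne : ∀ᵐ ξ : ℝ, ξ ≠ 0 := by simp [ae_iff, measure_singleton]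
    filter_upwards [hne] with ξ hξ
    have hξ' : 0 < |ξ| := abs_pos.2 hξ
    have p0 : (0 : ℝ) < 1 + |ξ| ^ 2 := by positivity
    simp only [Pi.smul_apply', smul_eq_mul]
    rw [Real.rpow_neg p0.le, ← Real.sqrt_eq_rpow, inv_mul_eq_div, le_div_iff₀ (by positivity)]
    have hsq : Real.sqrt (1 + |ξ| ^ 2) ≤ 1 + |ξ| := by
      rw [Real.sqrt_le_left (by positivity)]; nlinarith
    have hle : ‖q ξ‖ * |ξ| ≤ ‖h ξ‖ := by
      rw [hqn]
      have : (2 * Real.pi)⁻¹ * (|ξ|⁻¹ * ‖h ξ‖) * |ξ| = (2 * Real.pi)⁻¹ * ‖h ξ‖ := by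
        field_simp
      rw [this]
      exact mul_le_of_le_one_left (norm_nonneg _) hinv
    nlinarith [norm_nonneg (q ξ)]
  have hne : ∀ᵐ ξ : ℝ, (2 * Real.pi * Complex.I * ξ) * q ξ = h ξ := by
    have hne : ∀ᵐ ξ : ℝ, ξ ≠ 0 := by simp [ae_iff, measure_singleton]
    filter_upwards [hne] with ξ hξ
    have h1 : (ξ : ℂ) ≠ 0 := by exact_mod_cast hξ
    have h2 : (Real.pi : ℂ) ≠ 0 := by exact_mod_cast Real.pi_ne_zero
    simp only [hq]; field_simp
  have hFh : 𝓕⁻ (fun ξ : ℝ => (2 * Real.pi * Complex.I * ξ) * q ξ) = 𝓕⁻ (h : ℝ → ℂ) := by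
    ext x
    rw [Real.fourierInv_eq, Real.fourierInv_eq]
    exact integral_congr_ae (hne.mono fun ξ hξ => by simp only [hξ])
  have hfr : f =ᵐ[volume] fun x => (𝓕⁻ (h : ℝ → ℂ) x).re := by
    have a1 := ae_eq_fourierInv_of_integrable h h0
    have a2 : (𝓕⁻ h : Lp ℂ 2 (volume : Measure ℝ)) = hf.toLp (fun x => (f x : ℂ)) := by
      rw [hh]; exact FourierTransform.fourierInv_fourier_eq _
    rw [a2] at a1
    filter_upwards [a1, hf.coeFn_toLp] with x hx hx'
    rw [← hx, hx']; simp
  set g : ℝ → ℝ := fun x => (𝓕⁻ q x).re with hg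
  have hder : ∀ x, HasDerivAt g ((𝓕⁻ (h : ℝ → ℂ) x).re) x := by
    intro x
    have := hasDerivAt_fourierInv hq1 (h0.congr (hne.mono fun ξ hξ => hξ.symm)) x
    rw [hFh] at this
    exact Complex.reCLM.hasFDerivAt.comp_hasDerivAt x this
  have hgLp : MemLp g 2 volume ∧ eLpNorm g 2 volume ≤ M := by
    set Q : Lp ℂ 2 (volume : Measure ℝ) := hq2.toLp q
    have hQ : Q =ᵐ[volume] q := hq2.coeFn_toLp
    have b1 := ae_eq_fourierInv_of_integrable Q (hq1.congr hQ.symm)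
    have b2 : 𝓕⁻ (Q : ℝ → ℂ) = 𝓕⁻ q := by
      ext x
      rw [Real.fourierInv_eq, Real.fourierInv_eq]
      exact integral_congr_ae (hQ.mono fun ξ hξ => by simp only [hξ])
    rw [b2] at b1
    have b3 : eLpNorm (𝓕⁻ q) 2 volume ≤ M := by
      rw [← eLpNorm_congr_ae b1, ← Lp.enorm_def]
      have : ‖(𝓕⁻ Q : Lp ℂ 2 (volume : Measure ℝ))‖ = ‖Q‖ :=
        (Lp.fourierTransformₗᵢ ℝ ℂ).symm.norm_map Q
      rw [← ofReal_norm, this, ofReal_norm, Lp.enorm_def, eLpNorm_congr_ae hQ]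
      exact hqM
    have hle : eLpNorm g 2 volume ≤ M :=
      (eLpNorm_mono fun x => Complex.abs_re_le_norm _).trans b3
    exact ⟨⟨(Complex.continuous_re.comp (continuous_fourierInv hq1)).aestronglyMeasurable,
      hle.trans_lt ENNReal.coe_lt_top⟩, hle⟩
  set F : ℝ → ℝ := fun x => ∫ y in Iic x, f y with hF
  have hFg : ∀ x y, F x - F y = g x - g y := by
    intro x y
    rw [hF]
    simp only
    rw [intervalIntegral.integral_Iic_sub_Iic hf1.integrableOn hf1.integrableOn,
      intervalIntegral.integral_congr_ae_restrict (ae_restrict_of_ae hfr)]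
    exact intervalIntegral.integral_eq_sub_of_hasDerivAt (fun z _ => hder z)
      ((Complex.continuous_re.comp (continuous_fourierInv h0)).intervalIntegrable _ _)
  have hF0 : Filter.Tendsto F Filter.atBot (nhds 0) := 
    tendsto_integral_Iic_zero Filter.tendsto_id
  -- `g` inherits a limit at `-∞` from `F`; being square integrable, it can only tend to `0`, so `g
  -- - F = 0`.
  have hgl : Filter.Tendsto g Filter.atBot (nhds (g 0 - F 0)) := by
    have : g = fun x => F x + (g 0 - F 0) := by
      ext x; linarith [hFg x 0]
    rw [this]
    simpa using hF0.add_const (g 0 - F 0)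
  have hz := eq_zero_of_tendsto_atBot_of_memLp_two hgLp.1 hgl
  have hFeq : F = g := by
    ext x; linarith [hFg x 0]
  rw [hFeq]
  exact hgLp

theorem eLpNorm_two_le_of_sobolevENorm_le {s : ℝ} (hs : 0 ≤ s) {f : ℝ → ℝ} {M : ℝ≥0}
    (hM : sobolevENorm s f ≤ M) : eLpNorm f 2 volume ≤ M := by
  have hf := memLp_of_sobolevENorm_lt_top (hM.trans_lt ENNReal.coe_lt_top)
  rw [sobolevENorm, dif_pos hf] at hM
  have e1 : eLpNorm f 2 volume = eLpNorm (fun x => (f x : ℂ)) 2 volume :=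
    eLpNorm_congr_norm_ae (Eventually.of_forall fun x => by simp)
  rw [e1, ← eLpNorm_congr_ae hf.coeFn_toLp, ← Lp.enorm_def, ← ofReal_norm,
    ← Lp.norm_fourier_eq, ofReal_norm, Lp.enorm_def]
  refine le_trans (eLpNorm_mono fun ξ => ?_) hM
  have h1 : (1 : ℝ) ≤ 1 + |ξ| ^ 2 := by nlinarith [sq_nonneg |ξ|]
  rw [norm_mul, Complex.norm_real, Real.norm_of_nonneg (by positivity)]
  exact le_mul_of_one_le_left (norm_nonneg _) (Real.one_le_rpow h1 (by positivity))

/-! ### Uniform `C^{1,1}` bounds and passage from almost every time to every time -/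

theorem abs_taylor_one_le {f f' : ℝ → ℝ} {L : ℝ} (hf : ∀ x, HasDerivAt f (f' x) x)
    (hL : ∀ x y, |f' x - f' y| ≤ L * |x - y|) (x y : ℝ) :
    |f y - f x - (y - x) * f' x| ≤ L * |y - x| ^ 2 := by
  have hL0 : 0 ≤ L := by
    have := (abs_nonneg _).trans (hL 1 0); simpa using this
  have hd : ∀ z ∈ uIcc x y, HasDerivWithinAt (fun z => f z - z * f' x) (f' z - f' x)
      (uIcc x y) z := fun z _ => by
    have := ((hf z).sub ((hasDerivAt_id z).mul_const (f' x))).hasDerivWithinAt (s := uIcc x y)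
    rw [one_mul] at this
    exact this
  have := (convex_uIcc x y).norm_image_sub_le_of_norm_hasDerivWithin_le (C := L * |y - x|) hd
    (fun z hz => (hL z x).trans
      (mul_le_mul_of_nonneg_left (abs_sub_left_of_mem_uIcc hz) hL0)) left_mem_uIcc right_mem_uIcc
  simp only [Real.norm_eq_abs] at this
  calc _ = |f y - y * f' x - (f x - x * f' x)| := by congr 1; ring
    _ ≤ _ := this
    _ = _ := by ring

/-- Interpolation: derivatives are close if the functions are and the derivatives are Lipschitz. -/
theorem abs_deriv_sub_le {f f' g g' : ℝ → ℝ} {L : ℝ} (hf : ∀ x, HasDerivAt f (f' x) x)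
    (hg : ∀ x, HasDerivAt g (g' x) x) (hfL : ∀ x y, |f' x - f' y| ≤ L * |x - y|)
    (hgL : ∀ x y, |g' x - g' y| ≤ L * |x - y|) (x : ℝ) {h : ℝ} (hh : 0 < h) :
    |f' x - g' x| ≤ (|f (x + h) - g (x + h)| + |f x - g x|) / h + 2 * L * h := by
  have e1 := abs_taylor_one_le hf hfL x (x + h)
  have e2 := abs_taylor_one_le hg hgL x (x + h)
  rw [add_sub_cancel_left, abs_of_pos hh] at e1 e2
  have e : h * |f' x - g' x| ≤ |f (x + h) - g (x + h)| + |f x - g x| + 2 * L * h ^ 2 := by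
    rw [← abs_of_pos hh, ← abs_mul, abs_of_pos hh]
    have : h * (f' x - g' x) = (f (x + h) - g (x + h)) - (f x - g x)
      - (f (x + h) - f x - h * f' x) + (g (x + h) - g x - h * g' x) := by ring
    rw [this]
    have t1 := abs_add_le ((f (x + h) - g (x + h)) - (f x - g x)
      - (f (x + h) - f x - h * f' x)) (g (x + h) - g x - h * g' x)
    have t2 := abs_sub ((f (x + h) - g (x + h)) - (f x - g x)) (f (x + h) - f x - h * f' x)
    have t3 := abs_sub (f (x + h) - g (x + h)) (f x - g x)
    linarith
  rw [div_add' _ _ _ hh.ne', le_div_iff₀ hh]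
  linarith

/-- Uniform `C^{1,1}` bounds pass to pointwise limits, with convergence of the derivatives. -/
theorem exists_hasDerivAt_of_tendsto {f f' : ℕ → ℝ → ℝ} {g : ℝ → ℝ} {L : ℝ}
    (hf : ∀ n x, HasDerivAt (f n) (f' n x) x) (hL : ∀ n x y, |f' n x - f' n y| ≤ L * |x - y|)
    (hlim : ∀ x, Tendsto (fun n => f n x) atTop (𝓝 (g x))) :
    ∃ g' : ℝ → ℝ, (∀ x, HasDerivAt g (g' x) x) ∧ ∀ x, Tendsto (fun n => f' n x) atTop (𝓝 (g' x)) := by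
  have hL0 : 0 ≤ L := by
    have := (abs_nonneg _).trans (hL 0 1 0); simpa using this
  have hcau : ∀ x, CauchySeq fun n => f' n x := by
    intro x
    rw [Metric.cauchySeq_iff]
    intro ε hε
    -- Interpolation step: `2Lh ≤ ε/2` controls the Taylor error, and convergence at the two points
    -- `x`, `x + h` controls the difference quotient.
    set h := ε / (4 * (L + 1)) with hh
    have hh0 : 0 < h := by positivity
    have hhe : h * (4 * (L + 1)) = ε := by rw [hh]; field_simp
    obtain ⟨N₁, h₁⟩ := Metric.cauchySeq_iff.1 (hlim x).cauchySeq (h * ε / 4) (by positivity)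
    obtain ⟨N₂, h₂⟩ := Metric.cauchySeq_iff.1 (hlim (x + h)).cauchySeq (h * ε / 4) (by positivity)
    refine ⟨max N₁ N₂, fun m hm n hn => ?_⟩
    have a1 := h₁ m ((le_max_left _ _).trans hm) n ((le_max_left _ _).trans hn)
    have a2 := h₂ m ((le_max_right _ _).trans hm) n ((le_max_right _ _).trans hn)
    rw [Real.dist_eq] at a1 a2 ⊢
    have := abs_deriv_sub_le (hf m) (hf n) (hL m) (hL n) x hh0
    have h3 : (|f m (x + h) - f n (x + h)| + |f m x - f n x|) / h < ε / 2 := by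
      rw [div_lt_iff₀ hh0]; linarith
    have : 2 * L * h ≤ ε / 2 := by nlinarith
    linarith
  choose g' hg' using fun x => cauchySeq_tendsto_of_complete (hcau x)
  refine ⟨g', fun x => ?_, hg'⟩
  -- The first-order Taylor estimate has a constant free of `n`, so it survives the pointwise limit
  -- and already contains differentiability of `g`.
  have hT : ∀ y, |g y - g x - (y - x) * g' x| ≤ L * |y - x| ^ 2 := fun y =>
    le_of_tendsto ((((hlim y).sub (hlim x)).sub ((hg' x).const_mul (y - x))).abs)
      (Eventually.of_forall fun n => abs_taylor_one_le (hf n) (hL n) x y)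
  rw [hasDerivAt_iff_isLittleO, Asymptotics.isLittleO_iff]
  intro ε hε
  have hδ : 0 < ε / (L + 1) := by positivity
  filter_upwards [Metric.ball_mem_nhds x hδ] with y hy
  rw [mem_ball_iff_norm, Real.norm_eq_abs] at hy
  simp only [Real.norm_eq_abs, smul_eq_mul]
  refine (hT y).trans ?_
  rw [sq, ← mul_assoc]
  refine mul_le_mul_of_nonneg_right ?_ (abs_nonneg _)
  rw [lt_div_iff₀ (by positivity)] at hy
  nlinarith [abs_nonneg (y - x)]

/-- Every right neighbourhood of `t` has positive measure and so meets the full-measure set. -/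
theorem exists_seq_tendsto_of_ae_Ici {p : ℝ → Prop}
    (hp : ∀ᵐ t ∂(volume.restrict (Ici (0 : ℝ))), p t) {t : ℝ} (ht : 0 ≤ t) :
    ∃ τ : ℕ → ℝ, (∀ n, 0 ≤ τ n ∧ p (τ n)) ∧ Tendsto τ atTop (𝓝 t) := by
  have h1 : ∀ n : ℕ, ∃ s, s ∈ Ioo t (t + 1 / ((n : ℝ) + 1)) ∧ p s := by
    intro n
    by_contra! hcon
    rw [ae_restrict_iff' measurableSet_Ici] at hp
    have hpos : (0 : ℝ) < 1 / ((n : ℝ) + 1) := by positivity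
    have hz : volume (Ioo t (t + 1 / ((n : ℝ) + 1))) = 0 := by
      refine measure_mono_null (fun s hs => ?_) hp
      exact fun hc => hcon s hs (hc (ht.trans hs.1.le))
    rw [Real.volume_Ioo, ENNReal.ofReal_eq_zero] at hz
    linarith
  choose τ hτ hpτ using h1
  refine ⟨τ, fun n => ⟨ht.trans (hτ n).1.le, hpτ n⟩, ?_⟩
  have h2 : Tendsto (fun n : ℕ => t + 1 / ((n : ℝ) + 1)) atTop (𝓝 t) := by
    simpa using (tendsto_one_div_add_atTop_nhds_zero_nat (𝕜 := ℝ)).const_add t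
  exact tendsto_of_tendsto_of_tendsto_of_le_of_le tendsto_const_nhds h2
    (fun n => (hτ n).1.le) (fun n => (hτ n).2.le)

/-- The continuous `g` makes `deriv f` locally integrable, so the fundamental theorem exhibits `f`
as a primitive of `g`. This upgrades the a.e. Sobolev representative of the derivative to the
derivative itself. -/
theorem hasDerivAt_of_deriv_ae_eq {f g : ℝ → ℝ} (hf : Differentiable ℝ f) (hg : Continuous g)
    (h : deriv f =ᵐ[volume] g) (x : ℝ) : HasDerivAt f (g x) x := by
  have hint : ∀ y, ∫ z in (0 : ℝ)..y, g z = f y - f 0 := by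
    intro y
    rw [← intervalIntegral.integral_congr_ae_restrict (ae_restrict_of_ae h)]
    exact intervalIntegral.integral_eq_sub_of_hasDerivAt (fun z _ => (hf z).hasDerivAt)
      ((hg.intervalIntegrable 0 y).congr_ae (ae_restrict_of_ae h.symm))
  have e : f = fun y => f 0 + ∫ z in (0 : ℝ)..y, g z := by
    ext y; rw [hint]; ring
  rw [e]
  exact (intervalIntegral.integral_hasDerivAt_right (hg.intervalIntegrable 0 x)
    (hg.stronglyMeasurableAtFilter _ _) hg.continuousAt).const_add _

/-! ### Space regularity of the background -/

namespace IsBackground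

variable {s cmin cmax : ℝ} {c : ℝ → ℝ → ℝ}

theorem continuous_clamped (hc : IsBackground s cmin cmax c) :
    Continuous fun z : ℝ × ℝ => c (max z.1 0) z.2 :=
  hc.continuousOn.comp_continuous (f := fun z : ℝ × ℝ => (max z.1 0, z.2)) (by fun_prop)
    fun z => ⟨show (0 : ℝ) ≤ max z.1 0 from le_max_right _ _, mem_univ _⟩

theorem continuous_slice (hc : IsBackground s cmin cmax c) {t : ℝ} (ht : 0 ≤ t) :
    Continuous (c t) := by
  have := hc.continuous_clamped.comp (continuous_const.prodMk continuous_id : Continuous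
    fun x : ℝ => (t, x))
  simpa [Function.comp_def, max_eq_left ht] using this

/-- The space derivative of a background is jointly continuous, bounded, and in `L²` initially. -/
theorem exists_spaceDeriv (hs : 2 ≤ s) (hc : IsBackground s cmin cmax c) :
    ∃ (cx : ℝ → ℝ → ℝ) (L : ℝ), 0 ≤ L ∧ Continuous (Function.uncurry cx) ∧
      (∀ t x, HasDerivAt (fun x => c (max t 0) x) (cx t x) x) ∧ (∀ t x, |cx t x| ≤ L) ∧
      MemLp (cx 0) 2 volume := by
  obtain ⟨M, hM⟩ := hc.space_deriv
  obtain ⟨C, hC⟩ := exists_continuous_derivs_of_sobolevENorm_le 1 (s := s) (by norm_num; exact hs)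
  set L : ℝ := C * M with hLdef
  -- These bounds hold for almost every `t` by Sobolev embedding and are stable under pointwise
  -- limits of `c`; continuity of `c` in time then spreads them to every `t ≥ 0`.
  set good : ℝ → Prop := fun t => ∃ g : ℝ → ℝ, (∀ x, HasDerivAt (c t) (g x) x) ∧ Continuous g ∧
    (∀ x, |g x| ≤ L) ∧ (∀ x y, |g x - g y| ≤ L * |x - y|) ∧ eLpNorm g 2 volume ≤ M with hgood
  have hae : ∀ᵐ t ∂(volume.restrict (Ici (0 : ℝ))), good t := by
    filter_upwards [hM] with t ⟨hd, hn⟩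
    obtain ⟨g, hg0, hg1, hg2⟩ := hC _ M hn
    refine ⟨g 0, hasDerivAt_of_deriv_ae_eq hd (hg1 0 (by norm_num)).1 hg0, (hg1 0 (by norm_num)).1,
      (hg1 0 (by norm_num)).2, fun x y => ?_, ?_⟩
    · obtain hb := (convex_univ (𝕜 := ℝ) (E := ℝ)).norm_image_sub_le_of_norm_hasDerivWithin_le
        (f := g 0) (f' := g 1) (C := L) (fun z _ => (hg2 0 (by norm_num) z).hasDerivWithinAt)
        (fun z _ => (hg1 1 le_rfl).2 z) (mem_univ y) (mem_univ x)
      exact hb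
    · rw [← eLpNorm_congr_ae hg0]
      exact eLpNorm_two_le_of_sobolevENorm_le (by linarith) hn
  have hall : ∀ t, 0 ≤ t → good t := by
    intro t ht
    obtain ⟨τ, hτ, hτt⟩ := exists_seq_tendsto_of_ae_Ici hae ht
    choose f' h1 h2 h3 h4 h5 using fun n => (hτ n).2
    have hlim : ∀ x, Tendsto (fun n => c (τ n) x) atTop (𝓝 (c t x)) := by
      intro x
      have hcx : Continuous fun r : ℝ => c (max r 0) x :=
        hc.continuous_clamped.comp (continuous_id.prodMk continuous_const : Continuous
          fun r : ℝ => (r, x))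
      have := (hcx.tendsto t).comp hτt
      simp only [max_eq_left ht] at this
      refine this.congr fun n => ?_
      simp [max_eq_left (hτ n).1]
    obtain ⟨g, hg, hgl⟩ := exists_hasDerivAt_of_tendsto h1 h4 hlim
    have hgL : ∀ x y, |g x - g y| ≤ L * |x - y| := fun x y =>
      le_of_tendsto ((hgl x).sub (hgl y)).abs (Eventually.of_forall fun n => h4 n x y)
    have hgc : Continuous g := by
      refine (LipschitzWith.of_dist_le_mul (K := C * M) fun x y => ?_).continuous
      rw [Real.dist_eq, Real.dist_eq]; exact hgL x y
    refine ⟨g, hg, hgc, fun x => le_of_tendsto (hgl x).abs (Eventually.of_forall fun n => h3 n x),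
      hgL, ?_⟩
    -- Fatou: the `L²` norm is lower semicontinuous along the converging derivatives.
    refine (Lp.eLpNorm_lim_le_liminf_eLpNorm (fun n => (h2 n).aestronglyMeasurable) g
      (Eventually.of_forall hgl)).trans ?_
    exact liminf_le_of_le (by isBoundedDefault) fun b hb =>
      (hb.exists).elim fun n hn => hn.trans (h5 n)
  choose! g h1 h2 h3 h4 h5 using hall
  have hmax : ∀ t : ℝ, 0 ≤ max t 0 := fun t => le_max_right _ _
  refine ⟨fun t => g (max t 0), L, by positivity, ?_, fun t x => h1 _ (hmax t) x,
    fun t x => h3 _ (hmax t) x, ?_⟩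
  · rw [Metric.continuous_iff]
    rintro ⟨t₀, x₀⟩ ε hε
    have hL0 : 0 ≤ L := by positivity
    -- The uniform Lipschitz bound reduces to the fixed point `x₀`; there interpolation turns
    -- continuity in time of `c` at `x₀` and `x₀ + h` into continuity of the derivative.
    set h := ε / (8 * (L + 1)) with hh
    have hh0 : 0 < h := by positivity
    have hhe : h * (8 * (L + 1)) = ε := by rw [hh]; field_simp
    have hct : ∀ x, Continuous fun r : ℝ => c (max r 0) x := fun x =>
      hc.continuous_clamped.comp (continuous_id.prodMk continuous_const : Continuous
        fun r : ℝ => (r, x))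
    obtain ⟨δ₁, hδ₁, d₁⟩ := Metric.continuous_iff.1 (hct x₀) t₀ (h * ε / 8) (by positivity)
    obtain ⟨δ₂, hδ₂, d₂⟩ := Metric.continuous_iff.1 (hct (x₀ + h)) t₀ (h * ε / 8) (by positivity)
    refine ⟨min h (min δ₁ δ₂), lt_min hh0 (lt_min hδ₁ hδ₂), ?_⟩
    rintro ⟨t, x⟩ hd
    rw [Prod.dist_eq, max_lt_iff, lt_min_iff, lt_min_iff, lt_min_iff] at hd
    have a1 := d₁ t hd.1.2.1
    have a2 := d₂ t hd.1.2.2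
    have a3 : |x - x₀| < h := hd.2.1
    rw [Real.dist_eq] at a1 a2 ⊢
    simp only [Function.uncurry_apply_pair]
    have b1 := h4 _ (hmax t) x x₀
    have b2 := abs_deriv_sub_le (h1 _ (hmax t)) (h1 _ (hmax t₀)) (h4 _ (hmax t)) (h4 _ (hmax t₀))
      x₀ hh0
    have b3 : (|c (max t 0) (x₀ + h) - c (max t₀ 0) (x₀ + h)| + |c (max t 0) x₀ - c (max t₀ 0) x₀|)
        / h < ε / 4 := by
      rw [div_lt_iff₀ hh0]; linarith
    have b4 := abs_sub_le (g (max t 0) x) (g (max t 0) x₀) (g (max t₀ 0) x₀)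
    have b5 : L * |x - x₀| ≤ L * h := mul_le_mul_of_nonneg_left a3.le hL0
    nlinarith
  · exact ⟨(h2 _ (hmax 0)).aestronglyMeasurable, (h5 _ (hmax 0)).trans_lt ENNReal.coe_lt_top⟩

end IsBackground

/-! ### Time regularity of the background and of its antiderivative -/

theorem eLpNorm_two_sq {α : Type*} [MeasurableSpace α] {E : Type*} [NormedAddCommGroup E]
    (f : α → E) (μ : Measure α) : eLpNorm f 2 μ ^ 2 = ∫⁻ x, ‖f x‖ₑ ^ 2 ∂μ := by
  have := eLpNorm_nnreal_pow_eq_lintegral (f := f) (μ := μ) (p := 2) (by norm_num)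
  simpa using this

theorem lintegral_sq_le_measure_mul {α : Type*} [MeasurableSpace α] {μ : Measure α}
    {f : α → ℝ≥0∞} (hf : AEMeasurable f μ) :
    (∫⁻ x, f x ∂μ) ^ 2 ≤ μ univ * ∫⁻ x, f x ^ 2 ∂μ := by
  have h := ENNReal.lintegral_mul_le_Lp_mul_Lq μ (p := 2) (q := 2)
    (by constructor <;> norm_num) (aemeasurable_const (b := (1 : ℝ≥0∞))) hf
  simp only [Pi.mul_apply, one_mul, ENNReal.one_rpow, lintegral_const] at h
  have h2 := pow_le_pow_left' h 2
  have hsq : ∀ a : ℝ≥0∞, (a ^ (1 / 2 : ℝ)) ^ 2 = a := fun a => by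
    rw [← ENNReal.rpow_natCast, ← ENNReal.rpow_mul]; norm_num
  rw [mul_pow, hsq, hsq] at h2
  simpa using h2

namespace IsBackground

variable {s cmin cmax : ℝ} {c : ℝ → ℝ → ℝ}

/-- The `L¹` bound is Fubini for the integrated time derivative. For the `L²` bound the
antiderivative is moved inside the time integral, where the `Ḣ⁻¹` bound on `∂ₜc` applies at almost
every time. -/
theorem exists_time_bounds (hs : 2 ≤ s) (hc : IsBackground s cmin cmax c) :
    ∃ M : ℝ≥0,
      (∀ t t', 0 ≤ t → t ≤ t' →
        ∫⁻ x, ‖c t' x - c t x‖ₑ ≤ M * ENNReal.ofReal (t' - t)) ∧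
      ∀ t, 0 ≤ t →
        ∫⁻ x, ‖∫ y in Iic x, (c t y - c 0 y)‖ₑ ^ 2 ≤ (M * ENNReal.ofReal t) ^ 2 := by
  obtain ⟨ct, hm, hint, M, hM⟩ := hc.time_deriv
  rw [ae_restrict_iff' measurableSet_Ici] at hM
  have hme : Measurable fun z : ℝ × ℝ => ‖ct z.1 z.2‖ₑ := hm.enorm
  have hM1 : ∀ t t', 0 ≤ t → ∀ᵐ τ ∂(volume.restrict (Ioc t t')), ∫⁻ x, ‖ct τ x‖ₑ ≤ M := by
    intro t t' ht
    rw [ae_restrict_iff' measurableSet_Ioc]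
    filter_upwards [hM] with τ hτ hτm
    rw [← eLpNorm_one_eq_lintegral_enorm]
    exact (hτ (ht.trans hτm.1.le)).2.2
  have hdouble : ∀ t t', 0 ≤ t →
      ∫⁻ τ in Ioc t t', ∫⁻ x, ‖ct τ x‖ₑ ≤ M * ENNReal.ofReal (t' - t) := by
    intro t t' ht
    calc _ ≤ ∫⁻ τ in Ioc t t', (M : ℝ≥0∞) := lintegral_mono_ae (hM1 t t' ht)
      _ = _ := by rw [setLIntegral_const, Real.volume_Ioc]
  refine ⟨M, fun t t' ht htt => ?_, fun t ht => ?_⟩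
  · calc ∫⁻ x, ‖c t' x - c t x‖ₑ ≤ ∫⁻ x, ∫⁻ τ in Ioc t t', ‖ct τ x‖ₑ := by
          refine lintegral_mono_ae ?_
          filter_upwards [hint t ht, hint t' (ht.trans htt)] with x h1 h2
          rw [h2.2, h1.2, add_sub_add_left_eq_sub,
            intervalIntegral.integral_interval_sub_left h2.1 h1.1,
            intervalIntegral.integral_of_le htt]
          exact enorm_integral_le_lintegral_enorm _
      _ = ∫⁻ τ in Ioc t t', ∫⁻ x, ‖ct τ x‖ₑ :=
          lintegral_lintegral_swap (hme.comp measurable_swap).aemeasurable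
      _ ≤ _ := hdouble t t' ht
  -- Joint integrability, from the `L¹` bound on `∂ₜc`, justifies exchanging the time integral with
  -- the integral over `(-∞, x]`.
  · have hprod : Integrable (Function.uncurry ct) ((volume.restrict (Ioc 0 t)).prod volume) := by
      refine ⟨hm.aestronglyMeasurable, ?_⟩
      show ∫⁻ z : ℝ × ℝ, ‖ct z.1 z.2‖ₑ ∂((volume.restrict (Ioc 0 t)).prod volume) < ⊤
      rw [lintegral_prod _ hme.aemeasurable]
      exact (hdouble 0 t le_rfl).trans_lt
        (ENNReal.mul_lt_top ENNReal.coe_lt_top ENNReal.ofReal_lt_top)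
    set b : ℝ → ℝ → ℝ := fun τ x => ∫ y in Iic x, ct τ y with hb
    have hbm : Measurable fun z : ℝ × ℝ => b z.1 z.2 := by
      have e : (fun z : ℝ × ℝ => b z.1 z.2) =
          fun z : ℝ × ℝ => ∫ y, (Iic z.2).indicator (ct z.1) y := by
        ext z; rw [integral_indicator measurableSet_Iic]
      rw [e]
      have hset : MeasurableSet {w : (ℝ × ℝ) × ℝ | w.2 ≤ w.1.2} :=
        measurableSet_le measurable_snd (measurable_snd.comp measurable_fst)
      have hmm : Measurable fun w : (ℝ × ℝ) × ℝ => (Iic w.1.2).indicator (ct w.1.1) w.2 :=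
        (hm.comp ((measurable_fst.comp measurable_fst).prodMk measurable_snd)).indicator hset
      exact (hmm.stronglyMeasurable.integral_prod_right).measurable
    have hbM : ∀ᵐ τ ∂(volume.restrict (Ioc 0 t)), ∫⁻ x, ‖b τ x‖ₑ ^ 2 ≤ (M : ℝ≥0∞) ^ 2 := by
      rw [ae_restrict_iff' measurableSet_Ioc]
      filter_upwards [hM] with τ hτ hτm
      obtain ⟨g1, g2, g3⟩ := hτ hτm.1.le
      have hi : Integrable (ct τ) := by
        rw [← memLp_one_iff_integrable]
        exact ⟨(hm.comp measurable_prodMk_left).aestronglyMeasurable,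
          g3.trans_lt ENNReal.coe_lt_top⟩
      rw [← eLpNorm_two_sq]
      gcongr
      exact (eLpNorm_integral_Iic_le_of_homSobolevNegOneENorm_le (by linarith) hi
        (g1.trans_lt ENNReal.coe_lt_top) g2).2
    have hB : ∀ x, ∫ y in Iic x, (c t y - c 0 y) = ∫ τ in Ioc 0 t, b τ x := by
      intro x
      have e1 : ∫ y in Iic x, (c t y - c 0 y) = ∫ y in Iic x, ∫ τ in Ioc 0 t, ct τ y := by
        refine integral_congr_ae (ae_restrict_of_ae ?_)
        filter_upwards [hint t ht] with y hy
        rw [hy.2, intervalIntegral.integral_of_le ht]; ring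
      rw [e1]
      refine (integral_integral_swap ?_).symm
      have : (volume.restrict (Ioc 0 t)).prod ((volume : Measure ℝ).restrict (Iic x))
          ≤ (volume.restrict (Ioc 0 t)).prod volume :=
        Measure.prod_mono le_rfl Measure.restrict_le_self
      exact hprod.mono_measure this
    -- Cauchy–Schwarz in time produces one factor `t`; the length of the interval after Tonelli
    -- produces the other.
    calc ∫⁻ x, ‖∫ y in Iic x, (c t y - c 0 y)‖ₑ ^ 2
        ≤ ∫⁻ x, ENNReal.ofReal t * ∫⁻ τ in Ioc 0 t, ‖b τ x‖ₑ ^ 2 := by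
          refine lintegral_mono fun x => ?_
          rw [hB]
          refine (pow_le_pow_left' (enorm_integral_le_lintegral_enorm _) 2).trans ?_
          have := lintegral_sq_le_measure_mul (μ := volume.restrict (Ioc 0 t))
            (f := fun τ => ‖b τ x‖ₑ) (hbm.comp measurable_prodMk_right).enorm.aemeasurable
          simpa using this
      _ = ENNReal.ofReal t * ∫⁻ x, ∫⁻ τ in Ioc 0 t, ‖b τ x‖ₑ ^ 2 :=
          lintegral_const_mul' _ _ ENNReal.ofReal_ne_top
      _ = ENNReal.ofReal t * ∫⁻ τ in Ioc 0 t, ∫⁻ x, ‖b τ x‖ₑ ^ 2 := by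
          rw [lintegral_lintegral_swap]
          exact ((hbm.enorm.pow_const 2).comp measurable_swap).aemeasurable
      _ ≤ ENNReal.ofReal t * ∫⁻ τ in Ioc 0 t, (M : ℝ≥0∞) ^ 2 := by
          exact mul_le_mul' le_rfl (lintegral_mono_ae hbM)
      _ = _ := by
          rw [setLIntegral_const, Real.volume_Ioc, sub_zero]; ring

theorem integrable_sub (hs : 2 ≤ s) (hc : IsBackground s cmin cmax c) {t t' : ℝ} (ht : 0 ≤ t)
    (ht' : 0 ≤ t') : Integrable fun x => c t' x - c t x := by
  obtain ⟨M, h1, -⟩ := hc.exists_time_bounds hs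
  wlog h : t ≤ t' generalizing t t'
  · refine (this ht' ht (by linarith)).neg.congr (Eventually.of_forall fun x => ?_)
    simp
  exact ⟨((hc.continuous_slice ht').sub (hc.continuous_slice ht)).aestronglyMeasurable,
    (h1 t t' ht h).trans_lt (ENNReal.mul_lt_top ENNReal.coe_lt_top ENNReal.ofReal_lt_top)⟩

/-- The antiderivative `Γ` of the background, with `∂ₓΓ = c` for `t ≥ 0`, jointly continuous. -/
theorem continuous_antideriv (hs : 2 ≤ s) (hc : IsBackground s cmin cmax c) :
    Continuous (fun z : ℝ × ℝ => (∫ y in (0 : ℝ)..z.2, c 0 y) +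
      ∫ y in Iic z.2, (c (max z.1 0) y - c 0 y)) := by
  obtain ⟨M, h1, -⟩ := hc.exists_time_bounds hs
  have hmax : ∀ t : ℝ, 0 ≤ max t 0 := fun t => le_max_right _ _
  refine ((intervalIntegral.continuous_primitive
    (fun a b => (hc.continuous_slice le_rfl).intervalIntegrable a b) 0).comp continuous_snd).add ?_
  have hti : ∀ t x, Integrable (fun y => c (max t 0) y - c 0 y) (volume.restrict (Iic x)) :=
    fun t x => (hc.integrable_sub hs le_rfl (hmax t)).restrict
  -- The Lipschitz constant in time is uniform in `x`, so continuity in `x` at one fixed time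
  -- suffices for joint continuity.
  have hlip : ∀ t t' x, |(∫ y in Iic x, (c (max t 0) y - c 0 y)) -
      ∫ y in Iic x, (c (max t' 0) y - c 0 y)| ≤ M * |t - t'| := by
    intro t t' x
    wlog h : t' ≤ t generalizing t t'
    · rw [abs_sub_comm, abs_sub_comm t]; exact this t' t (by linarith)
    rw [← integral_sub (hti t x) (hti t' x)]
    simp only [sub_sub_sub_cancel_right]
    have hmm : max t' 0 ≤ max t 0 := max_le_max_right _ h
    have e1 : ‖∫ y in Iic x, (c (max t 0) y - c (max t' 0) y)‖ₑ ≤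
        M * ENNReal.ofReal (max t 0 - max t' 0) :=
      (enorm_integral_le_lintegral_enorm _).trans
        ((lintegral_mono' Measure.restrict_le_self le_rfl).trans (h1 _ _ (hmax t') hmm))
    have e2 := ENNReal.toReal_mono
      (ENNReal.mul_lt_top ENNReal.coe_lt_top ENNReal.ofReal_lt_top).ne e1
    rw [ENNReal.toReal_mul, ENNReal.toReal_ofReal (by linarith), toReal_enorm,
      ENNReal.coe_toReal, Real.norm_eq_abs] at e2
    refine e2.trans (mul_le_mul_of_nonneg_left ?_ M.2)
    rw [← abs_of_nonneg (sub_nonneg.2 hmm)]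
    simpa using abs_max_sub_max_le_abs t t' 0
  have hx : ∀ t, Continuous fun x => ∫ y in Iic x, (c (max t 0) y - c 0 y) := by
    intro t
    have e : (fun x => ∫ y in Iic x, (c (max t 0) y - c 0 y)) = fun x =>
        (∫ y in Iic 0, (c (max t 0) y - c 0 y)) + ∫ y in (0 : ℝ)..x, (c (max t 0) y - c 0 y) := by
      ext x
      rw [← intervalIntegral.integral_Iic_sub_Iic (hti t 0) (hti t x)]; ring
    rw [e]
    exact continuous_const.add (intervalIntegral.continuous_primitive (fun a b =>
      (hc.integrable_sub hs le_rfl (hmax t)).intervalIntegrable) 0)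
  rw [Metric.continuous_iff]
  rintro ⟨t₀, x₀⟩ ε hε
  obtain ⟨δ, hδ, h⟩ := Metric.continuous_iff.1 (hx t₀) x₀ (ε / 2) (by linarith)
  refine ⟨min δ (ε / (2 * (M + 1))), lt_min hδ (by positivity), ?_⟩
  rintro ⟨t, x⟩ hd
  rw [Prod.dist_eq, max_lt_iff, lt_min_iff, lt_min_iff] at hd
  have a1 := h x hd.2.1
  have a2 : |t - t₀| < ε / (2 * (M + 1)) := hd.1.2
  rw [lt_div_iff₀ (by positivity)] at a2
  rw [Real.dist_eq] at a1 ⊢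
  have a3 := hlip t t₀ x
  simp only
  have a4 := abs_sub_le (∫ y in Iic x, (c (max t 0) y - c 0 y))
    (∫ y in Iic x, (c (max t₀ 0) y - c 0 y)) (∫ y in Iic x₀, (c (max t₀ 0) y - c 0 y))
  have := abs_nonneg (t - t₀)
  linarith

theorem hasDerivAt_antideriv (hs : 2 ≤ s) (hc : IsBackground s cmin cmax c) {t : ℝ} (ht : 0 ≤ t)
    (x : ℝ) : HasDerivAt (fun x => (∫ y in (0 : ℝ)..x, c 0 y) + ∫ y in Iic x, (c t y - c 0 y))
      (c t x) x := by
  have hc0 := hc.continuous_slice le_rfl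
  have hct := (hc.continuous_slice ht).sub hc0
  have hi := hc.integrable_sub hs le_rfl ht
  have e : (fun x => (∫ y in (0 : ℝ)..x, c 0 y) + ∫ y in Iic x, (c t y - c 0 y)) = fun x =>
      (∫ y in (0 : ℝ)..x, c 0 y) + ((∫ y in Iic 0, (c t y - c 0 y)) +
        ∫ y in (0 : ℝ)..x, (c t y - c 0 y)) := by
    ext x
    rw [← intervalIntegral.integral_Iic_sub_Iic hi.restrict hi.restrict]; ring
  rw [e]
  have h1 := intervalIntegral.integral_hasDerivAt_right (hc0.intervalIntegrable 0 x)
    (hc0.stronglyMeasurableAtFilter _ _) hc0.continuousAt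
  have h2 := (intervalIntegral.integral_hasDerivAt_right (hct.intervalIntegrable 0 x)
    (hct.stronglyMeasurableAtFilter _ _) hct.continuousAt).const_add
      (∫ y in Iic 0, (c t y - c 0 y))
  convert! h1.add h2 using 1
  simp

end IsBackground

/-! ### The damped oscillator equation on a short symmetric interval -/

/-- Truncation of the time variable to `[-T, T]`. -/
noncomputable def clampTime (T t : ℝ) : ℝ := max (-T) (min T t)

theorem continuous_clampTime (T : ℝ) : Continuous (clampTime T) := by
  unfold clampTime; fun_prop

theorem clampTime_mem {T : ℝ} (hT : 0 < T) (t : ℝ) : clampTime T t ∈ Icc (-T) T :=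
  ⟨le_max_left _ _, max_le (by linarith) (min_le_left _ _)⟩

theorem clampTime_of_mem {T t : ℝ} (ht : t ∈ Icc (-T) T) : clampTime T t = t := by
  rw [clampTime, min_eq_right ht.2, max_eq_right ht.1]

/-- `p' = q`, `q' = -ν q + g` on `[-T, T]` in integrated form, with `p`, `q` frozen outside. -/
structure SolvesOscillator (ν T : ℝ) (p q g : ℝ → ℝ) : Prop where
  cont_p : Continuous p
  cont_q : Continuous q
  cont_g : Continuous g
  clamp_p : ∀ t, p t = p (clampTime T t)
  clamp_q : ∀ t, q t = q (clampTime T t)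
  eq_p : ∀ t ∈ Icc (-T) T, p t = p 0 + ∫ s in (0 : ℝ)..t, q s
  eq_q : ∀ t ∈ Icc (-T) T, q t = q 0 + ∫ s in (0 : ℝ)..t, (-ν * q s + g s)

namespace SolvesOscillator

variable {ν T : ℝ} {p q g p' q' g' : ℝ → ℝ}

theorem sub (h : SolvesOscillator ν T p q g) (h' : SolvesOscillator ν T p' q' g') :
    SolvesOscillator ν T (fun t => p t - p' t) (fun t => q t - q' t) (fun t => g t - g' t) where
  cont_p := h.cont_p.sub h'.cont_p
  cont_q := h.cont_q.sub h'.cont_q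
  cont_g := h.cont_g.sub h'.cont_g
  clamp_p t := by rw [h.clamp_p, h'.clamp_p]
  clamp_q t := by rw [h.clamp_q, h'.clamp_q]
  eq_p t ht := by
    rw [intervalIntegral.integral_sub (h.cont_q.intervalIntegrable _ _)
      (h'.cont_q.intervalIntegrable _ _), h.eq_p t ht, h'.eq_p t ht]
    ring
  eq_q t ht := by
    have e : ∀ s, -ν * (q s - q' s) + (g s - g' s) = (-ν * q s + g s) - (-ν * q' s + g' s) :=
      fun s => by ring
    have c1 : Continuous fun s => -ν * q s + g s := (h.cont_q.const_mul _).add h.cont_g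
    have c2 : Continuous fun s => -ν * q' s + g' s := (h'.cont_q.const_mul _).add h'.cont_g
    simp only [e]
    rw [intervalIntegral.integral_sub (c1.intervalIntegrable _ _) (c2.intervalIntegrable _ _),
      h.eq_q t ht, h'.eq_q t ht]
    ring

theorem const_mul (h : SolvesOscillator ν T p q g) (c : ℝ) :
    SolvesOscillator ν T (fun t => c * p t) (fun t => c * q t) (fun t => c * g t) where
  cont_p := h.cont_p.const_mul c
  cont_q := h.cont_q.const_mul c
  cont_g := h.cont_g.const_mul c
  clamp_p t := by rw [h.clamp_p]
  clamp_q t := by rw [h.clamp_q]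
  eq_p t ht := by
    rw [intervalIntegral.integral_const_mul, h.eq_p t ht]; ring
  eq_q t ht := by
    have e : ∀ s, -ν * (c * q s) + c * g s = c * (-ν * q s + g s) := fun s => by ring
    simp only [e]
    rw [intervalIntegral.integral_const_mul, h.eq_q t ht]; ring

theorem hasDerivAt (h : SolvesOscillator ν T p q g) {t : ℝ} (ht : t ∈ Ioo (-T) T) :
    HasDerivAt p (q t) t ∧ HasDerivAt q (-ν * q t + g t) t := by
  have hn : ∀ᶠ s in 𝓝 t, s ∈ Icc (-T) T := Icc_mem_nhds ht.1 ht.2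
  have c1 : Continuous fun s => -ν * q s + g s := (h.cont_q.const_mul _).add h.cont_g
  constructor
  · have := (intervalIntegral.integral_hasDerivAt_right (h.cont_q.intervalIntegrable 0 t)
      (h.cont_q.stronglyMeasurableAtFilter _ _) h.cont_q.continuousAt).const_add (p 0)
    exact this.congr_of_eventuallyEq (hn.mono fun s hs => h.eq_p s hs)
  · have := (intervalIntegral.integral_hasDerivAt_right (c1.intervalIntegrable 0 t)
      (c1.stronglyMeasurableAtFilter _ _) c1.continuousAt).const_add (q 0)
    exact this.congr_of_eventuallyEq (hn.mono fun s hs => h.eq_q s hs)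

/-- Comparison with the integral over the whole interval makes later estimates indifferent to the
sign of `t`. -/
theorem abs_integral_le_of_le {T : ℝ} {f b : ℝ → ℝ} (hb : Continuous b)
    (hfb : ∀ s ∈ Icc (-T) T, |f s| ≤ b s) {t : ℝ} (ht : t ∈ Icc (-T) T) :
    |∫ s in (0 : ℝ)..t, f s| ≤ ∫ s in (-T)..T, b s := by
  have hT : -T ≤ T := ht.1.trans ht.2
  have h0 : (0 : ℝ) ∈ Icc (-T) T := ⟨by linarith, by linarith⟩
  have hsub : Ι 0 t ⊆ Icc (-T) T := uIoc_subset_uIcc.trans (uIcc_subset_Icc h0 ht)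
  have hsub' : Ι 0 t ⊆ Ioc (-T) T := by
    intro x hx
    rw [uIoc, mem_Ioc] at hx
    exact ⟨lt_of_le_of_lt (le_min h0.1 ht.1) hx.1, hx.2.trans (max_le h0.2 ht.2)⟩
  have hbi : IntegrableOn b (Ioc (-T) T) :=
    (hb.integrableOn_Icc (a := -T) (b := T) (μ := volume)).mono_set Ioc_subset_Icc_self
  rw [intervalIntegral.integral_of_le hT]
  have hb0 : ∀ s ∈ Icc (-T) T, 0 ≤ b s := fun s hs => (abs_nonneg _).trans (hfb s hs)
  calc |∫ s in (0 : ℝ)..t, f s| ≤ |∫ s in (0 : ℝ)..t, b s| := by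
        rw [← Real.norm_eq_abs (∫ s in (0 : ℝ)..t, f s)]
        refine intervalIntegral.norm_integral_le_abs_of_norm_le (μ := volume) ?_
          (hb.intervalIntegrable _ _)
        filter_upwards [ae_restrict_mem measurableSet_uIoc] with s hs
        exact hfb s (hsub hs)
    _ = ∫ s in Ι 0 t, b s := by
        have e := intervalIntegral.norm_intervalIntegral_eq b 0 t (volume : Measure ℝ)
        rw [Real.norm_eq_abs] at e
        rw [e, Real.norm_of_nonneg]
        exact setIntegral_nonneg measurableSet_uIoc fun s hs => hb0 s (hsub hs)
    _ ≤ ∫ s in Ioc (-T) T, b s := by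
        refine setIntegral_mono_set hbi ?_ hsub'.eventuallyLE
        filter_upwards [ae_restrict_mem measurableSet_Ioc] with s hs
        exact hb0 s (Ioc_subset_Icc_self hs)

/-- A priori bound on a short time interval. -/
theorem bound (h : SolvesOscillator ν T p q g) {K : ℝ} (hT : 0 < T) (hK : 0 ≤ K)
    (hTK : T * (1 + |ν| + K) ≤ 1 / 4) {r : ℝ → ℝ} (hr : Continuous r)
    (hg : ∀ t ∈ Icc (-T) T, |g t| ≤ K * |p t| + r t) (t : ℝ) :
    |p t| + |q t| ≤ 2 * (|p 0| + |q 0| + ∫ s in (-T)..T, r s) := by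
  have h0 : (0 : ℝ) ∈ Icc (-T) T := ⟨by linarith, by linarith⟩
  -- At a maximum point of `|p| + |q|` the integral equations give `S ≤ |p 0| + |q 0| + ∫ r + 2T(1 +
  -- |ν| + K) S`. The smallness of `T` makes the last term at most `S/2`, whence the factor `2`; no
  -- exponential appears.
  obtain ⟨m, hm, hmax⟩ := isCompact_Icc.exists_isMaxOn ⟨0, h0⟩
    ((h.cont_p.abs.add h.cont_q.abs).continuousOn (s := Icc (-T) T))
  set S := |p m| + |q m| with hS
  have hle : ∀ s ∈ Icc (-T) T, |p s| + |q s| ≤ S := fun s hs => hmax hs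
  have hS0 : 0 ≤ S := by positivity
  have b1 : |∫ s in (0 : ℝ)..m, q s| ≤ ∫ s in (-T)..T, S :=
    abs_integral_le_of_le continuous_const
      (fun s hs => by linarith [hle s hs, abs_nonneg (p s)]) hm
  have b2 : |∫ s in (0 : ℝ)..m, (-ν * q s + g s)| ≤ ∫ s in (-T)..T, ((|ν| + K) * S + r s) := by
    refine abs_integral_le_of_le (by fun_prop) (fun s hs => ?_) hm
    have e1 : |-ν * q s| ≤ |ν| * S := by
      rw [abs_mul, abs_neg]
      exact mul_le_mul_of_nonneg_left (by linarith [hle s hs, abs_nonneg (p s)]) (abs_nonneg _)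
    have e2 : K * |p s| ≤ K * S :=
      mul_le_mul_of_nonneg_left (by linarith [hle s hs, abs_nonneg (q s)]) hK
    have := abs_add_le (-ν * q s) (g s)
    linarith [hg s hs]
  rw [intervalIntegral.integral_const] at b1
  rw [intervalIntegral.integral_add intervalIntegrable_const (hr.intervalIntegrable _ _),
    intervalIntegral.integral_const] at b2
  simp only [smul_eq_mul] at b1 b2
  have e1 := abs_add_le (p 0) (∫ s in (0 : ℝ)..m, q s)
  have e2 := abs_add_le (q 0) (∫ s in (0 : ℝ)..m, (-ν * q s + g s))
  rw [← h.eq_p m hm] at e1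
  rw [← h.eq_q m hm] at e2
  have hTS : T * (1 + |ν| + K) * S ≤ 1 / 4 * S := mul_le_mul_of_nonneg_right hTK hS0
  have hfin : S ≤ 2 * (|p 0| + |q 0| + ∫ s in (-T)..T, r s) := by nlinarith
  rw [h.clamp_p t, h.clamp_q t]
  exact (hle _ (clampTime_mem hT t)).trans hfin

end SolvesOscillator

/-- Existence for `p' = q`, `q' = -ν q + g(t, p)`, with `g` Lipschitz in `p`, on a short interval. -/
theorem exists_solvesOscillator {ν T K : ℝ} (hT : 0 < T) (hK : 0 ≤ K)
    (hTK : T * (1 + |ν| + K) ≤ 1 / 4) {g : ℝ → ℝ → ℝ} (hg : Continuous (Function.uncurry g))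
    (hL : ∀ t x y, |g t x - g t y| ≤ K * |x - y|) (p₀ q₀ : ℝ) :
    ∃ p q : ℝ → ℝ, p 0 = p₀ ∧ q 0 = q₀ ∧ SolvesOscillator ν T p q (fun t => g t (p t)) := by
  set f : ℝ → ℝ × ℝ → ℝ × ℝ := fun t x => (x.2, -ν * x.2 + g t x.1) with hf
  have hfc : Continuous fun z : ℝ × (ℝ × ℝ) => f z.1 z.2 := by
    have : Continuous fun z : ℝ × (ℝ × ℝ) => g z.1 z.2.1 :=
      hg.comp (continuous_fst.prodMk (continuous_fst.comp continuous_snd))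
    simp only [hf]; fun_prop
  set L : ℝ := 1 + |ν| + K with hLdef
  have hL0 : 0 ≤ L := by positivity
  have hfL : ∀ t x y, dist (f t x) (f t y) ≤ L * dist x y := by
    intro t x y
    have h1 : |x.1 - y.1| ≤ dist x y := by
      rw [← Real.dist_eq, Prod.dist_eq]; exact le_max_left _ _
    have h2 : |x.2 - y.2| ≤ dist x y := by
      rw [← Real.dist_eq, Prod.dist_eq]; exact le_max_right _ _
    have hd : 0 ≤ dist x y := dist_nonneg
    rw [Prod.dist_eq]
    refine max_le ?_ ?_
    · rw [Real.dist_eq]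
      simp only [hf]
      nlinarith [abs_nonneg ν]
    · rw [Real.dist_eq]
      simp only [hf]
      have e : -ν * x.2 + g t x.1 - (-ν * y.2 + g t y.1)
          = -ν * (x.2 - y.2) + (g t x.1 - g t y.1) := by ring
      rw [e]
      refine (abs_add_le _ _).trans ?_
      rw [abs_mul, abs_neg]
      have := mul_le_mul_of_nonneg_left h2 (abs_nonneg ν)
      have := mul_le_mul_of_nonneg_left h1 hK
      linarith [hL t x.1 y.1]
  set x₀ : ℝ × ℝ := (p₀, q₀)
  obtain ⟨N, hN⟩ := isCompact_Icc.exists_bound_of_continuousOn (s := Icc (-T) T)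
    (f := fun t => f t x₀) (hfc.comp (continuous_id.prodMk continuous_const)).continuousOn
  have h0 : (0 : ℝ) ∈ Icc (-T) T := ⟨by linarith, by linarith⟩
  have hN0 : 0 ≤ N := (norm_nonneg _).trans (hN 0 h0)
  -- On the ball of radius `R` the field has size at most `N + LR`, and `TL ≤ 1/4` yields `(N + LR)
  -- T ≤ R/2 + R/4`. So Picard–Lindelöf reaches the whole interval whatever the size of the data.
  set R : ℝ := 2 * N * T with hR
  have hR0 : 0 ≤ R := by positivity
  have hPL : IsPicardLindelof f (⟨0, h0⟩ : Icc (-T) T) x₀ ⟨R, hR0⟩ 0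
      ⟨N + L * R, by positivity⟩ ⟨L, hL0⟩ := by
    refine ⟨fun t _ => LipschitzOnWith.of_dist_le_mul fun x _ y _ => hfL t x y, fun x _ => ?_,
      fun t ht x hx => ?_, ?_⟩
    · exact (hfc.comp (continuous_id.prodMk continuous_const)).continuousOn
    · have h1 := hfL t x x₀
      have h2 : dist x x₀ ≤ R := hx
      have h3 : ‖f t x‖ ≤ ‖f t x₀‖ + dist (f t x) (f t x₀) := by
        rw [dist_eq_norm]; exact norm_le_norm_add_norm_sub' _ _
      have h4 := mul_le_mul_of_nonneg_left h2 hL0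
      have := hN t ht
      show ‖f t x‖ ≤ N + L * R
      linarith
    · simp only [sub_zero, zero_sub, neg_neg, max_self, NNReal.coe_zero]
      show (N + L * R) * T ≤ R
      have : T * L * R ≤ 1 / 4 * R := mul_le_mul_of_nonneg_right hTK hR0
      nlinarith
  obtain ⟨α, hα0, hα⟩ := hPL.exists_eq_forall_mem_Icc_hasDerivWithinAt₀
  have hα0' : α 0 = x₀ := hα0
  have hαc : ContinuousOn α (Icc (-T) T) := fun t ht => (hα t ht).continuousWithinAt
  have hcc : Continuous fun t => α (clampTime T t) :=
    hαc.comp_continuous (continuous_clampTime T) fun t => clampTime_mem hT t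
  have hc0 : clampTime T 0 = 0 := clampTime_of_mem h0
  have hp : Continuous fun t => (α (clampTime T t)).1 := continuous_fst.comp hcc
  have hq : Continuous fun t => (α (clampTime T t)).2 := continuous_snd.comp hcc
  have hgc : Continuous fun t => g t (α (clampTime T t)).1 :=
    hg.comp (continuous_id.prodMk hp)
  have hder : ∀ t ∈ Ioo (-T) T, HasDerivAt (fun t => α (clampTime T t))
      (f t (α (clampTime T t))) t := by
    intro t ht
    have hn := Icc_mem_nhds ht.1 ht.2
    rw [clampTime_of_mem (Ioo_subset_Icc_self ht)]
    exact ((hα t (Ioo_subset_Icc_self ht)).hasDerivAt hn).congr_of_eventuallyEq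
      (mem_of_superset hn fun s hs => congrArg α (clampTime_of_mem hs))
  have hIoo : ∀ t ∈ Icc (-T) T, Ioo (min 0 t) (max 0 t) ⊆ Ioo (-T) T := fun t ht s hs =>
    ⟨lt_of_le_of_lt (le_min h0.1 ht.1) hs.1, lt_of_lt_of_le hs.2 (max_le h0.2 ht.2)⟩
  have hidem : ∀ t, clampTime T (clampTime T t) = clampTime T t := fun t =>
    clampTime_of_mem (clampTime_mem hT t)
  refine ⟨fun t => (α (clampTime T t)).1, fun t => (α (clampTime T t)).2,
    by simp [hc0, hα0', x₀], by simp [hc0, hα0', x₀], ⟨hp, hq, hgc, fun t => by simp only [hidem],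
      fun t => by simp only [hidem], fun t ht => ?_, fun t ht => ?_⟩⟩
  · have e : ∫ s in (0 : ℝ)..t, (α (clampTime T s)).2 = _ :=
      intervalIntegral.integral_eq_sub_of_hasDeriv_right hp.continuousOn
        (fun s hs => ((ContinuousLinearMap.fst ℝ ℝ ℝ).hasFDerivAt.comp_hasDerivAt s
          (hder s (hIoo t ht hs))).hasDerivWithinAt) (hq.intervalIntegrable _ _)
    rw [e]; ring
  · have e : ∫ s in (0 : ℝ)..t, (-ν * (α (clampTime T s)).2 + g s (α (clampTime T s)).1) = _ :=
      intervalIntegral.integral_eq_sub_of_hasDeriv_right hq.continuousOn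
        (fun s hs => ((ContinuousLinearMap.snd ℝ ℝ ℝ).hasFDerivAt.comp_hasDerivAt s
          (hder s (hIoo t ht hs))).hasDerivWithinAt)
        (((hq.const_mul _).add hgc).intervalIntegrable _ _)
    rw [e]; ring

/-! ### Dependence of oscillator solutions on a parameter -/

theorem exists_mvt {f f' : ℝ → ℝ} (hf : ∀ x, HasDerivAt f (f' x) x) (x y : ℝ) :
    ∃ z, |z - x| ≤ |y - x| ∧ f y - f x = f' z * (y - x) := by
  have hd : ∀ x, deriv f x = f' x := fun x => (hf x).deriv
  have hc : Continuous f := continuous_iff_continuousAt.2 fun x => (hf x).continuousAt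
  rcases lt_trichotomy x y with h | h | h
  · obtain ⟨z, hz, e⟩ := exists_deriv_eq_slope f h hc.continuousOn
      fun z _ => (hf z).differentiableAt.differentiableWithinAt
    refine ⟨z, ?_, ?_⟩
    · rw [abs_of_pos (by linarith [hz.1]), abs_of_pos (by linarith)]; linarith [hz.2]
    · rw [← hd, e, div_mul_cancel₀ _ (by linarith : y - x ≠ 0)]
  · exact ⟨x, by simp, by simp [h]⟩
  · obtain ⟨z, hz, e⟩ := exists_deriv_eq_slope f h hc.continuousOn
      fun z _ => (hf z).differentiableAt.differentiableWithinAt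
    refine ⟨z, ?_, ?_⟩
    · rw [abs_of_neg (by linarith [hz.2]), abs_of_neg (by linarith)]; linarith [hz.1]
    · rw [← hd, e]
      have : x - y ≠ 0 := by linarith
      field_simp; ring

/-- A tube argument: the curve `t ↦ (t, a₀, γ t)` has compact image, near which continuity of `F` is
uniform. -/
theorem exists_uniform_delta_along_curve {F : ℝ → ℝ → ℝ → ℝ}
    (hF : Continuous fun z : ℝ × ℝ × ℝ => F z.1 z.2.1 z.2.2) {γ : ℝ → ℝ} (hγ : Continuous γ)
    (a₀ T : ℝ) {ε : ℝ} (hε : 0 < ε) :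
    ∃ δ > 0, ∀ t ∈ Icc (-T) T, ∀ a p, |a - a₀| < δ → |p - γ t| < δ →
      |F t a p - F t a₀ (γ t)| < ε := by
  have hcomp : IsCompact ((fun t => (t, a₀, γ t)) '' Icc (-T) T) :=
    isCompact_Icc.image (by fun_prop)
  have := hcomp.uniformContinuousAt_of_continuousAt _ (fun z _ => hF.continuousAt)
    (Metric.dist_mem_uniformity hε)
  obtain ⟨δ, hδ, h⟩ := Metric.mem_uniformity_dist.1 this
  refine ⟨δ, hδ, fun t ht a p ha hp => ?_⟩
  have hd : dist (t, a₀, γ t) (t, a, p) < δ := by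
    rw [Prod.dist_eq, Prod.dist_eq, dist_self]
    refine max_lt hδ (max_lt ?_ ?_)
    · rwa [dist_comm, Real.dist_eq]
    · rwa [dist_comm, Real.dist_eq]
  have := h hd ⟨t, ht, rfl⟩
  simp only [mem_ofPred_eq, Real.dist_eq] at this
  rwa [abs_sub_comm]

theorem continuous_uncurry_of_uniform {F : ℝ → ℝ → ℝ} (h1 : ∀ a, Continuous fun t => F t a)
    (h2 : ∀ a₀, ∀ ε > 0, ∃ δ > 0, ∀ a, |a - a₀| < δ → ∀ t, |F t a - F t a₀| ≤ ε) :
    Continuous (Function.uncurry F) := by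
  rw [Metric.continuous_iff]
  rintro ⟨t₀, a₀⟩ ε hε
  obtain ⟨δ, hδ, h⟩ := h2 a₀ (ε / 2) (by linarith)
  obtain ⟨δ', hδ', h'⟩ := Metric.continuous_iff.1 (h1 a₀) t₀ (ε / 2) (by linarith)
  refine ⟨min δ δ', lt_min hδ hδ', ?_⟩
  rintro ⟨t, a⟩ hd
  rw [Prod.dist_eq, max_lt_iff, lt_min_iff, lt_min_iff] at hd
  have e1 := h a (by rw [← Real.dist_eq]; exact hd.2.1) t
  have e2 := h' t hd.1.2
  rw [Real.dist_eq] at e2 ⊢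
  simp only [Function.uncurry_apply_pair]
  have := abs_sub_le (F t a) (F t a₀) (F t₀ a₀)
  linarith

/-- A family of oscillator problems, continuous in the parameter. -/
theorem exists_continuous_family {ν T K : ℝ} (hT : 0 < T) (hK : 0 ≤ K)
    (hTK : T * (1 + |ν| + K) ≤ 1 / 4) {g : ℝ → ℝ → ℝ → ℝ}
    (hg : Continuous fun z : ℝ × ℝ × ℝ => g z.1 z.2.1 z.2.2)
    (hL : ∀ t a x y, |g t a x - g t a y| ≤ K * |x - y|) {α β : ℝ → ℝ} (hα : Continuous α)
    (hβ : Continuous β) :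
    ∃ p q : ℝ → ℝ → ℝ, Continuous (Function.uncurry p) ∧ Continuous (Function.uncurry q) ∧
      (∀ a, p 0 a = α a ∧ q 0 a = β a) ∧
      ∀ a, SolvesOscillator ν T (fun t => p t a) (fun t => q t a) (fun t => g t a (p t a)) := by
  have ex : ∀ a, ∃ p q : ℝ → ℝ, p 0 = α a ∧ q 0 = β a ∧
      SolvesOscillator ν T p q (fun t => g t a (p t)) := fun a =>
    exists_solvesOscillator hT hK hTK (g := fun t x => g t a x)
      (hg.comp (continuous_fst.prodMk (continuous_const.prodMk continuous_snd)))
      (fun t x y => hL t a x y) _ _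
  choose p q hp0 hq0 hs using ex
  have unif : ∀ a₀, ∀ ε > 0, ∃ δ > 0, ∀ a, |a - a₀| < δ →
      ∀ t, |p a t - p a₀ t| + |q a t - q a₀ t| ≤ ε := by
    intro a₀ ε hε
    set η := ε / (8 * (1 + 2 * T)) with hη
    have hη0 : 0 < η := by positivity
    obtain ⟨δ₁, hδ₁, h₁⟩ := exists_uniform_delta_along_curve hg (hs a₀).cont_p a₀ T hη0
    obtain ⟨δ₂, hδ₂, h₂⟩ := Metric.continuous_iff.1 hα a₀ η hη0
    obtain ⟨δ₃, hδ₃, h₃⟩ := Metric.continuous_iff.1 hβ a₀ η hη0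
    refine ⟨min δ₁ (min δ₂ δ₃), lt_min hδ₁ (lt_min hδ₂ hδ₃), fun a ha t => ?_⟩
    rw [lt_min_iff, lt_min_iff] at ha
    -- The difference of two solutions is an oscillator whose source splits into a Lipschitz part in
    -- `p` and a change of parameter of size at most `η`.
    have hb := ((hs a).sub (hs a₀)).bound hT hK hTK (r := fun _ => η) continuous_const
      (fun t ht => by
        have e1 := hL t a (p a t) (p a₀ t)
        have e2 := h₁ t ht a (p a₀ t) ha.1 (by simpa using hδ₁)
        have := abs_sub_le (g t a (p a t)) (g t a (p a₀ t)) (g t a₀ (p a₀ t))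
        linarith) t
    have i1 := h₂ a (by rw [Real.dist_eq]; exact ha.2.1)
    have i2 := h₃ a (by rw [Real.dist_eq]; exact ha.2.2)
    rw [Real.dist_eq] at i1 i2
    rw [intervalIntegral.integral_const] at hb
    simp only [hp0, hq0, smul_eq_mul] at hb
    have : η * (8 * (1 + 2 * T)) = ε := by rw [hη]; field_simp
    nlinarith
  refine ⟨fun t a => p a t, fun t a => q a t, ?_, ?_, fun a => ⟨hp0 a, hq0 a⟩, hs⟩
  · refine continuous_uncurry_of_uniform (fun a => (hs a).cont_p) fun a₀ ε hε => ?_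
    obtain ⟨δ, hδ, h⟩ := unif a₀ ε hε
    exact ⟨δ, hδ, fun a ha t => by linarith [h a ha t, abs_nonneg (q a t - q a₀ t)]⟩
  · refine continuous_uncurry_of_uniform (fun a => (hs a).cont_q) fun a₀ ε hε => ?_
    obtain ⟨δ, hδ, h⟩ := unif a₀ ε hε
    exact ⟨δ, hδ, fun a ha t => by linarith [h a ha t, abs_nonneg (p a t - p a₀ t)]⟩

/-- A family of oscillator problems, continuously differentiable in the parameter; the derivative
solves the linearised problem. -/
theorem exists_differentiable_family {ν T K : ℝ} (hT : 0 < T) (hK : 0 ≤ K)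
    (hTK : T * (1 + |ν| + K) ≤ 1 / 4) {g ga gp : ℝ → ℝ → ℝ → ℝ}
    (hg : Continuous fun z : ℝ × ℝ × ℝ => g z.1 z.2.1 z.2.2)
    (hga : Continuous fun z : ℝ × ℝ × ℝ => ga z.1 z.2.1 z.2.2)
    (hgp : Continuous fun z : ℝ × ℝ × ℝ => gp z.1 z.2.1 z.2.2)
    (dga : ∀ t a x, HasDerivAt (fun a => g t a x) (ga t a x) a)
    (dgp : ∀ t a x, HasDerivAt (fun x => g t a x) (gp t a x) x)
    (hb : ∀ t a x, |gp t a x| ≤ K) {α β α' β' : ℝ → ℝ}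
    (dα : ∀ a, HasDerivAt α (α' a) a) (dβ : ∀ a, HasDerivAt β (β' a) a)
    (hα' : Continuous α') (hβ' : Continuous β') :
    ∃ p q P Q : ℝ → ℝ → ℝ,
      (Continuous (Function.uncurry p) ∧ Continuous (Function.uncurry q) ∧
        Continuous (Function.uncurry P) ∧ Continuous (Function.uncurry Q)) ∧
      (∀ a, p 0 a = α a ∧ q 0 a = β a ∧ P 0 a = α' a ∧ Q 0 a = β' a) ∧
      (∀ a, SolvesOscillator ν T (fun t => p t a) (fun t => q t a) (fun t => g t a (p t a))) ∧
      (∀ a, SolvesOscillator ν T (fun t => P t a) (fun t => Q t a)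
        (fun t => ga t a (p t a) + gp t a (p t a) * P t a)) ∧
      ∀ t a, HasDerivAt (fun a => p t a) (P t a) a ∧ HasDerivAt (fun a => q t a) (Q t a) a := by
  have hL : ∀ t a x y, |g t a x - g t a y| ≤ K * |x - y| := by
    intro t a x y
    obtain ⟨z, -, e⟩ := exists_mvt (dgp t a) y x
    rw [e, abs_mul]
    exact mul_le_mul_of_nonneg_right (hb t a z) (abs_nonneg _)
  obtain ⟨p, q, hpc, hqc, h0, hs⟩ := exists_continuous_family hT hK hTK hg hL
    (continuous_iff_continuousAt.2 fun a => (dα a).continuousAt)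
    (continuous_iff_continuousAt.2 fun a => (dβ a).continuousAt)
  have hcomp : ∀ {F : ℝ → ℝ → ℝ → ℝ}, Continuous (fun z : ℝ × ℝ × ℝ => F z.1 z.2.1 z.2.2) →
      Continuous fun z : ℝ × ℝ × ℝ => F z.1 z.2.1 (p z.1 z.2.1) := by
    intro F hF
    have : Continuous fun z : ℝ × ℝ × ℝ => p z.1 z.2.1 :=
      hpc.comp (continuous_fst.prodMk (continuous_fst.comp continuous_snd))
    exact hF.comp (continuous_fst.prodMk ((continuous_fst.comp continuous_snd).prodMk this))
  obtain ⟨P, Q, hPc, hQc, h0', hs'⟩ := exists_continuous_family hT hK hTK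
    (g := fun t a x => ga t a (p t a) + gp t a (p t a) * x)
    ((hcomp hga).add ((hcomp hgp).mul (continuous_snd.comp continuous_snd)))
    (fun t a x y => by
      rw [add_sub_add_left_eq_sub, ← mul_sub, abs_mul]
      exact mul_le_mul_of_nonneg_right (hb _ _ _) (abs_nonneg _)) hα' hβ'
  refine ⟨p, q, P, Q, ⟨hpc, hqc, hPc, hQc⟩,
    fun a => ⟨(h0 a).1, (h0 a).2, (h0' a).1, (h0' a).2⟩, hs, hs', ?_⟩
  -- The first-order remainder in the parameter itself solves an oscillator problem, with data and
  -- source `o(|a - a₀|)` up to a Lipschitz term; the a priori bound makes the remainder `o(|a -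
  -- a₀|)` uniformly in time.
  have key : ∀ a₀, ∀ c > 0, ∀ᶠ a in 𝓝 a₀, ∀ t,
      |p t a - p t a₀ - (a - a₀) * P t a₀| + |q t a - q t a₀ - (a - a₀) * Q t a₀|
        ≤ c * |a - a₀| := by
    intro a₀ c hc
    obtain ⟨N, hN⟩ := isCompact_Icc.exists_bound_of_continuousOn (s := Icc (-T) T)
      (f := fun t => P t a₀) (hs' a₀).cont_p.continuousOn
    have hN0 : 0 ≤ N := (norm_nonneg _).trans (hN 0 ⟨by linarith, by linarith⟩)
    set ε := c / (8 * (1 + 2 * T) * (1 + N)) with hε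
    have hε0 : 0 < ε := by positivity
    have hεc : ε * (8 * (1 + 2 * T) * (1 + N)) = c := by rw [hε]; field_simp
    obtain ⟨δ₁, hδ₁, h₁⟩ := exists_uniform_delta_along_curve hga (hs a₀).cont_p a₀ T hε0
    obtain ⟨δ₂, hδ₂, h₂⟩ := exists_uniform_delta_along_curve hgp (hs a₀).cont_p a₀ T hε0
    have hpu : ∀ᶠ a in 𝓝 a₀, ∀ t ∈ Icc (-T) T, |p t a - p t a₀| < δ₂ := by
      -- The third argument is a dummy: only uniformity in time of `p t a → p t a₀` is wanted.
      obtain ⟨δ, hδ, h⟩ := exists_uniform_delta_along_curve (F := fun t a _ => p t a)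
        (hpc.comp (continuous_fst.prodMk (continuous_fst.comp continuous_snd)))
        (continuous_const (y := (0 : ℝ))) a₀ T hδ₂
      filter_upwards [Metric.ball_mem_nhds a₀ hδ] with a ha t ht
      exact h t ht a 0 (by simpa [Real.dist_eq] using ha) (by simpa using hδ)
    have hα1 := (hasDerivAt_iff_isLittleO.1 (dα a₀)).def hε0
    have hβ1 := (hasDerivAt_iff_isLittleO.1 (dβ a₀)).def hε0
    filter_upwards [hpu, hα1, hβ1, Metric.ball_mem_nhds a₀ hδ₁, Metric.ball_mem_nhds a₀ hδ₂]
      with a hpa hαa hβa ha1 ha2 t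
    rw [mem_ball_iff_norm, Real.norm_eq_abs] at ha1 ha2
    have hbd := (((hs a).sub (hs a₀)).sub ((hs' a₀).const_mul (a - a₀))).bound hT hK hTK
      (r := fun _ => ε * (1 + N) * |a - a₀|) continuous_const (fun t ht => by
        obtain ⟨ξ, hξ, e1⟩ := exists_mvt (dgp t a) (p t a₀) (p t a)
        obtain ⟨ζ, hζ, e2⟩ := exists_mvt (fun a => dga t a (p t a₀)) a₀ a
        have b1 := h₁ t ht ζ (p t a₀) (hζ.trans_lt ha1) (by simpa using hδ₁)
        have b2 := h₂ t ht a ξ ha2 (hξ.trans_lt (hpa t ht))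
        have b3 := hN t ht
        rw [Real.norm_eq_abs] at b3
        -- The mean value theorem in each variable isolates the remainder with coefficient `gp`,
        -- bounded by `K`; what is left is `a - a₀` times oscillations of `ga` and `gp`.
        have e : g t a (p t a) - g t a₀ (p t a₀)
              - (a - a₀) * (ga t a₀ (p t a₀) + gp t a₀ (p t a₀) * P t a₀)
            = gp t a ξ * (p t a - p t a₀ - (a - a₀) * P t a₀)
              + ((gp t a ξ - gp t a₀ (p t a₀)) * P t a₀
                + (ga t ζ (p t a₀) - ga t a₀ (p t a₀))) * (a - a₀) := by
          linear_combination e1 + e2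
        rw [e]
        refine (abs_add_le _ _).trans ?_
        rw [abs_mul, abs_mul]
        refine add_le_add (mul_le_mul_of_nonneg_right (hb _ _ _) (abs_nonneg _))
          (mul_le_mul_of_nonneg_right ?_ (abs_nonneg _))
        refine (abs_add_le _ _).trans ?_
        rw [abs_mul]
        have := mul_le_mul b2.le b3 (abs_nonneg _) hε0.le
        linarith) t
    rw [intervalIntegral.integral_const] at hbd
    simp only [(h0 _).1, (h0 _).2, (h0' _).1, (h0' _).2, smul_eq_mul] at hbd
    simp only [Real.norm_eq_abs, smul_eq_mul] at hαa hβa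
    refine hbd.trans ?_
    rw [← hεc]
    have hA := abs_nonneg (a - a₀)
    have : 0 ≤ ε * |a - a₀| := by positivity
    have : 0 ≤ ε * |a - a₀| * N := by positivity
    have : 0 ≤ ε * |a - a₀| * T := by positivity
    have : 0 ≤ ε * |a - a₀| * T * N := by positivity
    nlinarith
  intro t a₀
  constructor
  · rw [hasDerivAt_iff_isLittleO, Asymptotics.isLittleO_iff]
    intro c hc
    filter_upwards [key a₀ c hc] with a ha
    simp only [Real.norm_eq_abs, smul_eq_mul]
    linarith [ha t, abs_nonneg (q t a - q t a₀ - (a - a₀) * Q t a₀)]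
  · rw [hasDerivAt_iff_isLittleO, Asymptotics.isLittleO_iff]
    intro c hc
    filter_upwards [key a₀ c hc] with a ha
    simp only [Real.norm_eq_abs, smul_eq_mul]
    linarith [ha t, abs_nonneg (p t a - p t a₀ - (a - a₀) * P t a₀)]

theorem SolvesOscillator.eq_of_lipschitz {ν T K : ℝ} {p q g p' q' g' : ℝ → ℝ} (hT : 0 < T)
    (hK : 0 ≤ K) (hTK : T * (1 + |ν| + K) ≤ 1 / 4) (h : SolvesOscillator ν T p q g)
    (h' : SolvesOscillator ν T p' q' g') (hp : p 0 = p' 0) (hq : q 0 = q' 0)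
    (hg : ∀ t, |g t - g' t| ≤ K * |p t - p' t|) : p = p' ∧ q = q' := by
  have hb := (h.sub h').bound hT hK hTK (r := fun _ => 0) continuous_const
    (fun t _ => by simpa using hg t)
  simp only [hp, hq, sub_self, abs_zero, intervalIntegral.integral_zero, add_zero, mul_zero] at hb
  constructor
  · ext t
    have := hb t
    exact sub_eq_zero.1 (abs_nonpos_iff.1 (by linarith [abs_nonneg (q t - q' t)]))
  · ext t
    have := hb t
    exact sub_eq_zero.1 (abs_nonpos_iff.1 (by linarith [abs_nonneg (p t - p' t)]))

theorem solvesOscillator_const (ν T a : ℝ) :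
    SolvesOscillator ν T (fun _ => a) (fun _ => 0) (fun _ => 0) where
  cont_p := continuous_const
  cont_q := continuous_const
  cont_g := continuous_const
  clamp_p _ := rfl
  clamp_q _ := rfl
  eq_p t _ := by simp
  eq_q t _ := by simp

/-- Subtracting the constant solution bounds the displacement rather than the position; positions
start at arbitrary labels in `ℝ` and have no uniform bound. -/
theorem SolvesOscillator.bound_sub_const {ν T K : ℝ} {p q g : ℝ → ℝ}
    (h : SolvesOscillator ν T p q g) (hT : 0 < T) (hK : 0 ≤ K)
    (hTK : T * (1 + |ν| + K) ≤ 1 / 4) {r : ℝ → ℝ} (hr : Continuous r) (hg : ∀ t ∈ Icc (-T) T,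
      |g t| ≤ K * |p t - p 0| + r t) (t : ℝ) :
    |p t - p 0| + |q t| ≤ 2 * (|q 0| + ∫ s in (-T)..T, r s) := by
  have := (h.sub (solvesOscillator_const ν T (p 0))).bound hT hK hTK hr
    (fun t ht => by simpa using hg t ht) t
  simpa using this

/-! ### The Lagrangian flow and its label derivatives -/

/-- The data of the Lagrangian system `X' = U`, `U' = -ν U - k (Γ(t, X) - m)`, with `∂ₓΓ = c` and
`m' = ρ₀`, on a short time interval. -/
structure FlowData (k ν K N L T : ℝ) (Γ cb cx : ℝ → ℝ → ℝ) (m ρ₀ ρ₀' u₀ u₀' u₀'' : ℝ → ℝ) :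
    Prop where
  abs_k_le : |k| ≤ 1
  T_pos : 0 < T
  T_le_one : T ≤ 1
  K_nonneg : 0 ≤ K
  small : T * (1 + |ν| + K) ≤ 1 / 4
  small' : T * (2 * (3 * N + 2 * K)) ≤ 1 / 2
  cont_Γ : Continuous (Function.uncurry Γ)
  cont_cb : Continuous (Function.uncurry cb)
  cont_cx : Continuous (Function.uncurry cx)
  deriv_Γ : ∀ t x, HasDerivAt (Γ t) (cb t x) x
  deriv_cb : ∀ t x, HasDerivAt (cb t) (cx t x) x
  deriv_m : ∀ x, HasDerivAt m (ρ₀ x) x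
  deriv_ρ₀ : ∀ x, HasDerivAt ρ₀ (ρ₀' x) x
  deriv_u₀ : ∀ x, HasDerivAt u₀ (u₀' x) x
  deriv_u₀' : ∀ x, HasDerivAt u₀' (u₀'' x) x
  cont_ρ₀' : Continuous ρ₀'
  cont_u₀'' : Continuous u₀''
  cb_le : ∀ t x, |cb t x| ≤ K
  cx_le : ∀ t x, |cx t x| ≤ L
  ρ₀_le : ∀ x, |ρ₀ x| ≤ N
  ρ₀'_le : ∀ x, |ρ₀' x| ≤ N
  u₀_le : ∀ x, |u₀ x| ≤ N
  u₀'_le : ∀ x, |u₀' x| ≤ N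
  u₀''_le : ∀ x, |u₀'' x| ≤ N
  field_le : ∀ t ∈ Icc (-T) T, ∀ x, |Γ t x - m x| ≤ N

/-- The particle flow `X`, the velocity `U`, and their label derivatives `Y = ∂ₐX`, `V = ∂ₐU`,
`Z = ∂ₐY`. -/
structure ParticleFlow (k ν T : ℝ) (Γ cb : ℝ → ℝ → ℝ) (m ρ₀ u₀ u₀' : ℝ → ℝ) (N : ℝ)
    (X U Y V Z : ℝ → ℝ → ℝ) : Prop where
  cont_X : Continuous (Function.uncurry X)
  cont_U : Continuous (Function.uncurry U)
  cont_Y : Continuous (Function.uncurry Y)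
  cont_V : Continuous (Function.uncurry V)
  cont_Z : Continuous (Function.uncurry Z)
  X_zero : ∀ a, X 0 a = a
  U_zero : ∀ a, U 0 a = u₀ a
  Y_zero : ∀ a, Y 0 a = 1
  V_zero : ∀ a, V 0 a = u₀' a
  solves : ∀ a, SolvesOscillator ν T (fun t => X t a) (fun t => U t a)
    (fun t => -k * (Γ t (X t a) - m a))
  solves_deriv : ∀ a, SolvesOscillator ν T (fun t => Y t a) (fun t => V t a)
    (fun t => -k * (cb t (X t a) * Y t a - ρ₀ a))
  deriv_X : ∀ t a, HasDerivAt (X t) (Y t a) a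
  deriv_U : ∀ t a, HasDerivAt (U t) (V t a) a
  deriv_Y : ∀ t a, HasDerivAt (Y t) (Z t a) a
  Y_sub_one_le : ∀ t a, |Y t a - 1| ≤ 1 / 2
  U_le : ∀ t a, |U t a| ≤ N
  V_le : ∀ t a, |V t a| ≤ N
  Z_le : ∀ t a, |Z t a| ≤ N
  field_le : ∀ t ∈ Icc (-T) T, ∀ a, |Γ t (X t a) - m a| ≤ N

theorem abs_sub_le_of_hasDerivAt_le {f f' : ℝ → ℝ} {K : ℝ} (hf : ∀ x, HasDerivAt f (f' x) x)
    (hK : ∀ x, |f' x| ≤ K) (x y : ℝ) : |f x - f y| ≤ K * |x - y| := by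
  obtain ⟨z, -, e⟩ := exists_mvt hf y x
  rw [e, abs_mul]
  exact mul_le_mul_of_nonneg_right (hK z) (abs_nonneg _)

/-- Parameter differentiability is used twice: for `(X, U)`, and then for the linear system of their
label derivatives, which gives the second label derivative `Z`. -/
theorem FlowData.exists_particleFlow {k ν K N L T : ℝ} {Γ cb cx : ℝ → ℝ → ℝ}
    {m ρ₀ ρ₀' u₀ u₀' u₀'' : ℝ → ℝ} (h : FlowData k ν K N L T Γ cb cx m ρ₀ ρ₀' u₀ u₀' u₀'') :
    ∃ (N' : ℝ) (X U Y V Z : ℝ → ℝ → ℝ), ParticleFlow k ν T Γ cb m ρ₀ u₀ u₀' N' X U Y V Z := by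
  have hT := h.T_pos
  have hK := h.K_nonneg
  have hN : 0 ≤ N := (abs_nonneg _).trans (h.u₀_le 0)
  have hL : 0 ≤ L := (abs_nonneg _).trans (h.cx_le 0 0)
  have cm : Continuous m := continuous_iff_continuousAt.2 fun x => (h.deriv_m x).continuousAt
  have cρ : Continuous ρ₀ := continuous_iff_continuousAt.2 fun x => (h.deriv_ρ₀ x).continuousAt
  have cu' : Continuous u₀' := continuous_iff_continuousAt.2 fun x => (h.deriv_u₀' x).continuousAt
  have c2 : ∀ {F : ℝ → ℝ → ℝ}, Continuous (Function.uncurry F) →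
      Continuous fun z : ℝ × ℝ × ℝ => F z.1 z.2.2 := fun hF =>
    hF.comp (continuous_fst.prodMk (continuous_snd.comp continuous_snd))
  have c1 : ∀ {F : ℝ → ℝ → ℝ}, Continuous (Function.uncurry F) →
      Continuous fun z : ℝ × ℝ × ℝ => F z.1 z.2.1 := fun hF =>
    hF.comp (continuous_fst.prodMk (continuous_fst.comp continuous_snd))
  have hkc : ∀ t x, |-k * cb t x| ≤ K := fun t x => by
    rw [abs_mul, abs_neg]
    exact (mul_le_of_le_one_left (abs_nonneg _) h.abs_k_le).trans (h.cb_le t x)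
  have hkle : ∀ x : ℝ, |-k * x| ≤ |x| := fun x => by
    rw [abs_mul, abs_neg]
    exact mul_le_of_le_one_left (abs_nonneg _) h.abs_k_le
  obtain ⟨X, U, Y, V, ⟨cX, cU, cY, cV⟩, h0, hs, hs', hd⟩ := exists_differentiable_family hT hK h.small
    (g := fun t a x => -k * (Γ t x - m a)) (ga := fun _ a _ => k * ρ₀ a)
    (gp := fun t _ x => -k * cb t x) ((c2 h.cont_Γ).sub (by fun_prop) |>.const_mul _)
    (by fun_prop) ((c2 h.cont_cb).const_mul _)
    (fun t a x => by
      have := ((h.deriv_m a).const_sub (Γ t x)).const_mul (-k)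
      rwa [neg_mul_neg] at this)
    (fun t a x => ((h.deriv_Γ t x).sub_const _).const_mul (-k)) (fun t a x => hkc t x)
    (α := id) (β := u₀) (α' := fun _ => 1) (fun a => hasDerivAt_id a) h.deriv_u₀ continuous_const cu'
  have hXa : Continuous fun z : ℝ × ℝ × ℝ => cb z.1 (X z.1 z.2.1) :=
    h.cont_cb.comp (continuous_fst.prodMk (c1 cX))
  have hXx : Continuous fun z : ℝ × ℝ × ℝ => cx z.1 (X z.1 z.2.1) :=
    h.cont_cx.comp (continuous_fst.prodMk (c1 cX))
  obtain ⟨Y', V', Z, W, ⟨-, -, cZ, cW⟩, h0', hr, hr', hd'⟩ :=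
    exists_differentiable_family hT hK h.small
    (g := fun t a x => k * ρ₀ a + -k * cb t (X t a) * x)
    (ga := fun t a x => k * ρ₀' a + -k * (cx t (X t a) * Y t a) * x)
    (gp := fun t a _ => -k * cb t (X t a))
    ((by fun_prop : Continuous fun z : ℝ × ℝ × ℝ => k * ρ₀ z.2.1).add
      ((hXa.const_mul _).mul (by fun_prop)))
    (((h.cont_ρ₀'.comp (continuous_fst.comp continuous_snd)).const_mul k).add
      (((hXx.mul (c1 cY)).const_mul _).mul (by fun_prop)))
    (hXa.const_mul _)
    (fun t a x => ((h.deriv_ρ₀ a).const_mul k).add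
      ((((h.deriv_cb t (X t a)).comp a (hd t a).1).const_mul (-k)).mul_const x))
    (fun t a x => by
      have := ((hasDerivAt_id x).const_mul (-k * cb t (X t a))).const_add (k * ρ₀ a)
      rwa [mul_one] at this)
    (fun t a x => hkc t _) (α := fun _ => 1) (β := u₀') (α' := fun _ => 0)
    (fun a => hasDerivAt_const a _) h.deriv_u₀' continuous_const h.cont_u₀''
  -- The second application builds its own solution of the linear system; uniqueness identifies it
  -- with the label derivatives already found.
  have huniq : ∀ a, ((fun t => Y' t a) = fun t => Y t a) ∧ ((fun t => V' t a) = fun t => V t a) := by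
    intro a
    refine (hr a).eq_of_lipschitz hT hK h.small (hs' a) ((h0' a).1.trans (h0 a).2.2.1.symm)
      ((h0' a).2.1.trans (h0 a).2.2.2.symm) fun t => ?_
    rw [add_sub_add_left_eq_sub, ← mul_sub, abs_mul]
    exact mul_le_mul_of_nonneg_right (hkc _ _) (abs_nonneg _)
  have eY : Y' = Y := by ext t a; exact congrFun (huniq a).1 t
  subst eY
  have hsY : ∀ a, SolvesOscillator ν T (fun t => Y' t a) (fun t => V t a)
      (fun t => -k * (cb t (X t a) * Y' t a - ρ₀ a)) := by
    intro a
    have e : (fun t => -k * (cb t (X t a) * Y' t a - ρ₀ a)) =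
        fun t => k * ρ₀ a + -k * cb t (X t a) * Y' t a := by ext t; ring
    rw [e]; exact hs' a
  have hconst : ∀ b : ℝ, ∫ _ in (-T)..T, b = 2 * T * b := fun b => by
    rw [intervalIntegral.integral_const, smul_eq_mul]; ring
  -- The force is at most its value at the unmoved point, `N`, plus `K|X - a|`; hence `2(N + 2TN) ≤
  -- 6N` for `T ≤ 1`.
  have hXU : ∀ t a, |X t a - a| + |U t a| ≤ 6 * N := by
    intro t a
    have := (hs a).bound_sub_const hT hK h.small (r := fun _ => N) continuous_const
      (fun t ht => by
        refine (hkle _).trans ?_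
        have e1 := abs_sub_le_of_hasDerivAt_le (h.deriv_Γ t) (h.cb_le t) (X t a) a
        have e2 := h.field_le t ht a
        have e3 := abs_sub_le (Γ t (X t a)) (Γ t a) (m a)
        have e0 : X 0 a = a := (h0 a).1
        rw [e0]; linarith) t
    simp only [(h0 a).1, (h0 a).2.1, hconst, id] at this
    have := h.u₀_le a
    nlinarith [h.T_le_one]
  have hYV : ∀ t a, |Y' t a - 1| + |V t a| ≤ 2 * (3 * N + 2 * K) := by
    intro t a
    have := (hsY a).bound_sub_const hT hK h.small (r := fun _ => K + N) continuous_const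
      (fun t ht => by
        refine (hkle _).trans ?_
        rw [(h0' a).1]
        have e : cb t (X t a) * Y' t a - ρ₀ a =
          cb t (X t a) * (Y' t a - 1) + (cb t (X t a) - ρ₀ a) := by ring
        rw [e]
        have e1 := abs_add_le (cb t (X t a) * (Y' t a - 1)) (cb t (X t a) - ρ₀ a)
        rw [abs_mul] at e1
        have e2 := mul_le_mul_of_nonneg_right (h.cb_le t (X t a)) (abs_nonneg (Y' t a - 1))
        have e3 := abs_sub (cb t (X t a)) (ρ₀ a)
        have e4 := h.cb_le t (X t a)
        have e5 := h.ρ₀_le a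
        linarith) t
    simp only [(h0' a).1, (h0 a).2.2.2, hconst] at this
    have := h.u₀'_le a
    nlinarith [h.T_le_one]
  -- `Y - 1` is the time integral of `V`, bounded by `2(3N + 2K)`; the condition `small'` is made
  -- for this and prevents particle crossing.
  have hY1 : ∀ t a, |Y' t a - 1| ≤ 1 / 2 := by
    intro t a
    rw [(hsY a).clamp_p t, (hsY a).eq_p _ (clampTime_mem hT t), (h0' a).1, add_sub_cancel_left]
    have hc := clampTime_mem hT t
    have := intervalIntegral.norm_integral_le_of_norm_le_const (a := 0) (b := clampTime T t)
      (C := 2 * (3 * N + 2 * K)) (f := fun s => V s a) fun s _ => by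
        rw [Real.norm_eq_abs]; linarith [hYV s a, abs_nonneg (Y' s a - 1)]
    rw [Real.norm_eq_abs, sub_zero] at this
    have h1 : |clampTime T t| ≤ T := abs_le.2 hc
    have h2 : 0 ≤ 2 * (3 * N + 2 * K) := by positivity
    nlinarith [h.small', mul_le_mul_of_nonneg_left h1 h2]
  have hY2 : ∀ t a, |Y' t a| ≤ 3 / 2 := fun t a => by
    have := hY1 t a
    rw [abs_le] at this ⊢
    constructor <;> linarith
  -- The source of the second-derivative equation is `kρ₀' - k cx Y²`, and `|Y| ≤ 3/2` explains the
  -- `9/4`.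
  have hZ : ∀ t a, |Z t a| ≤ 2 * (N + 2 * (N + 9 / 4 * L)) := by
    intro t a
    have := (hr' a).bound hT hK h.small (r := fun _ => N + 9 / 4 * L) continuous_const
      (fun t ht => by
        have e1 : |k * ρ₀' a| ≤ N := by
          rw [abs_mul]
          exact (mul_le_of_le_one_left (abs_nonneg _) h.abs_k_le).trans (h.ρ₀'_le a)
        have e2 : |-k * (cx t (X t a) * Y' t a) * Y' t a| ≤ 9 / 4 * L := by
          rw [mul_assoc]
          refine (hkle _).trans ?_
          rw [abs_mul, abs_mul]
          have a1 := h.cx_le t (X t a)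
          have a2 := hY2 t a
          have a3 := abs_nonneg (Y' t a)
          have a4 : |cx t (X t a)| * |Y' t a| ≤ L * (3 / 2) := mul_le_mul a1 a2 a3 hL
          have a5 : |cx t (X t a)| * |Y' t a| * |Y' t a| ≤ L * (3 / 2) * (3 / 2) :=
            mul_le_mul a4 a2 a3 (by positivity)
          linarith
        have e3 : |-k * cb t (X t a) * Z t a| ≤ K * |Z t a| := by
          rw [abs_mul]
          exact mul_le_mul_of_nonneg_right (hkc _ _) (abs_nonneg _)
        have e4 := abs_add_le (k * ρ₀' a + -k * (cx t (X t a) * Y' t a) * Y' t a)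
          (-k * cb t (X t a) * Z t a)
        have e5 := abs_add_le (k * ρ₀' a) (-k * (cx t (X t a) * Y' t a) * Y' t a)
        linarith) t
    simp only [(h0' a).2.2.1, (h0' a).2.2.2, hconst, abs_zero] at this
    have h1 := h.u₀''_le a
    have h2 := abs_nonneg (W t a)
    have h3 : 0 ≤ N + 9 / 4 * L := by positivity
    nlinarith [h.T_le_one]
  refine ⟨6 * N + 2 * (3 * N + 2 * K) + 2 * (N + 2 * (N + 9 / 4 * L)) + (K * (6 * N) + N),
    X, U, Y', V, Z, cX, cU, cY, cV, cZ, fun a => (h0 a).1, fun a => (h0 a).2.1,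
    fun a => (h0' a).1, fun a => (h0 a).2.2.2, hs, hsY, fun t a => (hd t a).1,
    fun t a => (hd t a).2, fun t a => (hd' t a).1, hY1, fun t a => ?_, fun t a => ?_,
    fun t a => ?_, fun t ht a => ?_⟩
  · have := hXU t a
    have := abs_nonneg (X t a - a)
    have : 0 ≤ 2 * (3 * N + 2 * K) + 2 * (N + 2 * (N + 9 / 4 * L)) + (K * (6 * N) + N) := by
      positivity
    linarith
  · have := hYV t a
    have := abs_nonneg (Y' t a - 1)
    have : 0 ≤ 6 * N + 2 * (N + 2 * (N + 9 / 4 * L)) + (K * (6 * N) + N) := by positivity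
    linarith
  · have := hZ t a
    have : 0 ≤ 6 * N + 2 * (3 * N + 2 * K) + (K * (6 * N) + N) := by positivity
    linarith
  · have e1 := abs_sub_le_of_hasDerivAt_le (h.deriv_Γ t) (h.cb_le t) (X t a) a
    have e2 := h.field_le t ht a
    have e3 := abs_sub_le (Γ t (X t a)) (Γ t a) (m a)
    have e4 : K * |X t a - a| ≤ K * (6 * N) :=
      mul_le_mul_of_nonneg_left (by linarith [hXU t a, abs_nonneg (U t a)]) hK
    have : 0 ≤ 6 * N + 2 * (3 * N + 2 * K) + 2 * (N + 2 * (N + 9 / 4 * L)) := by positivity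
    linarith

/-! ### Inversion of the flow and change of variables -/

theorem hasFDerivAt_uncurry_of_partials {Q Qt Qa : ℝ → ℝ → ℝ} {T : ℝ}
    (hQt : ∀ t ∈ Ioo (-T) T, ∀ a, HasDerivAt (fun t => Q t a) (Qt t a) t)
    (hQa : ∀ t a, HasDerivAt (Q t) (Qa t a) a) (cQt : Continuous (Function.uncurry Qt))
    (cQa : Continuous (Function.uncurry Qa)) {t : ℝ} (ht : t ∈ Ioo (-T) T) (a : ℝ) :
    HasFDerivAt (Function.uncurry Q) ((ContinuousLinearMap.toSpanSingleton ℝ (Qt t a)).coprod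
      (ContinuousLinearMap.toSpanSingleton ℝ (Qa t a))) (t, a) := by
  have hn : ∀ᶠ v : ℝ × ℝ in 𝓝 (t, a), v.1 ∈ Ioo (-T) T :=
    continuousAt_fst.eventually (isOpen_Ioo.mem_nhds ht)
  have := hasStrictFDerivAt_uncurry_coprod (u := (t, a)) (f := Q)
    (f₁ := fun t a => ContinuousLinearMap.toSpanSingleton ℝ (Qt t a))
    (f₂ := fun t a => ContinuousLinearMap.toSpanSingleton ℝ (Qa t a))
    (hn.mono fun v hv => (hQt v.1 hv v.2).hasFDerivAt)
    (Eventually.of_forall fun v => (hQa v.1 v.2).hasFDerivAt)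
    ((ContinuousLinearMap.toSpanSingletonCLE (𝕜 := ℝ) (E := ℝ)).continuous.comp cQt).continuousAt
    ((ContinuousLinearMap.toSpanSingletonCLE (𝕜 := ℝ) (E := ℝ)).continuous.comp cQa).continuousAt
  exact this.hasFDerivAt

/-- Expansion estimate for a flow with `∂ₐX ≥ 1/2`. -/
theorem abs_sub_le_two_mul_of_half_le {f f' : ℝ → ℝ} (hf : ∀ x, HasDerivAt f (f' x) x)
    (h : ∀ x, 1 / 2 ≤ f' x) (x y : ℝ) : |x - y| ≤ 2 * |f x - f y| := by
  obtain ⟨z, -, e⟩ := exists_mvt hf y x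
  rw [e, abs_mul]
  have := h z
  have h2 : 1 / 2 ≤ |f' z| := this.trans (le_abs_self _)
  nlinarith [abs_nonneg (x - y)]

theorem bijective_of_half_le {f f' : ℝ → ℝ} (hf : ∀ x, HasDerivAt f (f' x) x)
    (h : ∀ x, 1 / 2 ≤ f' x) : Function.Bijective f := by
  have hc : Continuous f := continuous_iff_continuousAt.2 fun x => (hf x).continuousAt
  refine ⟨fun x y hxy => ?_, hc.surjective ?_ ?_⟩
  · have := abs_sub_le_two_mul_of_half_le hf h x y
    rw [hxy, sub_self, abs_zero, mul_zero] at this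
    exact sub_eq_zero.1 (abs_nonpos_iff.1 this)
  · have hl : Tendsto (fun x : ℝ => f 0 + x / 2) atTop atTop :=
      tendsto_atTop_add_const_left _ _ (tendsto_id.atTop_div_const (by norm_num))
    refine tendsto_atTop_mono' _ ?_ hl
    filter_upwards [eventually_ge_atTop 0] with x hx
    obtain ⟨z, -, e⟩ := exists_mvt hf 0 x
    nlinarith [h z]
  · have hl : Tendsto (fun x : ℝ => f 0 + x / 2) atBot atBot :=
      tendsto_atBot_add_const_left _ _ (tendsto_id.atBot_div_const (by norm_num))
    refine tendsto_atBot_mono' _ ?_ hl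
    filter_upwards [eventually_le_atBot 0] with x hx
    obtain ⟨z, -, e⟩ := exists_mvt hf 0 x
    nlinarith [h z]

/-- Inversion of a flow in the space variable: the back-to-labels map and the chain rule. -/
theorem exists_inverse_flow {X U Y : ℝ → ℝ → ℝ} {T : ℝ}
    (cX : Continuous (Function.uncurry X)) (cU : Continuous (Function.uncurry U))
    (cY : Continuous (Function.uncurry Y))
    (hXt : ∀ t ∈ Ioo (-T) T, ∀ a, HasDerivAt (fun t => X t a) (U t a) t)
    (hXa : ∀ t a, HasDerivAt (X t) (Y t a) a) (hY : ∀ t a, 1 / 2 ≤ Y t a) :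
    ∃ A : ℝ → ℝ → ℝ, Continuous (Function.uncurry A) ∧ (∀ t x, X t (A t x) = x) ∧
      (∀ t a, A t (X t a) = a) ∧
      (∀ t, ∀ Q Qa : ℝ → ℝ, (∀ a, HasDerivAt Q (Qa a) a) →
        ∀ x, HasDerivAt (fun x => Q (A t x)) (Qa (A t x) / Y t (A t x)) x) ∧
      ∀ Q Qt Qa : ℝ → ℝ → ℝ, (∀ t ∈ Ioo (-T) T, ∀ a, HasDerivAt (fun t => Q t a) (Qt t a) t) →
        (∀ t a, HasDerivAt (Q t) (Qa t a) a) → Continuous (Function.uncurry Qt) →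
        Continuous (Function.uncurry Qa) → ∀ t ∈ Ioo (-T) T, ∀ x,
          HasDerivAt (fun t => Q t (A t x))
            (Qt t (A t x) - U t (A t x) * (Qa t (A t x) / Y t (A t x))) t := by
  have hbij := fun t => bijective_of_half_le (hXa t) (hY t)
  choose A hA using fun t x => (hbij t).2 x
  have hA' : ∀ t a, A t (X t a) = a := fun t a => (hbij t).1 (hA t (X t a))
  have hexp := fun t => abs_sub_le_two_mul_of_half_le (hXa t) (hY t)
  have hYpos : ∀ t a, 0 < Y t a := fun t a => by linarith [hY t a]
  -- The expansion estimate gives `|A(t,x) - A(t₀,x₀)| ≤ 2 |x - X(t, A(t₀,x₀))|`, which tends to `0`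
  -- by continuity of `X` in time.
  have cA : Continuous (Function.uncurry A) := by
    rw [Metric.continuous_iff]
    rintro ⟨t₀, x₀⟩ ε hε
    have hc : Continuous fun t => X t (A t₀ x₀) := cX.comp (continuous_id.prodMk continuous_const)
    obtain ⟨δ, hδ, h⟩ := Metric.continuous_iff.1 hc t₀ (ε / 4) (by linarith)
    refine ⟨min δ (ε / 4), lt_min hδ (by linarith), ?_⟩
    rintro ⟨t, x⟩ hd
    rw [Prod.dist_eq, max_lt_iff, lt_min_iff, lt_min_iff] at hd
    have a1 := h t hd.1.1
    have a2 : |x - x₀| < ε / 4 := hd.2.2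
    rw [Real.dist_eq] at a1 ⊢
    rw [hA] at a1
    simp only [Function.uncurry_apply_pair]
    have a3 := hexp t (A t x) (A t₀ x₀)
    rw [hA] at a3
    have a4 := abs_sub_le x x₀ (X t (A t₀ x₀))
    rw [abs_sub_comm x₀] at a4
    linarith
  have hAx : ∀ t x, HasDerivAt (A t) (Y t (A t x))⁻¹ x := fun t x =>
    HasDerivAt.of_local_left_inverse
      (cA.comp (continuous_const.prodMk continuous_id) : Continuous (A t)).continuousAt
      (hXa t (A t x)) (hYpos _ _).ne' (Eventually.of_forall fun x => hA t x)
  refine ⟨A, cA, hA, hA', fun t Q Qa hQ x => ?_, fun Q Qt Qa hQt hQa cQt cQa t ht x => ?_⟩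
  · rw [div_eq_mul_inv]
    exact (hQ (A t x)).comp x (hAx t x)
  -- Differentiation of `X(τ, A(τ,x)) = x`. The expansion estimate first yields `A(τ,x) - A(t,x) =
  -- O(τ - t)`, so the Fréchet remainder of `X` is `o(τ - t)` and the linear relation can be solved
  -- for the increment of `A`.
  · have hAt : HasDerivAt (fun t => A t x) (-(U t (A t x) / Y t (A t x))) t := by
      have hF := hasFDerivAt_uncurry_of_partials hXt hXa cU cY ht (A t x)
      have hcA : Tendsto (fun τ => (τ, A τ x)) (𝓝 t) (𝓝 (t, A t x)) :=
        (continuous_id.prodMk (cA.comp (continuous_id.prodMk continuous_const))).tendsto t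
      have ho := (hasFDerivAt_iff_isLittleO.1 hF).comp_tendsto hcA
      have hO : (fun τ => A τ x - A t x) =O[𝓝 t] fun τ => τ - t := by
        have h1 : (fun τ => A τ x - A t x) =O[𝓝 t] fun τ => X τ (A t x) - X t (A t x) := by
          refine Asymptotics.IsBigO.of_bound 2 (Eventually.of_forall fun τ => ?_)
          have := hexp τ (A τ x) (A t x)
          rw [hA, abs_sub_comm x] at this
          rw [hA, Real.norm_eq_abs, Real.norm_eq_abs]
          exact this
        exact h1.trans (hXt t ht (A t x)).isBigO_sub
      have hO2 : (fun τ => (τ, A τ x) - (t, A t x)) =O[𝓝 t] fun τ => τ - t :=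
        (Asymptotics.isBigO_refl _ _).prod_left hO
      have ho2 := (ho.trans_isBigO hO2).const_mul_left (-(Y t (A t x))⁻¹)
      rw [hasDerivAt_iff_isLittleO]
      refine ho2.congr_left fun τ => ?_
      have hne := (hYpos t (A t x)).ne'
      simp only [Function.comp_apply, Function.uncurry_apply_pair, hA, Prod.mk_sub_mk,
        ContinuousLinearMap.coprod_apply, ContinuousLinearMap.toSpanSingleton_apply, smul_eq_mul]
      field_simp
      ring
    have hF := hasFDerivAt_uncurry_of_partials hQt hQa cQt cQa ht (A t x)
    have := hF.comp_hasDerivAt t ((hasDerivAt_id t).prodMk hAt)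
    convert! this using 1
    simp only [ContinuousLinearMap.coprod_apply, ContinuousLinearMap.toSpanSingleton_apply,
      smul_eq_mul]
    ring

theorem lintegral_eq_lintegral_comp_flow {f f' : ℝ → ℝ} (hf : ∀ x, HasDerivAt f (f' x) x)
    (h : ∀ x, 1 / 2 ≤ f' x) (g : ℝ → ℝ≥0∞) :
    ∫⁻ x, g x = ∫⁻ a, ENNReal.ofReal (f' a) * g (f a) := by
  have hb := bijective_of_half_le hf h
  have := lintegral_image_eq_lintegral_abs_deriv_mul MeasurableSet.univ
    (fun x _ => (hf x).hasDerivWithinAt) hb.1.injOn g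
  rw [image_univ, hb.2.range_eq, Measure.restrict_univ] at this
  rw [this]
  refine lintegral_congr fun a => ?_
  rw [abs_of_nonneg (by linarith [h a])]

theorem lintegral_comp_flow_le {f f' : ℝ → ℝ} (hf : ∀ x, HasDerivAt f (f' x) x)
    (h : ∀ x, 1 / 2 ≤ f' x) (g : ℝ → ℝ≥0∞) : ∫⁻ a, g (f a) ≤ 2 * ∫⁻ x, g x := by
  rw [lintegral_eq_lintegral_comp_flow hf h g, ← lintegral_const_mul' _ _ (by simp)]
  refine lintegral_mono fun a => ?_
  rw [← mul_assoc]
  refine le_mul_of_one_le_left' ?_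
  have : (1 : ℝ≥0∞) = ENNReal.ofReal (2 * (1 / 2)) := by norm_num
  rw [this, ENNReal.ofReal_mul (by norm_num), ENNReal.ofReal_ofNat]
  gcongr
  exact h a

/-! ### `L²` and `L¹` bounds along the flow -/

theorem memLp_two_of_lintegral_sq_lt_top {f : ℝ → ℝ} (hf : AEStronglyMeasurable f volume)
    (h : ∫⁻ x, ‖f x‖ₑ ^ 2 < ⊤) : MemLp f 2 volume := by
  refine ⟨hf, ?_⟩
  rw [← eLpNorm_two_sq] at h
  exact (ENNReal.pow_lt_top_iff.1 h).resolve_right two_ne_zero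

theorem lintegral_sq_lt_top_of_memLp {f : ℝ → ℝ} (h : MemLp f 2 volume) :
    ∫⁻ x, ‖f x‖ₑ ^ 2 < ⊤ := by
  rw [← eLpNorm_two_sq]; exact ENNReal.pow_lt_top h.2

theorem enorm_intervalIntegral_abs_le {f : ℝ → ℝ} {T : ℝ} (hT : 0 < T) :
    ‖∫ τ in (-T)..T, |f τ|‖ₑ ≤ ∫⁻ τ in Ioc (-T) T, ‖f τ‖ₑ := by
  rw [intervalIntegral.integral_of_le (by linarith)]
  refine (enorm_integral_le_lintegral_enorm _).trans_eq ?_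
  simp

/-- Cauchy–Schwarz in time and Tonelli. The outcome is a majorant independent of time, as needed
when estimating each label separately. -/
theorem memLp_two_time_integral {F : ℝ → ℝ → ℝ} (hF : Continuous (Function.uncurry F)) {T : ℝ}
    (hT : 0 < T) {M : ℝ≥0∞} (hM : M ≠ ⊤)
    (hle : ∀ t ∈ Icc (-T) T, ∫⁻ a, ‖F t a‖ₑ ^ 2 ≤ M) :
    MemLp (fun a => ∫ τ in (-T)..T, |F τ a|) 2 volume := by
  have hc : Continuous fun a => ∫ τ in (-T)..T, |F τ a| :=
    intervalIntegral.continuous_parametric_intervalIntegral_of_continuous'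
      (f := fun a τ => |F τ a|) (hF.comp continuous_swap).abs _ _
  refine memLp_two_of_lintegral_sq_lt_top hc.aestronglyMeasurable ?_
  calc ∫⁻ a, ‖∫ τ in (-T)..T, |F τ a|‖ₑ ^ 2
      ≤ ∫⁻ a, ENNReal.ofReal (2 * T) * ∫⁻ τ in Ioc (-T) T, ‖F τ a‖ₑ ^ 2 := by
        refine lintegral_mono fun a => ?_
        refine (pow_le_pow_left' (enorm_intervalIntegral_abs_le hT) 2).trans ?_
        have := lintegral_sq_le_measure_mul (μ := volume.restrict (Ioc (-T) T))
          (f := fun τ => ‖F τ a‖ₑ)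
          (hF.comp (continuous_id.prodMk continuous_const)).enorm.measurable.aemeasurable
        refine this.trans_eq ?_
        rw [Measure.restrict_apply_univ, Real.volume_Ioc]
        ring_nf
    _ = ENNReal.ofReal (2 * T) * ∫⁻ a, ∫⁻ τ in Ioc (-T) T, ‖F τ a‖ₑ ^ 2 :=
        lintegral_const_mul' _ _ ENNReal.ofReal_ne_top
    _ = ENNReal.ofReal (2 * T) * ∫⁻ τ in Ioc (-T) T, ∫⁻ a, ‖F τ a‖ₑ ^ 2 := by
        rw [lintegral_lintegral_swap]
        exact ((hF.comp continuous_swap).enorm.measurable.pow_const 2).aemeasurable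
    _ ≤ ENNReal.ofReal (2 * T) * ∫⁻ τ in Ioc (-T) T, M := by
        refine mul_le_mul' le_rfl (setLIntegral_mono' measurableSet_Ioc fun τ hτ => ?_)
        exact hle τ (Ioc_subset_Icc_self hτ)
    _ < ⊤ := by
        rw [setLIntegral_const, Real.volume_Ioc]
        exact ENNReal.mul_lt_top ENNReal.ofReal_lt_top
          (ENNReal.mul_lt_top hM.lt_top ENNReal.ofReal_lt_top)

theorem lintegral_time_integral_le {F : ℝ → ℝ → ℝ} (hF : Continuous (Function.uncurry F)) {T : ℝ}
    (hT : 0 < T) {M : ℝ≥0∞} (hle : ∀ t ∈ Icc (-T) T, ∫⁻ a, ‖F t a‖ₑ ≤ M) :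
    ∫⁻ a, ‖∫ τ in (-T)..T, |F τ a|‖ₑ ≤ M * ENNReal.ofReal (2 * T) := by
  calc _ ≤ ∫⁻ a, ∫⁻ τ in Ioc (-T) T, ‖F τ a‖ₑ :=
        lintegral_mono fun a => enorm_intervalIntegral_abs_le hT
    _ = ∫⁻ τ in Ioc (-T) T, ∫⁻ a, ‖F τ a‖ₑ := by
        rw [lintegral_lintegral_swap]
        exact (hF.comp continuous_swap).enorm.measurable.aemeasurable
    _ ≤ ∫⁻ τ in Ioc (-T) T, M :=
        setLIntegral_mono' measurableSet_Ioc fun τ hτ => hle τ (Ioc_subset_Icc_self hτ)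
    _ = _ := by
        rw [setLIntegral_const, Real.volume_Ioc]
        ring_nf

namespace ParticleFlow

variable {k ν T N K : ℝ} {Γ cb B : ℝ → ℝ → ℝ} {C₀ e₀ m ρ₀ u₀ u₀' : ℝ → ℝ} {X U Y V Z : ℝ → ℝ → ℝ}

theorem half_le (h : ParticleFlow k ν T Γ cb m ρ₀ u₀ u₀' N X U Y V Z) (t a : ℝ) :
    1 / 2 ≤ Y t a := by
  have := (abs_le.1 (h.Y_sub_one_le t a)).1; linarith

theorem le_two (h : ParticleFlow k ν T Γ cb m ρ₀ u₀ u₀' N X U Y V Z) (t a : ℝ) :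
    Y t a ≤ 2 := by
  have := (abs_le.1 (h.Y_sub_one_le t a)).2; linarith

theorem continuous_comp (h : ParticleFlow k ν T Γ cb m ρ₀ u₀ u₀' N X U Y V Z)
    {F : ℝ → ℝ → ℝ} (hF : Continuous (Function.uncurry F)) :
    Continuous (Function.uncurry fun t a => F t (X t a)) :=
  hF.comp (continuous_fst.prodMk h.cont_X)

/-- Square-integrable bounds for displacement, velocity and field along the flow. -/
theorem exists_memLp_two_bound (h : ParticleFlow k ν T Γ cb m ρ₀ u₀ u₀' N X U Y V Z)
    (hT : 0 < T) (hK : 0 ≤ K) (hk : |k| ≤ 1) (hTK : T * (1 + |ν| + K) ≤ 1 / 4)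
    (hΓ : ∀ t x, Γ t x = C₀ x + B t x) (hm : ∀ a, m a = C₀ a - e₀ a)
    (hC : ∀ x y, |C₀ x - C₀ y| ≤ K * |x - y|) (cB : Continuous (Function.uncurry B))
    {M : ℝ≥0∞} (hM : M ≠ ⊤) (hB : ∀ t ∈ Icc (-T) T, ∫⁻ x, ‖B t x‖ₑ ^ 2 ≤ M)
    (hu : MemLp u₀ 2 volume) (he : MemLp e₀ 2 volume) :
    (∃ S : ℝ → ℝ, MemLp S 2 volume ∧ ∀ t a, |U t a| ≤ S a) ∧
      ∀ t ∈ Icc (-T) T, MemLp (fun a => Γ t (X t a) - m a) 2 volume := by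
  have cBX := h.continuous_comp cB
  have hBX : ∀ t ∈ Icc (-T) T, ∫⁻ a, ‖B t (X t a)‖ₑ ^ 2 ≤ 2 * M := fun t ht =>
    (lintegral_comp_flow_le (h.deriv_X t) (h.half_le t) fun x => ‖B t x‖ₑ ^ 2).trans
      (mul_le_mul' le_rfl (hB t ht))
  have h2M : 2 * M ≠ ⊤ := ENNReal.mul_ne_top (by simp) hM
  set J : ℝ → ℝ := fun a => ∫ τ in (-T)..T, |B τ (X τ a)| with hJ
  have hJLp : MemLp J 2 volume := memLp_two_time_integral cBX hT h2M hBX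
  set S : ℝ → ℝ := fun a => 2 * (|u₀ a| + (2 * T * |e₀ a| + J a)) with hS
  have hSLp : MemLp S 2 volume :=
    (hu.abs.add ((he.abs.const_mul (2 * T)).add hJLp)).const_mul 2
  -- The first part is Lipschitz in the displacement and is absorbed by the oscillator bound; the
  -- other two are square integrable in `a`.
  have hfield : ∀ t a, |Γ t (X t a) - m a| ≤ K * |X t a - a| + (|B t (X t a)| + |e₀ a|) := by
    intro t a
    rw [hΓ, hm]
    have e : C₀ (X t a) + B t (X t a) - (C₀ a - e₀ a) =
      (C₀ (X t a) - C₀ a) + (B t (X t a) + e₀ a) := by ring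
    rw [e]
    have e1 := abs_add_le (C₀ (X t a) - C₀ a) (B t (X t a) + e₀ a)
    have e2 := abs_add_le (B t (X t a)) (e₀ a)
    linarith [hC (X t a) a]
  have hbound : ∀ t a, |X t a - a| + |U t a| ≤ S a := by
    intro t a
    have cBa : Continuous fun t => B t (X t a) := cBX.comp (continuous_id.prodMk continuous_const)
    have := (h.solves a).bound_sub_const hT hK hTK (r := fun t => |B t (X t a)| + |e₀ a|)
      (cBa.abs.add continuous_const) (fun t _ => by
        rw [abs_mul, abs_neg, h.X_zero]
        exact (mul_le_of_le_one_left (abs_nonneg _) hk).trans (hfield t a)) t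
    simp only [h.X_zero, h.U_zero] at this
    rw [intervalIntegral.integral_add (cBa.abs.intervalIntegrable _ _) intervalIntegrable_const,
      intervalIntegral.integral_const, smul_eq_mul] at this
    simp only [hS, hJ]
    linarith
  refine ⟨⟨S, hSLp, fun t a => by linarith [hbound t a, abs_nonneg (X t a - a)]⟩, fun t ht => ?_⟩
  have cBt : Continuous fun a => B t (X t a) := cBX.comp (continuous_const.prodMk continuous_id)
  have hBt : MemLp (fun a => B t (X t a)) 2 volume :=
    memLp_two_of_lintegral_sq_lt_top cBt.aestronglyMeasurable ((hBX t ht).trans_lt h2M.lt_top)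
  have hmaj : MemLp (fun a => K * S a + (|B t (X t a)| + |e₀ a|)) 2 volume :=
    (hSLp.const_mul K).add (hBt.abs.add he.abs)
  have hme : AEStronglyMeasurable (fun a => Γ t (X t a) - m a) volume := by
    have hbX : AEStronglyMeasurable (fun a => C₀ (X t a) - C₀ a) volume := by
      have hCc : Continuous C₀ := by
        refine (LipschitzWith.of_dist_le_mul (K := ⟨K, hK⟩) fun x y => ?_).continuous
        rw [Real.dist_eq, Real.dist_eq]; exact hC x y
      have hXc : Continuous (X t) := h.cont_X.comp (continuous_const.prodMk continuous_id)
      exact ((hCc.comp hXc).sub hCc).aestronglyMeasurable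
    have e : (fun a => Γ t (X t a) - m a) =
        fun a => (C₀ (X t a) - C₀ a) + (B t (X t a) + e₀ a) := by
      ext a; rw [hΓ, hm]; ring
    rw [e]
    exact hbX.add (cBt.aestronglyMeasurable.add he.1)
  refine hmaj.mono hme (Eventually.of_forall fun a => ?_)
  rw [Real.norm_eq_abs]
  refine (hfield t a).trans (le_trans ?_ (le_abs_self _))
  have := mul_le_mul_of_nonneg_left
    (by linarith [hbound t a, abs_nonneg (U t a)] : |X t a - a| ≤ S a) hK
  linarith

/-- Integrable bounds for the density perturbation and the velocity gradient along the flow. -/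
theorem exists_lintegral_bound (h : ParticleFlow k ν T Γ cb m ρ₀ u₀ u₀' N X U Y V Z)
    (hT : 0 < T) (hK : 0 ≤ K) (hk : |k| ≤ 1) (hTK : T * (1 + |ν| + K) ≤ 1 / 4)
    (ccb : Continuous (Function.uncurry cb)) (hcb : ∀ t x, |cb t x| ≤ K)
    {c₀ c₀' : ℝ → ℝ} (hc₀ : ∀ x, HasDerivAt c₀ (c₀' x) x) (cc₀' : Continuous c₀')
    (hc₀' : MemLp c₀' 2 volume)
    {S : ℝ → ℝ} (hS : MemLp S 2 volume) (hUS : ∀ t a, |U t a| ≤ S a)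
    {M : ℝ≥0∞} (hM : M ≠ ⊤) (hcM : ∀ t ∈ Icc (-T) T, ∫⁻ x, ‖cb t x - c₀ x‖ₑ ≤ M)
    (hρ : Integrable fun x => ρ₀ x - c₀ x) (cρ : Continuous ρ₀) (hu : Integrable u₀') :
    ∃ C : ℝ≥0∞, C < ⊤ ∧ ∀ t ∈ Icc (-T) T,
      ∫⁻ a, ‖ρ₀ a - cb t (X t a) * Y t a‖ₑ ≤ C ∧ ∫⁻ a, ‖V t a‖ₑ ≤ C := by
  have cc₀ : Continuous c₀ := continuous_iff_continuousAt.2 fun x => (hc₀ x).continuousAt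
  have cXt : ∀ t, Continuous (X t) := fun t => h.cont_X.comp (continuous_const.prodMk continuous_id)
  have cXa : ∀ a, Continuous fun t => X t a := fun a =>
    h.cont_X.comp (continuous_id.prodMk continuous_const)
  have cUa : ∀ a, Continuous fun t => U t a := fun a =>
    h.cont_U.comp (continuous_id.prodMk continuous_const)
  -- displacement of the initial background
  set G : ℝ → ℝ → ℝ := fun t a => c₀' (X t a) * U t a with hG
  have cG : Continuous (Function.uncurry G) := (cc₀'.comp h.cont_X).mul h.cont_U
  set Q : ℝ≥0∞ := 2 * (∫⁻ x, ‖c₀' x‖ₑ ^ 2) + ∫⁻ a, ‖S a‖ₑ ^ 2 with hQ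
  have hQtop : Q < ⊤ := ENNReal.add_lt_top.2
    ⟨ENNReal.mul_lt_top (by simp) (lintegral_sq_lt_top_of_memLp hc₀'), lintegral_sq_lt_top_of_memLp hS⟩
  have hGQ : ∀ t ∈ Icc (-T) T, ∫⁻ a, ‖G t a‖ₑ ≤ Q := by
    intro t _
    calc ∫⁻ a, ‖G t a‖ₑ ≤ ∫⁻ a, (‖c₀' (X t a)‖ₑ ^ 2 + ‖S a‖ₑ ^ 2) := by
          refine lintegral_mono fun a => ?_
          have e1 : ‖G t a‖ₑ ≤ ‖c₀' (X t a) ^ 2 + S a ^ 2‖ₑ := by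
            refine enorm_le_iff_norm_le.2 ?_
            rw [Real.norm_eq_abs, Real.norm_eq_abs, abs_mul, abs_of_nonneg (by positivity :
              (0 : ℝ) ≤ c₀' (X t a) ^ 2 + S a ^ 2)]
            have b1 := mul_le_mul_of_nonneg_left (hUS t a) (abs_nonneg (c₀' (X t a)))
            rw [← sq_abs (c₀' (X t a))]
            nlinarith [sq_nonneg (|c₀' (X t a)| - S a), sq_nonneg (|c₀' (X t a)|),
              sq_nonneg (S a)]
          refine e1.trans ((enorm_add_le _ _).trans_eq ?_)
          rw [enorm_pow, enorm_pow]
      _ = (∫⁻ a, ‖c₀' (X t a)‖ₑ ^ 2) + ∫⁻ a, ‖S a‖ₑ ^ 2 :=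
          lintegral_add_left ((cc₀'.comp (cXt t)).enorm.measurable.pow_const 2) _
      _ ≤ Q := add_le_add (lintegral_comp_flow_le (h.deriv_X t) (h.half_le t)
          fun x => ‖c₀' x‖ₑ ^ 2) le_rfl
  have hdisp : ∀ t ∈ Icc (-T) T, ∀ a, |c₀ (X t a) - c₀ a| ≤ ∫ τ in (-T)..T, |G τ a| := by
    intro t ht a
    have h0 : (0 : ℝ) ∈ Icc (-T) T := ⟨by linarith, by linarith⟩
    have e : ∫ τ in (0 : ℝ)..t, G τ a = c₀ (X t a) - c₀ (X 0 a) := by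
      refine intervalIntegral.integral_eq_sub_of_hasDeriv_right
        (cc₀.comp (cXa a)).continuousOn (fun τ hτ => ?_)
        ((cG.comp (continuous_id.prodMk continuous_const)).intervalIntegrable _ _)
      have hτ' : τ ∈ Ioo (-T) T :=
        ⟨lt_of_le_of_lt (le_min h0.1 ht.1) hτ.1, lt_of_lt_of_le hτ.2 (max_le h0.2 ht.2)⟩
      exact ((hc₀ (X τ a)).comp τ ((h.solves a).hasDerivAt hτ').1).hasDerivWithinAt
    rw [h.X_zero] at e
    rw [← e]
    exact SolvesOscillator.abs_integral_le_of_le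
      (cG.comp (continuous_id.prodMk continuous_const)).abs (fun τ _ => le_rfl) ht
  -- the source term of the linearised equation
  set R : ℝ → ℝ → ℝ := fun t a => cb t (X t a) - ρ₀ a with hR
  have cR : Continuous (Function.uncurry R) :=
    (h.continuous_comp ccb).sub (cρ.comp continuous_snd)
  set P : ℝ≥0∞ := 2 * M + (Q * ENNReal.ofReal (2 * T) + ∫⁻ a, ‖ρ₀ a - c₀ a‖ₑ) with hP
  have hPtop : P < ⊤ := ENNReal.add_lt_top.2 ⟨ENNReal.mul_lt_top (by simp) hM.lt_top,
    ENNReal.add_lt_top.2 ⟨ENNReal.mul_lt_top hQtop ENNReal.ofReal_lt_top, hρ.2⟩⟩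
  have hRP : ∀ t ∈ Icc (-T) T, ∫⁻ a, ‖R t a‖ₑ ≤ P := by
    intro t ht
    have c1 : Continuous fun a => cb t (X t a) - c₀ (X t a) :=
      ((h.continuous_comp ccb).comp (continuous_const.prodMk continuous_id)).sub (cc₀.comp (cXt t))
    calc ∫⁻ a, ‖R t a‖ₑ ≤ ∫⁻ a, (‖cb t (X t a) - c₀ (X t a)‖ₑ +
          (‖∫ τ in (-T)..T, |G τ a|‖ₑ + ‖ρ₀ a - c₀ a‖ₑ)) := by
          refine lintegral_mono fun a => ?_
          have e : R t a = (cb t (X t a) - c₀ (X t a)) +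
            ((c₀ (X t a) - c₀ a) + -(ρ₀ a - c₀ a)) := by simp only [hR]; ring
          rw [e]
          refine (enorm_add_le _ _).trans (add_le_add le_rfl ((enorm_add_le _ _).trans
            (add_le_add ?_ (enorm_neg _).le)))
          exact enorm_le_iff_norm_le.2 ((hdisp t ht a).trans (le_abs_self _))
      _ = (∫⁻ a, ‖cb t (X t a) - c₀ (X t a)‖ₑ) + ∫⁻ a, (‖∫ τ in (-T)..T, |G τ a|‖ₑ +
          ‖ρ₀ a - c₀ a‖ₑ) := lintegral_add_left c1.enorm.measurable _
      _ = (∫⁻ a, ‖cb t (X t a) - c₀ (X t a)‖ₑ) + ((∫⁻ a, ‖∫ τ in (-T)..T, |G τ a|‖ₑ) +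
          ∫⁻ a, ‖ρ₀ a - c₀ a‖ₑ) := by
          rw [lintegral_add_right (g := fun a => ‖ρ₀ a - c₀ a‖ₑ) _ (cρ.sub cc₀).enorm.measurable]
      _ ≤ P := add_le_add ((lintegral_comp_flow_le (h.deriv_X t) (h.half_le t)
          fun x => ‖cb t x - c₀ x‖ₑ).trans (mul_le_mul' le_rfl (hcM t ht)))
          (add_le_add (lintegral_time_integral_le cG hT hGQ) le_rfl)
  have hbound : ∀ t a, |Y t a - 1| + |V t a| ≤ 2 * (|u₀' a| + ∫ τ in (-T)..T, |R τ a|) := by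
    intro t a
    have cRa : Continuous fun t => R t a := cR.comp (continuous_id.prodMk continuous_const)
    have := (h.solves_deriv a).bound_sub_const hT hK hTK (r := fun t => |R t a|) cRa.abs
      (fun t _ => by
        rw [abs_mul, abs_neg, h.Y_zero]
        refine (mul_le_of_le_one_left (abs_nonneg _) hk).trans ?_
        have e : cb t (X t a) * Y t a - ρ₀ a = cb t (X t a) * (Y t a - 1) + R t a := by
          simp only [hR]; ring
        rw [e]
        refine (abs_add_le _ _).trans (add_le_add ?_ le_rfl)
        rw [abs_mul]
        exact mul_le_mul_of_nonneg_right (hcb _ _) (abs_nonneg _)) t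
    simpa only [h.Y_zero, h.V_zero] using this
  set D : ℝ≥0∞ := 2 * ((∫⁻ a, ‖u₀' a‖ₑ) + P * ENNReal.ofReal (2 * T)) with hD
  have hDtop : D < ⊤ := ENNReal.mul_lt_top (by simp) (ENNReal.add_lt_top.2
    ⟨hu.2, ENNReal.mul_lt_top hPtop ENNReal.ofReal_lt_top⟩)
  have hmaj : ∫⁻ a, ‖2 * (|u₀' a| + ∫ τ in (-T)..T, |R τ a|)‖ₑ ≤ D := by
    calc _ ≤ ∫⁻ a, 2 * (‖u₀' a‖ₑ + ‖∫ τ in (-T)..T, |R τ a|‖ₑ) := by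
          refine lintegral_mono fun a => ?_
          rw [enorm_mul]
          have e2 : ‖(2 : ℝ)‖ₑ = 2 := by
            rw [Real.enorm_eq_ofReal (by norm_num)]; simp
          rw [e2]
          refine mul_le_mul' le_rfl ((enorm_add_le _ _).trans ?_)
          rw [Real.enorm_abs]
      _ = 2 * ∫⁻ a, (‖u₀' a‖ₑ + ‖∫ τ in (-T)..T, |R τ a|‖ₑ) :=
          lintegral_const_mul' _ _ (by simp)
      _ = 2 * ((∫⁻ a, ‖u₀' a‖ₑ) + ∫⁻ a, ‖∫ τ in (-T)..T, |R τ a|‖ₑ) := by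
          rw [lintegral_add_left' hu.1.enorm]
      _ ≤ D := by
          refine mul_le_mul' le_rfl (add_le_add le_rfl ?_)
          exact lintegral_time_integral_le cR hT hRP
  refine ⟨P + ENNReal.ofReal K * D + D, ENNReal.add_lt_top.2 ⟨ENNReal.add_lt_top.2
    ⟨hPtop, ENNReal.mul_lt_top ENNReal.ofReal_lt_top hDtop⟩, hDtop⟩, fun t ht => ⟨?_, ?_⟩⟩
  -- The Lagrangian density perturbation is `-R - cb (Y - 1)`, and `Y - 1` has the same integrable
  -- majorant as `V`.
  · refine le_trans ?_ le_self_add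
    calc ∫⁻ a, ‖ρ₀ a - cb t (X t a) * Y t a‖ₑ
        ≤ ∫⁻ a, (‖R t a‖ₑ + ENNReal.ofReal K * ‖2 * (|u₀' a| + ∫ τ in (-T)..T, |R τ a|)‖ₑ) := by
          refine lintegral_mono fun a => ?_
          have e : ρ₀ a - cb t (X t a) * Y t a = -R t a + -(cb t (X t a) * (Y t a - 1)) := by
            simp only [hR]; ring
          rw [e]
          refine (enorm_add_le _ _).trans (add_le_add (enorm_neg _).le ?_)
          rw [enorm_neg, enorm_mul]
          refine mul_le_mul' ?_ (enorm_le_iff_norm_le.2 ?_)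
          · rw [← ofReal_norm]; exact ENNReal.ofReal_le_ofReal (hcb _ _)
          · rw [Real.norm_eq_abs, Real.norm_eq_abs]
            refine le_trans ?_ (le_abs_self _)
            linarith [hbound t a, abs_nonneg (V t a)]
      _ = (∫⁻ a, ‖R t a‖ₑ) + ∫⁻ a, ENNReal.ofReal K *
          ‖2 * (|u₀' a| + ∫ τ in (-T)..T, |R τ a|)‖ₑ :=
          lintegral_add_left (cR.comp (continuous_const.prodMk continuous_id)).enorm.measurable _
      _ ≤ _ := by
          rw [lintegral_const_mul' _ _ ENNReal.ofReal_ne_top]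
          exact add_le_add (hRP t ht) (mul_le_mul' le_rfl hmaj)
  · refine le_trans ?_ le_add_self
    refine le_trans (lintegral_mono fun a => enorm_le_iff_norm_le.2 ?_) hmaj
    rw [Real.norm_eq_abs, Real.norm_eq_abs]
    exact le_trans (by linarith [hbound t a, abs_nonneg (Y t a - 1)]) (le_abs_self _)

end ParticleFlow

/-! ### Bounded variation and vanishing total charge -/

/-- The cumulative variation `W` is monotone and dominates increments of `u`, so `|u'| ≤ W'` almost
everywhere; the integral of `W'` over an interval is at most the increment of `W`, hence at most the
total variation. -/
theorem integrable_of_hasDerivAt_of_boundedVariationOn {u u' : ℝ → ℝ}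
    (hu : ∀ x, HasDerivAt u (u' x) x) (cu' : Continuous u') (hBV : BoundedVariationOn u univ) :
    Integrable u' := by
  have hloc : LocallyBoundedVariationOn u univ := hBV.locallyBoundedVariationOn
  set W : ℝ → ℝ := variationOnFromTo u univ 0 with hW
  have hsub : ∀ x y, x ≤ y → W y - W x = (eVariationOn u (univ ∩ Icc x y)).toReal := by
    intro x y hxy
    rw [← variationOnFromTo.eq_of_le u univ hxy, hW,
      ← variationOnFromTo.add hloc (mem_univ 0) (mem_univ x) (mem_univ y)]
    ring
  have hfin : ∀ x y, eVariationOn u (univ ∩ Icc x y) ≠ ⊤ := fun x y =>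
    hloc x y (mem_univ _) (mem_univ _)
  have hdist : ∀ x y, x ≤ y → |u y - u x| ≤ W y - W x := by
    intro x y hxy
    rw [hsub x y hxy, ← Real.dist_eq, dist_edist]
    exact ENNReal.toReal_mono (hfin x y) (eVariationOn.edist_le u
      ⟨mem_univ _, right_mem_Icc.2 hxy⟩ ⟨mem_univ _, left_mem_Icc.2 hxy⟩)
  have hmono : Monotone W := fun x y hxy => by
    linarith [hdist x y hxy, abs_nonneg (u y - u x)]
  have hle : ∀ᵐ x, |u' x| ≤ deriv W x := by
    filter_upwards [hmono.ae_differentiableAt] with x hx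
    have hIoi : Ioi x ⊆ {x}ᶜ := fun y hy => ne_of_gt hy
    have h1 := (hasDerivAt_iff_tendsto_slope.1 (hu x)).abs.mono_left
      (nhdsWithin_mono x hIoi)
    have h2 := (hasDerivAt_iff_tendsto_slope.1 hx.hasDerivAt).mono_left
      (nhdsWithin_mono x hIoi)
    refine le_of_tendsto_of_tendsto h1 h2 ?_
    filter_upwards [self_mem_nhdsWithin] with y hy
    have hy' : 0 < y - x := sub_pos.2 hy
    rw [slope_def_field, slope_def_field, abs_div, abs_of_pos hy']
    exact div_le_div_of_nonneg_right (hdist x y (le_of_lt hy)) hy'.le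
  refine integrable_of_intervalIntegral_norm_bounded (l := atTop (α := ℝ)) (a := fun n => -n)
    (b := fun n => n) (eVariationOn u univ).toReal
    (fun n => cu'.continuousOn.integrableOn_Icc.mono_set Ioc_subset_Icc_self)
    tendsto_neg_atTop_atBot tendsto_id ?_
  filter_upwards [eventually_ge_atTop (0 : ℝ)] with n hn
  have hnn : -n ≤ n := by linarith
  have hm : MonotoneOn W (uIcc (-n) n) := hmono.monotoneOn _
  have h3 := hm.intervalIntegral_deriv_mem_uIcc
  rw [uIcc_of_le (sub_nonneg.2 (hmono hnn))] at h3
  calc ∫ x in -n..n, ‖u' x‖ ≤ ∫ x in -n..n, deriv W x :=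
        intervalIntegral.integral_mono_ae hnn (cu'.norm.intervalIntegrable _ _)
          hm.intervalIntegrable_deriv hle
    _ ≤ W n - W (-n) := h3.2
    _ ≤ _ := by
        rw [hsub _ _ hnn]
        exact ENNReal.toReal_mono hBV (eVariationOn.mono u (subset_univ _))

/-- An integrable derivative gives `g` limits at both ends, and square integrability makes both
zero. Applied to the field, this is neutrality. -/
theorem integral_eq_zero_of_hasDerivAt_of_memLp_two {g g' : ℝ → ℝ}
    (hg : ∀ x, HasDerivAt g (g' x) x) (hg' : Integrable g') (h2 : MemLp g 2 volume) :
    ∫ x, g' x = 0 := by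
  have hbot := tendsto_limUnder_of_hasDerivAt_of_integrableOn_Iic (a := 0)
    (fun x _ => hg x) hg'.integrableOn
  have htop := tendsto_limUnder_of_hasDerivAt_of_integrableOn_Ioi (a := 0)
    (fun x _ => hg x) hg'.integrableOn
  have e1 := eq_zero_of_tendsto_atBot_of_memLp_two h2 hbot
  have e2 := eq_zero_of_tendsto_atBot_of_memLp_two
    (h2.comp_measurePreserving (Measure.measurePreserving_neg volume))
    (htop.comp tendsto_neg_atBot_atTop)
  rw [integral_of_hasDerivAt_of_tendsto hg hg' hbot htop, e1, e2, sub_zero]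

/-! ### From the particle flow to the Eulerian solution -/

/-- Functions bounded on the time slab `[-T,T] × ℝ`. -/
def BoundedOnSlab (T : ℝ) (f : ℝ → ℝ → ℝ) : Prop :=
  ∃ B : ℝ, ∀ t ∈ Icc (-T) T, ∀ x, |f t x| ≤ B

namespace BoundedOnSlab

variable {T : ℝ} {f g : ℝ → ℝ → ℝ}

theorem add (hf : BoundedOnSlab T f) (hg : BoundedOnSlab T g) :
    BoundedOnSlab T fun t x => f t x + g t x := by
  obtain ⟨B, hB⟩ := hf
  obtain ⟨C, hC⟩ := hg
  exact ⟨B + C, fun t ht x => (abs_add_le _ _).trans (add_le_add (hB t ht x) (hC t ht x))⟩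

theorem sub (hf : BoundedOnSlab T f) (hg : BoundedOnSlab T g) :
    BoundedOnSlab T fun t x => f t x - g t x := by
  obtain ⟨B, hB⟩ := hf
  obtain ⟨C, hC⟩ := hg
  exact ⟨B + C, fun t ht x => (abs_sub _ _).trans (add_le_add (hB t ht x) (hC t ht x))⟩

theorem mul (hf : BoundedOnSlab T f) (hg : BoundedOnSlab T g) :
    BoundedOnSlab T fun t x => f t x * g t x := by
  obtain ⟨B, hB⟩ := hf
  obtain ⟨C, hC⟩ := hg
  refine ⟨B * C, fun t ht x => ?_⟩
  rw [abs_mul]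
  exact mul_le_mul (hB t ht x) (hC t ht x) (abs_nonneg _) ((abs_nonneg _).trans (hB t ht x))

theorem const (a : ℝ) : BoundedOnSlab T fun _ _ => a := ⟨|a|, fun _ _ _ => le_rfl⟩

theorem div_of_half_le (hf : BoundedOnSlab T f) (hg : ∀ t x, 1 / 2 ≤ g t x) :
    BoundedOnSlab T fun t x => f t x / g t x := by
  obtain ⟨B, hB⟩ := hf
  refine ⟨B * 2, fun t ht x => ?_⟩
  have h1 := hg t x
  rw [abs_div, abs_of_pos (by linarith : 0 < g t x), div_le_iff₀ (by linarith)]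
  nlinarith [hB t ht x, abs_nonneg (f t x)]

theorem comp (hf : BoundedOnSlab T f) (A : ℝ → ℝ → ℝ) : BoundedOnSlab T fun t x => f t (A t x) :=
  hf.imp fun _ hB t ht x => hB t ht (A t x)

end BoundedOnSlab

theorem timeDeriv_eq {T : ℝ} {f ft : ℝ → ℝ → ℝ}
    (hft : ∀ t ∈ Ioo (-T) T, ∀ x, HasDerivAt (fun t => f t x) (ft t x) t) {t : ℝ}
    (ht : t ∈ Ico 0 T) (x : ℝ) : timeDeriv T f t x = ft t x :=
  (hft t ⟨by linarith [ht.1, ht.2], ht.2⟩ x).hasDerivWithinAt.derivWithin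
    (uniqueDiffOn_Ico 0 T t ht)

theorem spaceDeriv_eq {f fx : ℝ → ℝ → ℝ} (hfx : ∀ t x, HasDerivAt (f t) (fx t x) x) :
    spaceDeriv f = fx := by
  ext t x; exact (hfx t x).deriv

theorem isClassC1_of_hasDerivAt {T : ℝ} {f ft fx : ℝ → ℝ → ℝ}
    (hft : ∀ t ∈ Ioo (-T) T, ∀ x, HasDerivAt (fun t => f t x) (ft t x) t)
    (hfx : ∀ t x, HasDerivAt (f t) (fx t x) x) (cf : Continuous (Function.uncurry f))
    (cft : Continuous (Function.uncurry ft)) (cfx : Continuous (Function.uncurry fx))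
    (bf : BoundedOnSlab T f) (bft : BoundedOnSlab T ft) (bfx : BoundedOnSlab T fx) :
    IsClassC1 T f where
  diff_time t ht x := (hft t ⟨by linarith [ht.1, ht.2], ht.2⟩ x).differentiableAt
    |>.differentiableWithinAt
  diff_space t _ x := (hfx t x).differentiableAt
  cont := cf.continuousOn
  cont_time := cft.continuousOn.congr fun z hz => timeDeriv_eq hft hz.1 z.2
  cont_space := by rw [spaceDeriv_eq hfx]; exact cfx.continuousOn
  bounded T' hT' := by
    obtain ⟨B₁, h₁⟩ := bf
    obtain ⟨B₂, h₂⟩ := bft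
    obtain ⟨B₃, h₃⟩ := bfx
    refine ⟨B₁ + B₂ + B₃, fun t ht x => ?_⟩
    have ht' : t ∈ Icc (-T) T := ⟨by linarith [ht.1, ht.2, hT'.2], by linarith [ht.2, hT'.2]⟩
    rw [spaceDeriv_eq hfx, timeDeriv_eq hft ⟨ht.1, ht.2.trans_lt hT'.2⟩]
    exact add_le_add (add_le_add (h₁ t ht' x) (h₂ t ht' x)) (h₃ t ht' x)

/-- A particle flow with square-integrable field and integrable density perturbation and velocity
gradient yields a classical solution. -/
theorem ParticleFlow.exists_isClassicalSolution {k ν K N L T N' : ℝ} {Γ c cx : ℝ → ℝ → ℝ}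
    {m ρ₀ ρ₀' u₀ u₀' u₀'' : ℝ → ℝ} {X U Y V Z : ℝ → ℝ → ℝ}
    (h : FlowData k ν K N L T Γ (fun t => c (max t 0)) cx m ρ₀ ρ₀' u₀ u₀' u₀'')
    (p : ParticleFlow k ν T Γ (fun t => c (max t 0)) m ρ₀ u₀ u₀' N' X U Y V Z)
    (hfield : ∀ t ∈ Icc (-T) T, MemLp (fun a => Γ t (X t a) - m a) 2 volume)
    {C : ℝ≥0∞} (hC : C < ⊤) (hCle : ∀ t ∈ Icc (-T) T,
      ∫⁻ a, ‖ρ₀ a - c (max t 0) (X t a) * Y t a‖ₑ ≤ C ∧ ∫⁻ a, ‖V t a‖ₑ ≤ C) :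
    ∃ ρ u : ℝ → ℝ → ℝ, IsClassicalSolution k ν c ρ₀ u₀ T ρ u ∧
      (⨆ t ∈ Ico (0 : ℝ) T,
        (eLpNorm (fun x => ρ t x - c t x) 1 volume + eLpNorm (spaceDeriv u t) 1 volume)) < ⊤ := by
  have hT := h.T_pos
  have hI : ∀ {t}, t ∈ Ico 0 T → t ∈ Icc (-T) T := fun ht => ⟨by linarith [ht.1], ht.2.le⟩
  have hYpos : ∀ t a, 0 < Y t a := fun t a => by linarith [p.half_le t a]
  have hY0 : ∀ t a, Y t a ≠ 0 := fun t a => (hYpos t a).ne'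
  have cm : Continuous m := continuous_iff_continuousAt.2 fun x => (h.deriv_m x).continuousAt
  have cρ : Continuous ρ₀ := continuous_iff_continuousAt.2 fun x => (h.deriv_ρ₀ x).continuousAt
  have hXt : ∀ t ∈ Ioo (-T) T, ∀ a, HasDerivAt (fun t => X t a) (U t a) t := fun t ht a =>
    ((p.solves a).hasDerivAt ht).1
  obtain ⟨A, cA, hXA, hAX, hAx, hAt⟩ :=
    exists_inverse_flow p.cont_X p.cont_U p.cont_Y hXt p.deriv_X p.half_le
  have hA0 : ∀ x, A 0 x = x := fun x => by
    have := hXA 0 x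
    rwa [p.X_zero] at this
  have comp : ∀ {F : ℝ → ℝ → ℝ}, Continuous (Function.uncurry F) →
      Continuous (Function.uncurry fun t x => F t (A t x)) := fun hF =>
    hF.comp (continuous_fst.prodMk cA)
  -- Lagrangian time and label derivatives of velocity and density
  set Ut : ℝ → ℝ → ℝ := fun t a => -ν * U t a + -k * (Γ t (X t a) - m a) with hUt
  set R : ℝ → ℝ → ℝ := fun t a => ρ₀ a / Y t a with hR
  -- The iterated quotients let the boundedness rule for division by `Y ≥ 1/2` apply twice.
  set Rt : ℝ → ℝ → ℝ := fun t a => 0 - ρ₀ a * V t a / Y t a / Y t a with hRt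
  set Ra : ℝ → ℝ → ℝ := fun t a => (ρ₀' a - ρ₀ a / Y t a * Z t a) / Y t a with hRa
  have dU : ∀ t ∈ Ioo (-T) T, ∀ a, HasDerivAt (fun t => U t a) (Ut t a) t := fun t ht a =>
    ((p.solves a).hasDerivAt ht).2
  have dR : ∀ t ∈ Ioo (-T) T, ∀ a, HasDerivAt (fun t => R t a) (Rt t a) t := fun t ht a => by
    have := (hasDerivAt_const t (ρ₀ a)).div ((p.solves_deriv a).hasDerivAt ht).1 (hY0 t a)
    refine this.congr_deriv ?_
    have := hY0 t a
    simp only [hRt]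
    field_simp
    ring
  have dRa : ∀ t a, HasDerivAt (R t) (Ra t a) a := fun t a => by
    refine ((h.deriv_ρ₀ a).div (p.deriv_Y t a) (hY0 t a)).congr_deriv ?_
    have := hY0 t a
    simp only [hRa]
    field_simp
  have cR : Continuous (Function.uncurry R) :=
    (cρ.comp continuous_snd).div p.cont_Y fun z => hY0 z.1 z.2
  have cUt : Continuous (Function.uncurry Ut) :=
    (continuous_const.mul p.cont_U).add (continuous_const.mul
      ((p.continuous_comp h.cont_Γ).sub (cm.comp continuous_snd)))
  have cRt : Continuous (Function.uncurry Rt) :=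
    continuous_const.sub ((((cρ.comp continuous_snd).mul p.cont_V).div p.cont_Y
      fun z => hY0 z.1 z.2).div p.cont_Y fun z => hY0 z.1 z.2)
  have cRa : Continuous (Function.uncurry Ra) :=
    ((h.cont_ρ₀'.comp continuous_snd).sub (cR.mul p.cont_Z)).div p.cont_Y fun z => hY0 z.1 z.2
  have bU : BoundedOnSlab T U := ⟨N', fun t _ => p.U_le t⟩
  have bV : BoundedOnSlab T V := ⟨N', fun t _ => p.V_le t⟩
  have bZ : BoundedOnSlab T Z := ⟨N', fun t _ => p.Z_le t⟩
  have bρ : BoundedOnSlab T fun _ => ρ₀ := ⟨N, fun _ _ => h.ρ₀_le⟩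
  have bρ' : BoundedOnSlab T fun _ => ρ₀' := ⟨N, fun _ _ => h.ρ₀'_le⟩
  have bUt : BoundedOnSlab T Ut :=
    ((BoundedOnSlab.const (-ν)).mul bU).add ((BoundedOnSlab.const (-k)).mul ⟨N', p.field_le⟩)
  have bR : BoundedOnSlab T R := bρ.div_of_half_le p.half_le
  have bRt : BoundedOnSlab T Rt := (BoundedOnSlab.const 0).sub
    (((bρ.mul bV).div_of_half_le p.half_le).div_of_half_le p.half_le)
  have bRa : BoundedOnSlab T Ra := (bρ'.sub (bR.mul bZ)).div_of_half_le p.half_le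
  -- Eulerian derivatives
  have ux := fun t => hAx t (U t) (V t) (p.deriv_U t)
  have ρx := fun t => hAx t (R t) (Ra t) (dRa t)
  have ut := hAt U Ut V dU p.deriv_U cUt p.cont_V
  have ρt := hAt R Rt Ra dR dRa cRt cRa
  have ρux : ∀ t x, HasDerivAt (fun x => R t (A t x) * U t (A t x))
      ((Ra t (A t x) * U t (A t x) + R t (A t x) * V t (A t x)) / Y t (A t x)) x := fun t =>
    hAx t (fun a => R t a * U t a) _ fun a => (dRa t a).mul (p.deriv_U t a)
  -- The Eulerian field `∂ₓφ`; differentiating gives `c - ρ`, so the Poisson equation is built in.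
  set e : ℝ → ℝ → ℝ := fun t x => Γ t x - m (A t x) with he
  have dex : ∀ t x, HasDerivAt (e t) (c (max t 0) x - R t (A t x)) x := fun t x =>
    (h.deriv_Γ t x).sub (hAx t m ρ₀ h.deriv_m x)
  have ce : ∀ t, Continuous (e t) := fun t =>
    continuous_iff_continuousAt.2 fun x => (dex t x).continuousAt
  have he2 : ∀ t ∈ Icc (-T) T, MemLp (e t) 2 volume := fun t ht => by
    refine memLp_two_of_lintegral_sq_lt_top (ce t).aestronglyMeasurable ?_
    rw [lintegral_eq_lintegral_comp_flow (p.deriv_X t) (p.half_le t)]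
    refine lt_of_le_of_lt ?_ (ENNReal.mul_lt_top (ENNReal.ofNat_lt_top (n := 2))
      (lintegral_sq_lt_top_of_memLp (hfield t ht)))
    rw [← lintegral_const_mul' _ _ (by simp)]
    refine lintegral_mono fun a => mul_le_mul' ?_ ?_
    · rw [← ENNReal.ofReal_ofNat]
      exact ENNReal.ofReal_le_ofReal (p.le_two t a)
    · rw [he]
      simp only [hAX]
      exact le_rfl
  -- The Jacobian `Y` cancels the denominator of the density: `(ρ₀/Y - c) Y = ρ₀ - cY`.
  have hρc : ∀ t ∈ Icc (-T) T, ∫⁻ x, ‖R t (A t x) - c (max t 0) x‖ₑ ≤ C := fun t ht => by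
    rw [lintegral_eq_lintegral_comp_flow (p.deriv_X t) (p.half_le t)]
    refine le_trans (lintegral_mono fun a => ?_) (hCle t ht).1
    have h0 := hY0 t a
    rw [hAX, ← Real.enorm_of_nonneg (hYpos t a).le, ← enorm_mul]
    refine le_of_eq (congrArg _ ?_)
    simp only [hR]
    field_simp
  have hux : ∀ t ∈ Icc (-T) T, ∫⁻ x, ‖V t (A t x) / Y t (A t x)‖ₑ ≤ C := fun t ht => by
    rw [lintegral_eq_lintegral_comp_flow (p.deriv_X t) (p.half_le t)]
    refine le_trans (lintegral_mono fun a => ?_) (hCle t ht).2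
    have h0 := hY0 t a
    rw [hAX, ← Real.enorm_of_nonneg (hYpos t a).le, ← enorm_mul]
    refine le_of_eq (congrArg _ ?_)
    field_simp
  have cρc : ∀ t, Continuous fun x => R t (A t x) - c (max t 0) x := fun t =>
    ((comp cR).comp (continuous_const.prodMk continuous_id)).sub
      (h.cont_cb.comp (continuous_const.prodMk continuous_id))
  have hint : ∀ t ∈ Icc (-T) T, Integrable fun x => R t (A t x) - c (max t 0) x := fun t ht =>
    ⟨(cρc t).aestronglyMeasurable, (hρc t ht).trans_lt hC⟩
  have hmax : ∀ {t}, t ∈ Ico 0 T → max t 0 = t := fun ht => max_eq_left ht.1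
  refine ⟨fun t x => R t (A t x), fun t x => U t (A t x), ⟨?_, ?_, ?_, ?_, ?_, ?_, ?_⟩, ?_⟩
  · exact isClassC1_of_hasDerivAt ρt ρx (comp cR)
      ((comp cRt).sub ((comp p.cont_U).mul ((comp cRa).div (comp p.cont_Y) fun z => hY0 _ _)))
      ((comp cRa).div (comp p.cont_Y) fun z => hY0 _ _) (bR.comp A)
      ((bRt.comp A).sub ((bU.comp A).mul
        ((bRa.comp A).div_of_half_le fun t x => p.half_le t (A t x))))
      ((bRa.comp A).div_of_half_le fun t x => p.half_le t (A t x))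
  · exact isClassC1_of_hasDerivAt ut ux (comp p.cont_U)
      ((comp cUt).sub ((comp p.cont_U).mul ((comp p.cont_V).div (comp p.cont_Y) fun z => hY0 _ _)))
      ((comp p.cont_V).div (comp p.cont_Y) fun z => hY0 _ _) (bU.comp A)
      ((bUt.comp A).sub ((bU.comp A).mul
        ((bV.comp A).div_of_half_le fun t x => p.half_le t (A t x))))
      ((bV.comp A).div_of_half_le fun t x => p.half_le t (A t x))
  · intro t ht x
    rw [timeDeriv_eq ρt ht, spaceDeriv_eq (f := fun τ y => R τ (A τ y) * U τ (A τ y)) ρux]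
    have h0 := hY0 t (A t x)
    simp only [hRt, hR]
    field_simp
    ring
  · refine ⟨fun t x => ∫ y in (0 : ℝ)..x, e t y, fun t ht => ?_⟩
    have hφ : spaceDeriv (fun t x => ∫ y in (0 : ℝ)..x, e t y) = e :=
      spaceDeriv_eq fun t x => (ce t).integral_hasStrictDerivAt 0 x |>.hasDerivAt
    rw [hφ]
    refine ⟨fun x => ((ce t).integral_hasStrictDerivAt 0 x).hasDerivAt.differentiableAt,
      fun x => (dex t x).differentiableAt, he2 t (hI ht), fun x => ?_, fun x => ?_⟩
    · rw [spaceDeriv_eq dex]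
      simp only [hmax ht]
      ring
    · rw [timeDeriv_eq ut ht, spaceDeriv_eq ux]
      simp only [hUt, he, hXA]
      ring
  · intro x
    simp only [hA0, hR, p.Y_zero, div_one]
  · intro x
    simp only [hA0, p.U_zero]
  · intro t ht
    have hi := hint t (hI ht)
    have hi' : Integrable fun x => c (max t 0) x - R t (A t x) :=
      hi.neg.congr (Eventually.of_forall fun x => by simp)
    have hz := integral_eq_zero_of_hasDerivAt_of_memLp_two (dex t) hi' (he2 t (hI ht))
    rw [hmax ht] at hi hz
    refine ⟨hi, ?_⟩
    rw [← neg_eq_zero, ← integral_neg, ← hz]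
    exact integral_congr_ae (Eventually.of_forall fun x => by simp)
  · refine lt_of_le_of_lt (iSup₂_le fun t ht => ?_) (ENNReal.add_lt_top.2 ⟨hC, hC⟩)
    rw [spaceDeriv_eq ux, eLpNorm_one_eq_lintegral_enorm, eLpNorm_one_eq_lintegral_enorm]
    refine add_le_add ?_ (hux t (hI ht))
    have := hρc t (hI ht)
    rwa [hmax ht] at this

/-! ### Choice of the Lagrangian data and conclusion -/

theorem hasDerivAt_integral_Iic {f : ℝ → ℝ} (hf : Integrable f) (cf : Continuous f) (x : ℝ) :
    HasDerivAt (fun x => ∫ y in Iic x, f y) (f x) x := by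
  have e : (fun x => ∫ y in Iic x, f y) = fun x => (∫ y in Iic 0, f y) + ∫ y in (0 : ℝ)..x, f y := by
    ext x
    rw [← intervalIntegral.integral_Iic_sub_Iic hf.integrableOn hf.integrableOn]
    ring
  rw [e]
  exact (cf.integral_hasStrictDerivAt 0 x).hasDerivAt.const_add _

theorem abs_integral_Iic_le {f : ℝ → ℝ} (hf : Integrable f) (x : ℝ) :
    |∫ y in Iic x, f y| ≤ ∫ y, |f y| :=
  (norm_integral_le_integral_norm _).trans
    (setIntegral_le_integral hf.norm (Eventually.of_forall fun _ => norm_nonneg _))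

theorem theorem1p3 (s : ℝ) (hs : 2 ≤ s) (k ν : ℝ) (hk : k = 1 ∨ k = -1) (hν : 0 ≤ ν)
    (cmin cmax : ℝ) (c : ℝ → ℝ → ℝ) (hc : IsBackground s cmin cmax c)
    (ρ₀ u₀ : ℝ → ℝ) (hρ₀_cont : Continuous ρ₀) (hu₀_cont : Continuous u₀)
    (hρ₀_Hs : sobolevENorm s (fun x => ρ₀ x - c 0 x) < ⊤)
    (hρ₀_Hneg : homSobolevNegOneENorm (fun x => ρ₀ x - c 0 x) < ⊤)
    (hρ₀_L1 : Integrable (fun x => ρ₀ x - c 0 x) volume)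
    (hu₀_Hs : sobolevENorm (s + 1) u₀ < ⊤)
    (hu₀_BV : BoundedVariationOn u₀ univ) :
    ∃ T : ℝ, 0 < T ∧ ∃ ρ u : ℝ → ℝ → ℝ,
      IsClassicalSolution k ν c ρ₀ u₀ T ρ u ∧
      (⨆ t ∈ Ico (0 : ℝ) T,
        (eLpNorm (fun x => ρ t x - c t x) 1 volume + eLpNorm (spaceDeriv u t) 1 volume)) < ⊤ := by
  have hk1 : |k| ≤ 1 := by rcases hk with rfl | rfl <;> simp
  have hcmax : 0 ≤ cmax :=
    hc.cmin_pos.le.trans ((hc.lower 0 le_rfl 0).trans (hc.upper 0 le_rfl 0))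
  have hmax0 : ∀ t : ℝ, 0 ≤ max t 0 := fun t => le_max_right _ _
  have hcb : ∀ t x, |c (max t 0) x| ≤ cmax := fun t x =>
    abs_le.2 ⟨by linarith [hc.lower _ (hmax0 t) x, hc.cmin_pos], hc.upper _ (hmax0 t) x⟩
  obtain ⟨cx, L, hL, ccx, dcx, bcx, hcx0⟩ := hc.exists_spaceDeriv hs
  obtain ⟨M, hM1, hM2⟩ := hc.exists_time_bounds hs
  have cc0 : Continuous (c 0) := hc.continuous_slice le_rfl
  have dc0 : ∀ x, HasDerivAt (c 0) (cx 0 x) x := fun x => by simpa using dcx 0 x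
  have hc0 : ∀ x, |c 0 x| ≤ cmax := fun x => by simpa using hcb 0 x
  -- initial density
  obtain ⟨g, g', hg0, hgc, hgd, C₁, hC₁, hgb⟩ : ∃ g g' : ℝ → ℝ, (∀ x, ρ₀ x - c 0 x = g x) ∧
      Continuous g' ∧ (∀ x, HasDerivAt g (g' x) x) ∧ ∃ C₁ : ℝ, 0 ≤ C₁ ∧
        ∀ x, |g x| ≤ C₁ ∧ |g' x| ≤ C₁ := by
    obtain ⟨C, hC⟩ := exists_continuous_derivs_of_sobolevENorm_le 1 (s := s)
      (by norm_num; exact hs)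
    obtain ⟨g, hg0, hg, hgd⟩ := hC _ _ (ENNReal.coe_toNNReal hρ₀_Hs.ne).ge
    -- Continuous functions that agree almost everywhere are equal, so the regularity holds for the
    -- given data and not merely for a representative.
    have e := (Continuous.ae_eq_iff_eq volume (hρ₀_cont.sub cc0) (hg 0 (by norm_num)).1).1 hg0
    exact ⟨g 0, g 1, fun x => congrFun e x, (hg 1 le_rfl).1, hgd 0 (by norm_num), _,
      by positivity, fun x => ⟨(hg 0 (by norm_num)).2 x, (hg 1 le_rfl).2 x⟩⟩
  have dρ : ∀ x, HasDerivAt ρ₀ (g' x + cx 0 x) x := fun x => by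
    have e : ρ₀ = fun x => g x + c 0 x := by
      ext x; rw [← hg0]; ring
    rw [e]
    exact (hgd x).add (dc0 x)
  -- initial velocity
  obtain ⟨u₁, u₂, cu₁, cu₂, du, du₁, C₂, hC₂, hub⟩ : ∃ u₁ u₂ : ℝ → ℝ, Continuous u₁ ∧
      Continuous u₂ ∧ (∀ x, HasDerivAt u₀ (u₁ x) x) ∧ (∀ x, HasDerivAt u₁ (u₂ x) x) ∧
      ∃ C₂ : ℝ, 0 ≤ C₂ ∧ ∀ x, |u₀ x| ≤ C₂ ∧ |u₁ x| ≤ C₂ ∧ |u₂ x| ≤ C₂ := by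
    obtain ⟨C, hC⟩ := exists_continuous_derivs_of_sobolevENorm_le 2 (s := s + 1)
      (by norm_num; linarith)
    obtain ⟨v, hv0, hv, hvd⟩ := hC _ _ (ENNReal.coe_toNNReal hu₀_Hs.ne).ge
    have e := (Continuous.ae_eq_iff_eq volume hu₀_cont (hv 0 (by norm_num)).1).1 hv0
    subst e
    exact ⟨v 1, v 2, (hv 1 (by norm_num)).1, (hv 2 le_rfl).1, hvd 0 (by norm_num),
      hvd 1 (by norm_num), _, by positivity, fun x => ⟨(hv 0 (by norm_num)).2 x,
        (hv 1 (by norm_num)).2 x, (hv 2 le_rfl).2 x⟩⟩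
  have hu₁ : Integrable u₁ := integrable_of_hasDerivAt_of_boundedVariationOn du cu₁ hu₀_BV
  have hu2 : MemLp u₀ 2 volume := ⟨hu₀_cont.aestronglyMeasurable,
    (eLpNorm_two_le_of_sobolevENorm_le (by linarith)
      (ENNReal.coe_toNNReal hu₀_Hs.ne).ge).trans_lt ENNReal.coe_lt_top⟩
  -- initial field
  set e₀ : ℝ → ℝ := fun x => -∫ y in Iic x, (ρ₀ y - c 0 y) with he₀
  have he2 : MemLp e₀ 2 volume := (eLpNorm_integral_Iic_le_of_homSobolevNegOneENorm_le
    (by linarith) hρ₀_L1 hρ₀_Hs (ENNReal.coe_toNNReal hρ₀_Hneg.ne).ge).1.neg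
  set I : ℝ := ∫ y, |ρ₀ y - c 0 y| with hI
  have hI0 : 0 ≤ I := integral_nonneg fun _ => abs_nonneg _
  have he₀I : ∀ x, |e₀ x| ≤ I := fun x => by
    rw [he₀, abs_neg]; exact abs_integral_Iic_le hρ₀_L1 x
  -- antiderivative of the background
  set C₀ : ℝ → ℝ := fun x => ∫ y in (0 : ℝ)..x, c 0 y with hC₀
  set B : ℝ → ℝ → ℝ := fun t x => ∫ y in Iic x, (c (max t 0) y - c 0 y) with hB
  set Γ : ℝ → ℝ → ℝ := fun t x => C₀ x + B t x with hΓ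
  -- The normalisation makes `Γ(0,·) - m = e₀` the initial field; since `e₀' = c(0) - ρ₀`, the
  -- derivative of `m` is `ρ₀`.
  set m : ℝ → ℝ := fun x => C₀ x - e₀ x with hm
  have cΓ : Continuous (Function.uncurry Γ) := hc.continuous_antideriv hs
  have dC₀ : ∀ x, HasDerivAt C₀ (c 0 x) x := fun x =>
    (cc0.integral_hasStrictDerivAt 0 x).hasDerivAt
  have cC₀ : Continuous C₀ := continuous_iff_continuousAt.2 fun x => (dC₀ x).continuousAt
  have cB : Continuous (Function.uncurry B) := by
    refine (cΓ.sub (cC₀.comp continuous_snd)).congr fun z => ?_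
    simp [Function.uncurry, hΓ]
  have dm : ∀ x, HasDerivAt m (ρ₀ x) x := fun x => by
    refine ((dC₀ x).sub (hasDerivAt_integral_Iic hρ₀_L1 (hρ₀_cont.sub cc0) x).neg).congr_deriv ?_
    ring
  have hmaxle : ∀ {t T : ℝ}, t ∈ Icc (-T) T → T ≤ 1 → max t 0 ≤ 1 := fun ht hT =>
    max_le (ht.2.trans hT) zero_le_one
  have hcM : ∀ t, max t 0 ≤ 1 → ∫⁻ x, ‖c (max t 0) x - c 0 x‖ₑ ≤ M := fun t ht => by
    refine (hM1 0 _ le_rfl (hmax0 t)).trans (mul_le_of_le_one_right' ?_)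
    rw [sub_zero]
    exact ENNReal.ofReal_le_one.2 ht
  have hBM : ∀ t, max t 0 ≤ 1 → ∫⁻ x, ‖B t x‖ₑ ^ 2 ≤ (M : ℝ≥0∞) ^ 2 := fun t ht =>
    (hM2 _ (hmax0 t)).trans (pow_le_pow_left' (mul_le_of_le_one_right'
      (ENNReal.ofReal_le_one.2 ht)) 2)
  have hBb : ∀ t, max t 0 ≤ 1 → ∀ x, |B t x| ≤ M := fun t ht x => by
    have h1 := (enorm_integral_le_lintegral_enorm _).trans
      ((setLIntegral_le_lintegral (Iic x) fun y => ‖c (max t 0) y - c 0 y‖ₑ).trans (hcM t ht))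
    rw [← ofReal_norm, ENNReal.ofReal_le_iff_le_toReal ENNReal.coe_ne_top] at h1
    exact h1
  -- size of the data and lifespan
  set N : ℝ := C₁ + C₂ + cmax + L + M + I with hN
  have hM0 : (0 : ℝ) ≤ M := M.2
  have hN0 : 0 ≤ N := by positivity
  -- With `T = 1/D`, the first summand gives `small`, the second gives `small'`, and `D ≥ 4` gives
  -- `T ≤ 1`.
  set D : ℝ := 4 * (1 + |ν| + cmax) + 4 * (3 * N + 2 * cmax) with hD
  have hD4 : 4 ≤ D := by
    have := abs_nonneg ν
    linarith
  have hD0 : 0 < D := by linarith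
  set T : ℝ := 1 / D with hT
  have hTD : T * D = 1 := by rw [hT]; field_simp
  have hT0 : 0 < T := by positivity
  have hT1 : T ≤ 1 := by rw [hT, div_le_one hD0]; linarith
  have hTN : 0 ≤ T * (3 * N + 2 * cmax) := by positivity
  have hTK : 0 ≤ T * (1 + |ν| + cmax) := by positivity
  have hTD' : 4 * (T * (1 + |ν| + cmax)) + 4 * (T * (3 * N + 2 * cmax)) = 1 :=
    Eq.trans (by rw [hD]; ring) hTD
  have data : FlowData k ν cmax N L T Γ (fun t => c (max t 0)) cx m ρ₀ (fun x => g' x + cx 0 x)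
      u₀ u₁ u₂ :=
    { abs_k_le := hk1
      T_pos := hT0
      T_le_one := hT1
      K_nonneg := hcmax
      small := by linarith
      small' := by
        have : T * (2 * (3 * N + 2 * cmax)) = 2 * (T * (3 * N + 2 * cmax)) := by ring
        linarith
      cont_Γ := cΓ
      cont_cb := hc.continuous_clamped
      cont_cx := ccx
      deriv_Γ := fun t x => hc.hasDerivAt_antideriv hs (hmax0 t) x
      deriv_cb := dcx
      deriv_m := dm
      deriv_ρ₀ := dρ
      deriv_u₀ := du
      deriv_u₀' := du₁
      cont_ρ₀' := hgc.add (ccx.comp (continuous_const.prodMk continuous_id))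
      cont_u₀'' := cu₂
      cb_le := hcb
      cx_le := bcx
      ρ₀_le := fun x => by
        have e : ρ₀ x = g x + c 0 x := by rw [← hg0]; ring
        rw [e]
        have := abs_add_le (g x) (c 0 x)
        linarith [(hgb x).1, hc0 x]
      ρ₀'_le := fun x => by
        have := abs_add_le (g' x) (cx 0 x)
        linarith [(hgb x).2, bcx 0 x]
      u₀_le := fun x => by linarith [(hub x).1]
      u₀'_le := fun x => by linarith [(hub x).2.1]
      u₀''_le := fun x => by linarith [(hub x).2.2]
      field_le := fun t ht x => by
        have e : Γ t x - m x = B t x + e₀ x := by simp only [hΓ, hm]; ring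
        rw [e]
        have := abs_add_le (B t x) (e₀ x)
        linarith [hBb t (hmaxle ht hT1) x, he₀I x] }
  obtain ⟨N', X, U, Y, V, Z, p⟩ := data.exists_particleFlow
  obtain ⟨⟨S, hS, hUS⟩, hfield⟩ := p.exists_memLp_two_bound hT0 hcmax hk1 data.small
    (fun _ _ => rfl) (fun _ => rfl) (abs_sub_le_of_hasDerivAt_le dC₀ hc0) cB
    (ENNReal.pow_ne_top ENNReal.coe_ne_top) (fun t ht => hBM t (hmaxle ht hT1)) hu2 he2
  obtain ⟨C, hC, hCle⟩ := p.exists_lintegral_bound hT0 hcmax hk1 data.small data.cont_cb hcb dc0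
    (ccx.comp (continuous_const.prodMk continuous_id)) hcx0 hS hUS ENNReal.coe_ne_top
    (fun t ht => hcM t (hmaxle ht hT1)) hρ₀_L1 hρ₀_cont hu₁
  exact ⟨T, hT0, p.exists_isClassicalSolution data hfield hC hCle⟩
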